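/- **Setting.** Let $F$ be one of the functions $$F^{(1)}(z)=\frac{\Gamma(z)}{\prod_{j=1}^r\Gamma(1+\nu_j-z)},\qquad F^{(2)}(z)=\frac{\Gamma(z)\prod_{k=1}^q\Gamma(1+\mu_k-z)}{\prod_{j=1}^r\Gamma(1+\nu_j-z)},\qquad F^{(3)}(z)=\frac{\Gamma(z+\frac\alpha2)}{\Gamma\big(\frac{\alpha/2+1-z}{\theta}\big)},$$ where $r\ge 1$ and $\nu_1,\dots,\nu_r\in\{0,1,2,\dots\}$; in the second case $0\le q<r$ and $\mu_1,\dots,\mu_q$ are integers with $\mu_k>\nu_k$; in the third case $\alpha>-1$ and $\theta>0$. Let $\gamma$ and $\tilde\gamma$ be simple, locally rectifiable curves, oriented upwards, with $\operatorname{Im}z\to\pm\infty$ at their two ends and with length $O(R)$ inside the disc of radius $R$ as $R\to\infty$, such that: $\gamma$ lies in $\operatorname{Re}z<\frac12$ and $\tilde\gamma$ in $\operatorname{Re}z>\frac12$; near infinity they lie in sectors $\operatorname{Re}z\le -c|\operatorname{Im}z|$, respectively $\operatorname{Re}z\ge c|\operatorname{Im}z|$, for some $c>0$; all poles of $F$ lie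 to the left of $\gamma$ and all zeros of $F$ lie to the right of $\tilde\gamma$. The Fredholm determinant of a kernel $K$ on a contour $\Sigma$ is $\det(1-K)=\sum_{n\ge0}\frac{(-1)^n}{n!}\int_{\Sigma^n}\det(K(z_i,z_j))_{i,j=1}^n\,dz_1\cdots dz_n$. **Proposition.** Let $s>0$. Let $\mathbb H_s$ be the integral operator on functions on $\tilde\gamma$ given by $$(\mathbb H_s\varphi)(z)=\int_{\tilde\gamma}\mathbb H_s(v,z)\varphi(v)\,\frac{dv}{2\pi i},\qquad \mathbb H_s(v,z)=\int_\gamma\frac{du}{2\pi i}\,\frac{s^{z-u}F(u)}{F(v)(v-u)(z-u)},$$ so that its kernel with respect to $dv$ is $\frac1{2\pi i}\mathbb H_s(v,z)$, and let $\mathbb M_s$ be the integral operator on functions on $\gamma\cup\tilde\gamma$ given by $(\mathbb M_s\varphi)(u)=\int_{\gamma\cup\tilde\gamma}\mathbb M_s(u,v)\varphi(v)\,dv$ with $$\mathbb M_s(u,v)=\frac{\mathbf f(u)^T\mathbf g(v)}{u-v},\qquad \mathbf f(u)=\frac1{2\pi i}\begin{pmatrix}\chi_\gamma(u)\\ s^u\chi_{\tilde\gamma}(u)\end{pmatrix},\qquad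 \mathbf g(v)=\begin{pmatrix}-F(v)^{-1}\chi_{\tilde\gamma}(v)\\ s^{-v}F(v)\chi_\gamma(v)\end{pmatrix},$$ where $\chi$ denotes a characteristic function and $\mathbb M_s(u,u):=0$. Then: 1. The integrals defining $\mathbb H_s(v,z)$, $v,z\in\tilde\gamma$, converge absolutely, $\mathbf f(u)^T\mathbf g(u)=0$ for all $u$, all integrals in the Fredholm series of $\mathbb H_s$ and $\mathbb M_s$ and the series themselves converge absolutely, and $$\det(1-\mathbb H_s)=\det(1-\mathbb M_s).$$ 2. For $\sigma>0$ let $L^2_\sigma(\tilde\gamma)=L^2(\tilde\gamma,|\sigma^{-z}|^2|dz|)$ and $L^2_\sigma(\gamma\cup\tilde\gamma)=L^2(\gamma,|dz|)\oplus L^2_\sigma(\tilde\gamma)$; for $\sigma=1$ these are the usual spaces. For every $\sigma\ge s$ the formulas $$(Ag)(z)=\int_\gamma\frac{s^{z-u}F(u)}{2\pi i(z-u)}g(u)\,du,\qquad (Bh)(u)=\int_{\tilde\gamma}\frac{h(v)}{2\pi i\,F(v)(v-u)}\,dv$$ define trace class operators $A:L^2(\gamma)\to L^2_\sigma(\tilde\gamma)$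 and $B:L^2_\sigma(\tilde\gamma)\to L^2(\gamma)$; $\mathbb H_s$ and $\mathbb M_s$ are trace class on $L^2_\sigma(\tilde\gamma)$ and $L^2_\sigma(\gamma\cup\tilde\gamma)$; $\mathbb H_s=A\circ B$; and with respect to the decomposition $L^2_\sigma(\tilde\gamma)\oplus L^2(\gamma)$ one has $\mathbb M_s=\begin{pmatrix}0&A\\ B&0\end{pmatrix}$. -/

import Mathlib

open Set Filter Topology MeasureTheory Complex

noncomputable section

namespace HardEdge

/-! ### The functions `F` of the three models -/

/-- The parameters of the three models: products of `r ≥ 1` Ginibre matrices; products of `r`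
truncated unitary matrices, `q < r` of which have parameters `μ k > ν k`; Muttalib-Borodin
Laguerre ensembles. -/
inductive Model : Type
  | ginibre (r : ℕ) (hr : 1 ≤ r) (ν : Fin r → ℕ) : Model
  | truncatedUnitary (r q : ℕ) (hq : q < r) (ν : Fin r → ℕ) (μ : Fin q → ℕ)
      (hμ : ∀ k : Fin q, ν (Fin.castLE hq.le k) < μ k) : Model
  | muttalibBorodin (α θ : ℝ) (hα : -1 < α) (hθ : 0 < θ) : Model

/-- The functions `F⁽¹⁾, F⁽²⁾, F⁽³⁾`. -/
def Model.F : Model → ℂ → ℂ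
  | .ginibre _ _ ν => fun z => Gamma z / ∏ j, Gamma (1 + (ν j : ℂ) - z)
  | .truncatedUnitary _ _ _ ν μ _ => fun z =>
      (Gamma z * ∏ k, Gamma (1 + (μ k : ℂ) - z)) / ∏ j, Gamma (1 + (ν j : ℂ) - z)
  | .muttalibBorodin α θ _ _ => fun z =>
      Gamma (z + (α : ℂ) / 2) / Gamma (((α : ℂ) / 2 + 1 - z) / (θ : ℂ))

/-! ### Contours -/

/-- Arc length `|dz|` on the curve `c`, as a measure on `ℂ`. -/
def arcMeasure (c : ℝ → ℂ) : Measure ℂ :=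
  (volume.withDensity fun t => ‖deriv c t‖ₑ).map c

/-- The measure `|σ ^ (-z)|² |dz|` on the curve `c`; for `σ = 1` this is arc length. -/
def weightedArcMeasure (σ : ℝ) (c : ℝ → ℂ) : Measure ℂ :=
  (arcMeasure c).withDensity fun z => ENNReal.ofReal (σ ^ (-2 * z.re))

/-- A simple, locally rectifiable curve (given by an injective locally Lipschitz parametrization)
that runs upwards from infinity to infinity and whose length inside the disc of radius `R` is
`O(R)`. -/
structure IsUpwardContour (c : ℝ → ℂ) : Prop where
  locallyLipschitz : LocallyLipschitz c
  injective : Function.Injective c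
  tendsto_top : Tendsto (fun t => (c t).im) atTop atTop
  tendsto_bot : Tendsto (fun t => (c t).im) atBot atBot
  length_le : ∃ C : ℝ, ∀ R : ℝ, 1 ≤ R →
    arcMeasure c (Metric.closedBall 0 R) ≤ ENNReal.ofReal (C * R)

/-- The points `p` and `q` lie on different sides of the curve `c`. -/
def Separates (c : ℝ → ℂ) (p q : ℂ) : Prop :=
  p ∉ range c ∧ q ∉ range c ∧ q ∉ connectedComponentIn (range c)ᶜ p

/-- The standing assumptions on the contours `γ` and `γ'` for a given function `F`: the line
`Re z = 1/2` lies between them (`γ` on its left, `γ'` on its right), they go to infinity within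
sectors lying strictly in the left, respectively right, half plane, all poles of `F` lie to the
left of `γ`, and all zeros of `F` lie to the right of `γ'`. -/
structure IsContourPair (F : ℂ → ℂ) (γ γ' : ℝ → ℂ) : Prop where
  contour_left : IsUpwardContour γ
  contour_right : IsUpwardContour γ'
  re_lt : ∀ t, (γ t).re < 1 / 2
  lt_re : ∀ t, 1 / 2 < (γ' t).re
  sector_left : ∃ c : ℝ, 0 < c ∧ ∀ᶠ t in cocompact ℝ, (γ t).re ≤ -(c * |(γ t).im|)
  sector_right : ∃ c : ℝ, 0 < c ∧ ∀ᶠ t in cocompact ℝ, c * |(γ' t).im| ≤ (γ' t).re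
  poles_left : ∀ p : ℂ, meromorphicOrderAt F p < 0 → Separates γ (1 / 2) p
  zeros_right : ∀ p : ℂ, 0 < meromorphicOrderAt F p → Separates γ' (1 / 2) p

/-! ### Integration over a finite union of disjoint curves

`Γ : Fin k → ℝ → ℂ` is the union of the oriented curves `Γ 0, …, Γ (k - 1)`, with parameter space
`Fin k × ℝ`. -/

/-- The measure on the parameter space. -/
def paramMeasure (k : ℕ) : Measure (Fin k × ℝ) :=
  (Measure.count : Measure (Fin k)).prod volume

/-- The point of the contour with the given parameter. -/
def point {k : ℕ} (Γ : Fin k → ℝ → ℂ) (p : Fin k × ℝ) : ℂ := Γ p.1 p.2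

/-- The complex line element `dz`. -/
def lineElement {k : ℕ} (Γ : Fin k → ℝ → ℂ) (p : Fin k × ℝ) : ℂ := deriv (Γ p.1) p.2

/-- The integral of `f` along the contour converges absolutely. -/
def ContourIntegrable {k : ℕ} (Γ : Fin k → ℝ → ℂ) (f : ℂ → ℂ) : Prop :=
  Integrable (fun p => f (point Γ p) * lineElement Γ p) (paramMeasure k)

/-- `∫_Γ f(z) dz`. -/
def contourIntegral {k : ℕ} (Γ : Fin k → ℝ → ℂ) (f : ℂ → ℂ) : ℂ :=
  ∫ p, f (point Γ p) * lineElement Γ p ∂(paramMeasure k)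

/-! ### Fredholm determinants -/

/-- `det (K(z_i, z_j))_{i,j=1}^n dz_1 ⋯ dz_n` in terms of the parameters. -/
def fredholmMinor {k : ℕ} (Γ : Fin k → ℝ → ℂ) (K : ℂ → ℂ → ℂ) (n : ℕ)
    (p : Fin n → Fin k × ℝ) : ℂ :=
  (Matrix.of fun i j => K (point Γ (p i)) (point Γ (p j))).det * ∏ i, lineElement Γ (p i)

/-- The term `(-1)^n / n! ∫_{Γ^n} det (K(z_i, z_j)) dz_1 ⋯ dz_n` of the Fredholm series. -/
def fredholmTerm {k : ℕ} (Γ : Fin k → ℝ → ℂ) (K : ℂ → ℂ → ℂ) (n : ℕ) : ℂ :=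
  (-1) ^ n / (n.factorial : ℂ) *
    ∫ p, fredholmMinor Γ K n p ∂(Measure.pi fun _ : Fin n => paramMeasure k)

/-- The Fredholm determinant of `K` over `Γ` is well defined: all integrals in the Fredholm series,
and the series itself, converge absolutely. -/
def FredholmConvergent {k : ℕ} (Γ : Fin k → ℝ → ℂ) (K : ℂ → ℂ → ℂ) : Prop :=
  (∀ n : ℕ, Integrable (fredholmMinor Γ K n) (Measure.pi fun _ : Fin n => paramMeasure k)) ∧
    Summable fun n : ℕ => ‖fredholmTerm Γ K n‖

/-- The Fredholm determinant `det (1 - K)` of the integral operator with kernel `K(z, w)` with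
respect to `dw` on the contour `Γ`. -/
def fredholmDet {k : ℕ} (Γ : Fin k → ℝ → ℂ) (K : ℂ → ℂ → ℂ) : ℂ :=
  ∑' n : ℕ, fredholmTerm Γ K n

/-! ### Operators -/

/-- Trace class operators between Hilbert spaces: absolutely convergent sums of operators of
rank one. -/
def IsTraceClass {E G : Type*} [NormedAddCommGroup E] [InnerProductSpace ℂ E]
    [NormedAddCommGroup G] [InnerProductSpace ℂ G] (T : E →L[ℂ] G) : Prop :=
  ∃ (x : ℕ → E) (y : ℕ → G), (Summable fun n => ‖x n‖ * ‖y n‖) ∧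
    ∀ φ : E, HasSum (fun n => inner ℂ (x n) φ • y n) (T φ)

/-- `T` is the integral operator `(T φ)(z) = ∫_Γ K(z, w) φ(w) dw`, with absolutely convergent
integrals; `μ` is a measure on `Γ`. -/
def IsIntegralOperator {k : ℕ} (Γ : Fin k → ℝ → ℂ) (K : ℂ → ℂ → ℂ) {μ ν : Measure ℂ}
    (T : Lp ℂ 2 μ →L[ℂ] Lp ℂ 2 ν) : Prop :=
  ∀ φ : Lp ℂ 2 μ, ∀ᵐ z ∂ν, ContourIntegrable Γ (fun w => K z w * φ w) ∧
    T φ z = contourIntegral Γ fun w => K z w * φ w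

/-! ### The kernels -/

/-- The integrand of `H_s(v, z)`. -/
def HIntegrand (F : ℂ → ℂ) (s : ℝ) (v z u : ℂ) : ℂ :=
  (2 * Real.pi * I)⁻¹ * ((s : ℂ) ^ (z - u) * F u / (F v * (v - u) * (z - u)))

/-- `H_s(v, z) = ∫_γ du/(2πi) s^(z-u) F(u) / (F(v) (v-u) (z-u))`. -/
def HKernel (F : ℂ → ℂ) (s : ℝ) (γ : ℝ → ℂ) (v z : ℂ) : ℂ :=
  contourIntegral ![γ] (HIntegrand F s v z)

/-- The operator `H_s` is `(H_s φ)(z) = ∫_γ' H_s(v, z) φ(v) dv/(2πi)`; this is its kernel with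
respect to `dv`, the output variable coming first. -/
def HOpKernel (F : ℂ → ℂ) (s : ℝ) (γ : ℝ → ℂ) (z v : ℂ) : ℂ :=
  (2 * Real.pi * I)⁻¹ * HKernel F s γ v z

/-- `f(u) = (1/2πi) (χ_γ(u), s^u χ_γ'(u))`. -/
def fVec (s : ℝ) (γ γ' : ℝ → ℂ) (u : ℂ) : Fin 2 → ℂ :=
  (2 * Real.pi * I)⁻¹ •
    ![(range γ).indicator (fun _ => (1 : ℂ)) u,
      (s : ℂ) ^ u * (range γ').indicator (fun _ => (1 : ℂ)) u]

/-- `g(v) = (-F(v)⁻¹ χ_γ'(v), s^(-v) F(v) χ_γ(v))`. -/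
def gVec (F : ℂ → ℂ) (s : ℝ) (γ γ' : ℝ → ℂ) (v : ℂ) : Fin 2 → ℂ :=
  ![-(F v)⁻¹ * (range γ').indicator (fun _ => (1 : ℂ)) v,
    (s : ℂ) ^ (-v) * F v * (range γ).indicator (fun _ => (1 : ℂ)) v]

/-- `M_s(u, v) = f(u)ᵀ g(v) / (u - v)`; on the diagonal this is `0 / 0 = 0`, which is the continuous
extension since `fᵀ g` vanishes whenever `u` and `v` lie on the same curve. -/
def MKernel (F : ℂ → ℂ) (s : ℝ) (γ γ' : ℝ → ℂ) (u v : ℂ) : ℂ :=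
  (fVec s γ γ' u ⬝ᵥ gVec F s γ γ' v) / (u - v)

/-- Kernel of `A : L²(γ) → L²(γ')`, with `z` on `γ'` and `u` on `γ`. -/
def AKernel (F : ℂ → ℂ) (s : ℝ) (z u : ℂ) : ℂ :=
  (s : ℂ) ^ (z - u) * F u / (2 * Real.pi * I * (z - u))

/-- Kernel of `B : L²(γ') → L²(γ)`, with `u` on `γ` and `v` on `γ'`. -/
def BKernel (F : ℂ → ℂ) (u v : ℂ) : ℂ :=
  1 / (2 * Real.pi * I * F v * (v - u))

end HardEdge

end

noncomputable section

namespace HardEdge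

section

/-! ### Bounds for the Gamma function -/

/-! `M` exchanges the two contours: it takes functions on `γ` to functions on `γ'` by `A`, and
functions on `γ'` to functions on `γ` by `B`. Formally, `det (1 - M) = det (1 - A B) = det (1 - H)`
by a Schur complement.

The Fredholm determinants are compared term by term, without operator theory. In the `n`-th minor of
`M`, distribute the points over the two curves. A determinant that vanishes within each curve is
zero unless the curves carry equally many points (`det_eq_zero_of_unbalanced`), so odd terms vanish.
For `n = 2k` each of the `(2k).choose k` balanced distributions contributes `(-1)^k ∫∫ det A · det
B`. By Andréief's identity (`integral_det_mul_det`), integrating out the points on `γ` gives `k! det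
H`. The factorials combine so that term `2k` for `M` is exactly term `k` for `H`
(`fredholmTerm_MKernel_add_self`).

Convergence is proved only for `M`, by Hadamard's inequality and a bound `α p * β q` on the kernel
(`fredholmConvergent_of_le`); it passes to `H` by Fubini and the equality of terms.

For the trace class property, write `z - u = Z + U` with `Z = z - 1/2` and `U = 1/2 - u`, both in
the right half plane. The Cayley transform turns `1 / (Z + U)` into a geometric series of products
(`hasSum_cayley`), hence the operator into a sum of rank one operators. The norms are `O(n⁻²)` at
the price of a factor `(1 + ‖U‖)²`, which the decay of the weight pays for
(`exists_isTraceClass_cauchy`).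

The analytic input is that `F` on `γ` and `1 / F` on `γ'` decay faster than any exponential. This
comes from the decay of `1 / Γ` in right sectors, the reflection formula, and the absence of poles
and zeros on the respective curves. -/

theorem norm_Gamma_le_Gamma_re {z : ℂ} (hz : 0 < z.re) : ‖Gamma z‖ ≤ Real.Gamma z.re := by
  rw [Gamma_eq_integral hz, Real.Gamma_eq_integral hz, GammaIntegral]
  refine (norm_integral_le_integral_norm _).trans_eq ?_
  refine setIntegral_congr_fun measurableSet_Ioi fun x (hx : 0 < x) => ?_
  simp only [norm_mul, norm_real, Real.norm_eq_abs, Real.abs_exp]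
  rw [norm_cpow_eq_rpow_re_of_pos hx]
  simp

theorem norm_sin_le_exp (z : ℂ) : ‖sin z‖ ≤ Real.exp |z.im| := by
  rw [Complex.sin, norm_div, norm_mul, norm_I, mul_one]
  have h1 : ‖exp (-z * I)‖ ≤ Real.exp |z.im| := by
    rw [norm_exp]; gcongr; simpa using le_abs_self z.im
  have h2 : ‖exp (z * I)‖ ≤ Real.exp |z.im| := by
    rw [norm_exp]; gcongr; simpa using neg_le_abs z.im
  have h3 := norm_sub_le (exp (-z * I)) (exp (z * I))
  rw [norm_ofNat]
  linarith

/-- The reverse triangle inequality gives `|sin z| ≥ |sinh (Im z)|`. This crude bound keeps the sine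
away from zero in the reflection formula, off the real axis. -/
theorem abs_im_le_norm_sin (z : ℂ) : |z.im| ≤ ‖sin z‖ := by
  have h1 : ‖exp (-z * I)‖ = Real.exp z.im := by rw [norm_exp]; simp
  have h2 : ‖exp (z * I)‖ = Real.exp (-z.im) := by rw [norm_exp]; simp
  have h3 := abs_norm_sub_norm_le (exp (-z * I)) (exp (z * I))
  rw [Complex.sin, norm_div, norm_mul, norm_I, mul_one, norm_ofNat, le_div_iff₀ two_pos]
  refine le_trans ?_ h3
  rw [h1, h2]
  have h4 : |z.im| ≤ |Real.sinh z.im| := by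
    rcases le_total 0 z.im with h | h
    · rw [abs_of_nonneg h, abs_of_nonneg (Real.sinh_nonneg_iff.2 h)]
      exact Real.self_le_sinh_iff.2 h
    · rw [abs_of_nonpos h, abs_of_nonpos (Real.sinh_nonpos_iff.2 h)]
      exact neg_le_neg (Real.sinh_le_self_iff.2 h)
  rw [Real.sinh_eq, abs_div, abs_two, le_div_iff₀ two_pos] at h4
  exact h4

theorem inv_Gamma_eq {w : ℂ} (hw : w.im ≠ 0) :
    (Gamma w)⁻¹ = Gamma (1 - w) * sin (Real.pi * w) / Real.pi := by
  have hsin : sin (Real.pi * w) ≠ 0 := by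
    have := abs_im_le_norm_sin (Real.pi * w)
    intro h
    rw [h, norm_zero, im_ofReal_mul, abs_mul] at this
    have h3 : 0 < |Real.pi| * |w.im| := by positivity
    linarith
  have hG : Gamma w ≠ 0 := Gamma_ne_zero fun m hm => hw (by simp [hm])
  have h := Gamma_mul_Gamma_one_sub w
  have hpi : (Real.pi : ℂ) ≠ 0 := by simp [Real.pi_ne_zero]
  rw [eq_div_iff hsin] at h
  field_simp
  exact h.symm.trans (by ring_nf)

/-- For `|Im w| ≤ 1` this is compactness. Otherwise reflection gives `1 / Γ(w) = Γ(1 - w) sin(πw) /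
π`, and `Γ(1 - w)` is smaller than `Γ(3 - w)`, whose argument lies again in the strip `1 ≤ Re ≤ 2`,
where `|Γ|` is at most `Γ` of the real part. -/
theorem exists_norm_inv_Gamma_le_of_strip :
    ∃ C : ℝ, 0 ≤ C ∧ ∀ w : ℂ, 1 ≤ w.re → w.re ≤ 2 →
      ‖(Gamma w)⁻¹‖ ≤ C * Real.exp (Real.pi * |w.im|) := by
  obtain ⟨C₁, hC₁⟩ := (isCompact_Icc (a := (1 : ℝ)) (b := 2)).exists_bound_of_continuousOn
    (f := Real.Gamma) fun x hx =>
      (Real.differentiableAt_Gamma fun m => by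
        have : (0 : ℝ) ≤ m := m.cast_nonneg
        have := hx.1
        linarith).continuousAt.continuousWithinAt
  obtain ⟨C₂, hC₂⟩ := (isCompact_Icc.reProdIm (isCompact_Icc (a := (-1 : ℝ)) (b := 1)) :
    IsCompact (Icc (1 : ℝ) 2 ×ℂ Icc (-1) 1)).exists_bound_of_continuousOn
      (differentiable_one_div_Gamma.continuous.continuousOn)
  have hC₁0 : 0 ≤ C₁ := (norm_nonneg _).trans (hC₁ 1 ⟨le_rfl, one_le_two⟩)
  have hC₂0 : 0 ≤ C₂ := (norm_nonneg _).trans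
    (hC₂ 1 (by simp [mem_reProdIm]))
  refine ⟨C₁ + C₂, by positivity, fun w h1 h2 => ?_⟩
  have hexp : 1 ≤ Real.exp (Real.pi * |w.im|) := Real.one_le_exp (by positivity)
  rcases le_total |w.im| 1 with him | him
  · have := hC₂ w ⟨⟨h1, h2⟩, abs_le.1 him⟩
    nlinarith
  · have hw0 : w.im ≠ 0 := by
      intro h; rw [h] at him; norm_num at him
    have hn1 : (1 : ℂ) - w ≠ 0 := fun h => hw0 (by simpa using congrArg Complex.im h)
    have hn2 : (2 : ℂ) - w ≠ 0 := fun h => hw0 (by simpa using congrArg Complex.im h)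
    have hG : Gamma (3 - w) = (2 - w) * ((1 - w) * Gamma (1 - w)) := by
      rw [← Gamma_add_one _ hn1, show (1 : ℂ) - w + 1 = 2 - w by ring, ← Gamma_add_one _ hn2]
      ring_nf
    have hn : 1 ≤ ‖(2 : ℂ) - w‖ * ‖(1 : ℂ) - w‖ := by
      have e1 : 1 ≤ ‖(2 : ℂ) - w‖ := him.trans (by simpa using abs_im_le_norm ((2 : ℂ) - w))
      have e2 : 1 ≤ ‖(1 : ℂ) - w‖ := him.trans (by simpa using abs_im_le_norm ((1 : ℂ) - w))
      nlinarith
    have hG1 : ‖Gamma (1 - w)‖ ≤ C₁ := by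
      have e1 : ‖Gamma (3 - w)‖ ≤ C₁ :=
        (norm_Gamma_le_Gamma_re (by simp; linarith)).trans ((le_abs_self _).trans
          (hC₁ _ (by simp only [sub_re, re_ofNat, mem_Icc]; constructor <;> linarith)))
      rw [hG, norm_mul, norm_mul, ← mul_assoc] at e1
      nlinarith [norm_nonneg (Gamma (1 - w))]
    rw [inv_Gamma_eq hw0, norm_div, norm_mul, norm_real, Real.norm_eq_abs,
      abs_of_pos Real.pi_pos]
    have hs := norm_sin_le_exp (Real.pi * w)
    rw [im_ofReal_mul, abs_mul, abs_of_pos Real.pi_pos] at hs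
    rw [div_le_iff₀ Real.pi_pos]
    calc ‖Gamma (1 - w)‖ * ‖sin (Real.pi * w)‖ ≤ C₁ * Real.exp (Real.pi * |w.im|) := by gcongr
      _ ≤ (C₁ + C₂) * Real.exp (Real.pi * |w.im|) * 1 := by rw [mul_one]; gcongr; linarith
      _ ≤ _ := by gcongr; linarith [Real.pi_gt_three]

/-- Each use of the functional equation divides by `w + n`, of modulus at least `n + 1`. -/
theorem exists_norm_inv_Gamma_add_nat_le :
    ∃ C : ℝ, 0 ≤ C ∧ ∀ (n : ℕ) (w : ℂ), 1 ≤ w.re → w.re ≤ 2 →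
      ‖(Gamma (w + n))⁻¹‖ ≤ C * Real.exp (Real.pi * |w.im|) / n.factorial := by
  obtain ⟨C, hC0, hC⟩ := exists_norm_inv_Gamma_le_of_strip
  refine ⟨C, hC0, fun n w h1 h2 => ?_⟩
  induction n with
  | zero => simpa using hC w h1 h2
  | succ n ih =>
    have hre : (n + 1 : ℝ) ≤ (w + n).re := by simp; linarith
    have hne : w + n ≠ 0 := fun h => by
      rw [h, zero_re] at hre
      have : (0 : ℝ) ≤ n := n.cast_nonneg
      linarith
    rw [Nat.cast_succ, ← add_assoc, Gamma_add_one _ hne, mul_inv, norm_mul, norm_inv,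
      Nat.factorial_succ, Nat.cast_mul, mul_comm ((n + 1 : ℕ) : ℝ), ← div_div, div_eq_inv_mul]
    have : ((n + 1 : ℕ) : ℝ) ≤ ‖w + n‖ := by
      push_cast
      exact hre.trans (re_le_norm _)
    gcongr

/-- `1 / Γ` decays faster than any exponential in sectors inside the right half plane. -/
theorem exists_norm_inv_Gamma_le {c : ℝ} (hc : 0 < c) (K : ℝ) (hK : 0 ≤ K) :
    ∃ C : ℝ, 0 ≤ C ∧ ∀ w : ℂ, 1 ≤ w.re → c * |w.im| ≤ w.re →
      ‖(Gamma w)⁻¹‖ ≤ C * Real.exp (-K * ‖w‖) := by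
  obtain ⟨C, hC0, hC⟩ := exists_norm_inv_Gamma_add_nat_le
  -- In the sector `|Im w| ≤ Re w / c`, so `π |Im w| + K ‖w‖ ≤ L Re w`. This exponential in `Re w ≤
  -- n + 2` is beaten by `1 / n!`, since `exp (L n) / n! ≤ exp (exp L)`.
  set L : ℝ := (Real.pi + K) / c + K with hL
  have hL0 : 0 ≤ L := by positivity
  refine ⟨C * Real.exp (Real.exp L) * Real.exp (2 * L), by positivity, fun w h1 h2 => ?_⟩
  -- One less than the floor, so that `w - n` lies in the strip `1 ≤ Re ≤ 2`.
  obtain ⟨n, hn⟩ : ∃ n : ℕ, n + 1 = ⌊w.re⌋₊ := by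
    have : 1 ≤ ⌊w.re⌋₊ := Nat.le_floor (by simpa using h1)
    exact ⟨⌊w.re⌋₊ - 1, by omega⟩
  have e1 : (n + 1 : ℝ) ≤ w.re := by
    have := Nat.floor_le (zero_le_one.trans h1)
    rw [← hn] at this
    exact_mod_cast this
  have e2 : w.re ≤ n + 2 := by
    have := (Nat.lt_floor_add_one w.re).le
    rw [← hn] at this
    push_cast at this
    linarith
  have h := hC n (w - n) (by simp; linarith) (by simp; linarith)
  rw [sub_add_cancel] at h
  simp only [sub_im, natCast_im, sub_zero] at h
  refine h.trans ?_
  have hfac : Real.exp (L * n) / n.factorial ≤ Real.exp (Real.exp L) := by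
    rw [mul_comm, Real.exp_nat_mul]
    exact Real.pow_div_factorial_le_exp _ (Real.exp_pos _).le n
  have hexp : Real.pi * |w.im| ≤ -K * ‖w‖ + L * w.re := by
    have hw := norm_le_abs_re_add_abs_im w
    rw [abs_of_nonneg (zero_le_one.trans h1)] at hw
    have h3 : |w.im| ≤ w.re / c := by rw [le_div_iff₀ hc]; linarith
    have h4 : (Real.pi + K) * |w.im| ≤ (Real.pi + K) / c * w.re := by
      calc _ ≤ (Real.pi + K) * (w.re / c) := by gcongr
        _ = _ := by ring
    have h5 : K * ‖w‖ ≤ K * (w.re + |w.im|) := by gcongr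
    rw [hL]
    linarith
  have hexp2 : Real.pi * |w.im| ≤ -K * ‖w‖ + L * n + 2 * L := by nlinarith
  calc C * Real.exp (Real.pi * |w.im|) / n.factorial
      ≤ C * Real.exp (-K * ‖w‖ + L * n + 2 * L) / n.factorial := by gcongr
    _ = C * (Real.exp (L * n) / n.factorial) * Real.exp (2 * L) * Real.exp (-K * ‖w‖) := by
      rw [Real.exp_add, Real.exp_add]; ring
    _ ≤ _ := by gcongr

/-! ### Decay along filters -/

/-- `f` decays faster than any exponential along `l`. -/
def Decays (l : Filter ℂ) (f : ℂ → ℂ) : Prop :=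
  ∀ K : ℝ, 0 ≤ K → ∃ C : ℝ, 0 ≤ C ∧ ∀ᶠ z in l, ‖f z‖ ≤ C * Real.exp (-K * ‖z‖)

/-- `f` grows at most exponentially along `l`. -/
def ExpBounded (l : Filter ℂ) (f : ℂ → ℂ) : Prop :=
  ∃ K : ℝ, 0 ≤ K ∧ ∃ C : ℝ, 0 ≤ C ∧ ∀ᶠ z in l, ‖f z‖ ≤ C * Real.exp (K * ‖z‖)

variable {l : Filter ℂ} {f g : ℂ → ℂ}

theorem Decays.expBounded (hf : Decays l f) : ExpBounded l f := by
  obtain ⟨C, hC0, hC⟩ := hf 0 le_rfl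
  exact ⟨0, le_rfl, C, hC0, by simpa using hC⟩

theorem ExpBounded.mul (hf : ExpBounded l f) (hg : ExpBounded l g) :
    ExpBounded l fun z => f z * g z := by
  obtain ⟨K, hK0, C, hC0, hC⟩ := hf
  obtain ⟨L, hL0, D, hD0, hD⟩ := hg
  refine ⟨K + L, by positivity, C * D, by positivity, ?_⟩
  filter_upwards [hC, hD] with z h1 h2
  rw [norm_mul, add_mul, Real.exp_add]
  calc ‖f z‖ * ‖g z‖ ≤ (C * Real.exp (K * ‖z‖)) * (D * Real.exp (L * ‖z‖)) := by gcongr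
    _ = _ := by ring

theorem ExpBounded.prod {ι : Type*} (t : Finset ι) {f : ι → ℂ → ℂ}
    (hf : ∀ i, ExpBounded l (f i)) : ExpBounded l fun z => ∏ i ∈ t, f i z := by
  classical
  induction t using Finset.induction_on with
  | empty => exact ⟨0, le_rfl, 1, zero_le_one, by simp⟩
  | insert a t ha ih =>
    simp_rw [Finset.prod_insert ha]
    exact (hf a).mul ih

theorem Decays.mul (hf : Decays l f) (hg : ExpBounded l g) : Decays l fun z => f z * g z := by
  intro K hK
  obtain ⟨L, hL0, D, hD0, hD⟩ := hg
  obtain ⟨C, hC0, hC⟩ := hf (K + L) (by positivity)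
  refine ⟨C * D, by positivity, ?_⟩
  filter_upwards [hC, hD] with z h1 h2
  rw [norm_mul]
  calc ‖f z‖ * ‖g z‖ ≤ (C * Real.exp (-(K + L) * ‖z‖)) * (D * Real.exp (L * ‖z‖)) := by gcongr
    _ = C * D * (Real.exp (-(K + L) * ‖z‖) * Real.exp (L * ‖z‖)) := by ring
    _ = _ := by rw [← Real.exp_add]; ring_nf

theorem Decays.congr (hf : Decays l f) (h : f =ᶠ[l] g) : Decays l g := by
  intro K hK
  obtain ⟨C, hC0, hC⟩ := hf K hK
  refine ⟨C, hC0, ?_⟩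
  filter_upwards [hC, h] with z h1 h2
  rwa [← h2]

/-- The filter of points going to infinity vertically inside the sector `c |Im z| ≤ Re z`. -/
def rightSector (c : ℝ) : Filter ℂ :=
  comap (fun z => |z.im|) atTop ⊓ 𝓟 {z | c * |z.im| ≤ z.re}

/-- The filter of points going to infinity vertically inside the sector `Re z ≤ -c |Im z|`. -/
def leftSector (c : ℝ) : Filter ℂ :=
  comap (fun z => |z.im|) atTop ⊓ 𝓟 {z | z.re ≤ -(c * |z.im|)}

theorem eventually_rightSector (c R : ℝ) :
    ∀ᶠ z in rightSector c, R ≤ |z.im| ∧ c * |z.im| ≤ z.re :=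
  ((tendsto_comap.eventually (eventually_ge_atTop R)).filter_mono inf_le_left).and
    ((eventually_principal.2 fun _ h => h).filter_mono inf_le_right)

theorem tendsto_neg_leftSector (c : ℝ) :
    Tendsto (fun z : ℂ => -z) (leftSector c) (rightSector c) := by
  refine tendsto_inf.2 ⟨tendsto_comap_iff.2 ?_, tendsto_principal.2 ?_⟩
  · refine (tendsto_comap.mono_left (inf_le_left (b := 𝓟 {z : ℂ | z.re ≤ -(c * |z.im|)}))).congr
      fun z => ?_
    simp
  · refine ((eventually_principal.2 fun _ h => h).filter_mono inf_le_right).mono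
      fun z (hz : z.re ≤ -(c * |z.im|)) => ?_
    simp only [neg_im, abs_neg, neg_re, mem_ofPred_eq]
    linarith

theorem Decays.comp_neg {c : ℝ} (hf : Decays (rightSector c) f) :
    Decays (leftSector c) fun z => f (-z) := by
  intro K hK
  obtain ⟨C, hC0, hC⟩ := hf K hK
  refine ⟨C, hC0, ?_⟩
  filter_upwards [(tendsto_neg_leftSector c).eventually hC] with z hz
  rwa [norm_neg] at hz

theorem decays_inv_Gamma {c : ℝ} (hc : 0 < c) (a : ℝ) {d : ℝ} (hd : 0 < d) :
    Decays (rightSector c) fun z => (Gamma (a + d * z))⁻¹ := by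
  intro K hK
  -- Halving the slope leaves room for the translation by `a`: far out, `a + d z` stays in the
  -- sector with constant `c / 2`.
  obtain ⟨C, hC0, hC⟩ := exists_norm_inv_Gamma_le (c := c / 2) (by positivity) (K / d)
    (by positivity)
  refine ⟨C * Real.exp (K / d * |a|), by positivity, ?_⟩
  filter_upwards [eventually_rightSector c ((2 * |a| + 2) / (c * d))] with z ⟨h1, h2⟩
  rw [div_le_iff₀ (by positivity)] at h1
  have ha := neg_abs_le a
  have h3 : |a| + 1 ≤ d * z.re / 2 := by nlinarith
  have hre : ((a : ℂ) + d * z).re = a + d * z.re := by simp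
  have him : ((a : ℂ) + d * z).im = d * z.im := by simp
  have h := hC (a + d * z) (by rw [hre]; linarith [abs_nonneg a]) (by
    rw [hre, him, abs_mul, abs_of_pos hd]
    nlinarith)
  refine h.trans ?_
  rw [mul_assoc, ← Real.exp_add]
  gcongr
  have h4 : d * ‖z‖ ≤ ‖(a : ℂ) + d * z‖ + |a| := by
    have := norm_sub_le ((a : ℂ) + d * z) a
    rw [add_sub_cancel_left, norm_mul, norm_real, norm_real, Real.norm_eq_abs, Real.norm_eq_abs,
      abs_of_pos hd] at this
    exact this
  have h5 : K / d * (d * ‖z‖) ≤ K / d * (‖(a : ℂ) + d * z‖ + |a|) := by gcongr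
  have h6 : K / d * (d * ‖z‖) = K * ‖z‖ := by field_simp
  linarith

/-- Reflection writes `Γ(a - dz)` as `1 / Γ(1 - a + dz)` times `π / sin`, and the latter is at most
1 as soon as `d |Im z| ≥ 1`. -/
theorem decays_Gamma {c : ℝ} (hc : 0 < c) (a : ℝ) {d : ℝ} (hd : 0 < d) :
    Decays (rightSector c) fun z => Gamma (a - d * z) := by
  have hb : ExpBounded (rightSector c) fun z => Real.pi / sin (Real.pi * (a - d * z)) := by
    refine ⟨0, le_rfl, 1, zero_le_one, ?_⟩
    filter_upwards [eventually_rightSector c (1 / d)] with z ⟨h1, h2⟩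
    have h3 := abs_im_le_norm_sin (Real.pi * (a - d * z))
    rw [im_ofReal_mul, sub_im, ofReal_im, im_ofReal_mul, zero_sub, abs_mul, abs_neg, abs_mul,
      abs_of_pos hd, abs_of_pos Real.pi_pos] at h3
    rw [div_le_iff₀ hd] at h1
    have h4 : Real.pi ≤ Real.pi * (d * |z.im|) := by nlinarith [Real.pi_pos]
    rw [norm_div, norm_real, Real.norm_eq_abs, abs_of_pos Real.pi_pos, zero_mul, Real.exp_zero,
      mul_one]
    exact div_le_one_of_le₀ (h4.trans h3) (norm_nonneg _)
  refine ((decays_inv_Gamma hc (1 - a) hd).mul hb).congr ?_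
  filter_upwards [eventually_rightSector c (1 / d)] with z ⟨h1, h2⟩
  have him : ((a : ℂ) - d * z).im ≠ 0 := by
    simp only [sub_im, ofReal_im, im_ofReal_mul, zero_sub, ne_eq, neg_eq_zero, mul_eq_zero, hd.ne',
      false_or]
    intro h
    rw [h, abs_zero] at h1
    have : 0 < 1 / d := by positivity
    linarith
  have h5 : (1 : ℂ) - (a - d * z) = ((1 - a : ℝ) : ℂ) + d * z := by push_cast; ring
  have h6 : Gamma (((1 - a : ℝ) : ℂ) + d * z) ≠ 0 := by
    refine Gamma_ne_zero fun m hm => him ?_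
    have := congrArg Complex.im hm
    simp only [add_im, ofReal_im, im_ofReal_mul, neg_im, natCast_im, neg_zero, zero_add] at this
    simp [this]
  have h7 := Gamma_mul_Gamma_one_sub (a - d * z)
  rw [h5] at h7
  rw [← h7]
  field_simp

theorem ExpBounded.congr (hf : ExpBounded l f) (h : f =ᶠ[l] g) : ExpBounded l g := by
  obtain ⟨K, hK0, C, hC0, hC⟩ := hf
  refine ⟨K, hK0, C, hC0, ?_⟩
  filter_upwards [hC, h] with z h1 h2
  rwa [← h2]

theorem Gamma_add_nat_add_one (a : ℂ) (n : ℕ) {z : ℂ} (hz : (a - z).im ≠ 0) :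
    Gamma (a - z + (n + 1 : ℕ)) = (a - z + n) * Gamma (a - z + n) := by
  rw [Nat.cast_succ, ← add_assoc, Gamma_add_one]
  intro h
  exact hz (by simpa using congrArg Complex.im h)

theorem im_ofReal_sub_ne_zero (a : ℝ) {z : ℂ} (hz : 1 ≤ |z.im|) : ((a : ℂ) - z).im ≠ 0 := by
  intro h
  simp only [sub_im, ofReal_im, zero_sub, neg_eq_zero] at h
  rw [h] at hz
  norm_num at hz

theorem Gamma_ofReal_sub_ne_zero (a : ℝ) {z : ℂ} (hz : 1 ≤ |z.im|) : Gamma (a - z) ≠ 0 :=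
  Gamma_ne_zero fun m hm => im_ofReal_sub_ne_zero a hz (by simp [hm])

/-- Off the real axis the quotient is a polynomial of degree `n`. This and the next lemma treat the
pairs `Γ(1 + μ k - z) / Γ(1 + ν k - z)` of the truncated unitary model, whose arguments differ by
integers. -/
theorem expBounded_Gamma_add_nat_div (hl : ∀ᶠ z in l, 1 ≤ |z.im|) (a : ℝ) (n : ℕ) :
    ExpBounded l fun z => Gamma (a - z + n) * (Gamma (a - z))⁻¹ := by
  induction n with
  | zero =>
    refine ⟨0, le_rfl, 1, zero_le_one, hl.mono fun z hz => ?_⟩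
    simp [mul_inv_cancel₀ (Gamma_ofReal_sub_ne_zero a hz)]
  | succ n ih =>
    have h : ExpBounded l fun z => a - z + n := by
      refine ⟨1, zero_le_one, |a| + n + 1, by positivity, Eventually.of_forall fun z => ?_⟩
      have h1 : ‖(a : ℂ) - z + n‖ ≤ |a| + ‖z‖ + n := by
        refine (norm_add_le _ _).trans ?_
        have := norm_sub_le (a : ℂ) z
        rw [norm_real, Real.norm_eq_abs] at this
        simpa using this
      have h2 := Real.add_one_le_exp ‖z‖
      have h3 : 1 ≤ Real.exp ‖z‖ := Real.one_le_exp (norm_nonneg _)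
      rw [one_mul]
      have h4 : 0 ≤ |a| + n := by positivity
      nlinarith
    refine (h.mul ih).congr (hl.mono fun z hz => ?_)
    simp only [Gamma_add_nat_add_one a n (im_ofReal_sub_ne_zero a hz), mul_assoc]

theorem expBounded_Gamma_div_add_nat (hl : ∀ᶠ z in l, 1 ≤ |z.im|) (a : ℝ) (n : ℕ) :
    ExpBounded l fun z => Gamma (a - z) * (Gamma (a - z + n))⁻¹ := by
  induction n with
  | zero =>
    refine ⟨0, le_rfl, 1, zero_le_one, hl.mono fun z hz => ?_⟩
    simp [mul_inv_cancel₀ (Gamma_ofReal_sub_ne_zero a hz)]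
  | succ n ih =>
    have h : ExpBounded l fun z => (a - z + n)⁻¹ := by
      refine ⟨0, le_rfl, 1, zero_le_one, hl.mono fun z hz => ?_⟩
      have h1 := abs_im_le_norm ((a : ℂ) - z + n)
      simp only [add_im, sub_im, ofReal_im, zero_sub, natCast_im, add_zero, abs_neg] at h1
      rw [norm_inv, zero_mul, Real.exp_zero, mul_one]
      exact inv_le_one_of_one_le₀ (hz.trans h1)
    refine (h.mul ih).congr (hl.mono fun z hz => ?_)
    simp only [Gamma_add_nat_add_one a n (im_ofReal_sub_ne_zero a hz), mul_inv]
    ring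

/-! ### The functions `F` -/

theorem eventually_leftSector (c R : ℝ) : ∀ᶠ z in leftSector c, R ≤ |z.im| := by
  filter_upwards [(tendsto_neg_leftSector c).eventually (eventually_rightSector c R)] with z hz
  simpa using hz.1

theorem decays_Gamma_left {c : ℝ} (hc : 0 < c) (a : ℝ) :
    Decays (leftSector c) fun z => Gamma (z + a) := by
  refine (decays_Gamma hc a one_pos).comp_neg.congr (Eventually.of_forall fun z => ?_)
  simp [add_comm]

theorem decays_inv_Gamma_left {c : ℝ} (hc : 0 < c) (a : ℝ) {d : ℝ} (hd : 0 < d) :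
    Decays (leftSector c) fun z => (Gamma (a - d * z))⁻¹ := by
  refine (decays_inv_Gamma hc a hd).comp_neg.congr (Eventually.of_forall fun z => ?_)
  simp [sub_eq_add_neg]

/-- The Gamma factor in the numerator that contains `+z` supplies the decay; of all the others it is
enough that they grow at most exponentially. -/
theorem Model.decays_F (m : Model) {c : ℝ} (hc : 0 < c) : Decays (leftSector c) m.F := by
  have hl := eventually_leftSector c 1
  cases m with
  | ginibre r hr ν =>
    refine ((decays_Gamma_left hc 0).mul (ExpBounded.prod Finset.univ fun j =>
      (decays_inv_Gamma_left hc (1 + ν j) one_pos).expBounded)).congr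
        (Eventually.of_forall fun z => ?_)
    simp [Model.F, div_eq_mul_inv]
  | truncatedUnitary r q hq ν μ hμ =>
    -- With `r = q + d`, the first `q` denominators pair with the `q` numerators, and `d` reciprocal
    -- Gamma factors are left over.
    obtain ⟨d, rfl⟩ := Nat.exists_eq_add_of_le hq.le
    choose n hn using fun k => Nat.exists_eq_add_of_lt (hμ k)
    refine ((decays_Gamma_left hc 0).mul ((ExpBounded.prod Finset.univ fun k : Fin q =>
      expBounded_Gamma_add_nat_div hl (1 + ν (Fin.castAdd d k)) (n k + 1)).mul
        (ExpBounded.prod Finset.univ fun j : Fin d =>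
      (decays_inv_Gamma_left hc (1 + ν (Fin.natAdd q j)) one_pos).expBounded))).congr
        (Eventually.of_forall fun z => ?_)
    simp only [Model.F, Fin.prod_univ_add, Finset.prod_mul_distrib, div_eq_mul_inv, mul_inv,
      ← Finset.prod_inv_distrib, hn]
    rw [mul_assoc, mul_assoc]
    congr 1
    · simp
    congr 1
    · refine Finset.prod_congr rfl fun k _ => ?_
      congr 1
      push_cast
      simp only [Fin.castLE, Fin.castAdd]
      ring
    · simp
  | muttalibBorodin α θ hα hθ =>
    refine ((decays_Gamma_left hc (α / 2)).mul
      (decays_inv_Gamma_left hc ((α / 2 + 1) / θ) (inv_pos.2 hθ)).expBounded).congr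
        (Eventually.of_forall fun z => ?_)
    simp only [Model.F, div_eq_mul_inv]
    push_cast
    congr 3
    ring

theorem Model.decays_inv_F (m : Model) {c : ℝ} (hc : 0 < c) :
    Decays (rightSector c) fun z => (m.F z)⁻¹ := by
  have hl := (eventually_rightSector c 1).mono fun _ h => h.1
  cases m with
  | ginibre r hr ν =>
    refine ((decays_inv_Gamma hc 0 one_pos).mul (ExpBounded.prod Finset.univ fun j =>
      (decays_Gamma hc (1 + ν j) one_pos).expBounded)).congr
        (Eventually.of_forall fun z => ?_)
    simp [Model.F, div_eq_mul_inv, mul_comm]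
  | truncatedUnitary r q hq ν μ hμ =>
    obtain ⟨d, rfl⟩ := Nat.exists_eq_add_of_le hq.le
    choose n hn using fun k => Nat.exists_eq_add_of_lt (hμ k)
    refine ((decays_inv_Gamma hc 0 one_pos).mul ((ExpBounded.prod Finset.univ fun k : Fin q =>
      expBounded_Gamma_div_add_nat hl (1 + ν (Fin.castAdd d k)) (n k + 1)).mul
        (ExpBounded.prod Finset.univ fun j : Fin d =>
      (decays_Gamma hc (1 + ν (Fin.natAdd q j)) one_pos).expBounded))).congr
        (Eventually.of_forall fun z => ?_)
    simp only [Model.F, Fin.prod_univ_add, Finset.prod_mul_distrib, div_eq_mul_inv, mul_inv,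
      ← Finset.prod_inv_distrib, hn, inv_inv]
    have e : ∏ k, (Gamma (((1 + ν (Fin.castAdd d k) : ℝ) : ℂ) - z + ((n k + 1 : ℕ) : ℂ)))⁻¹ =
        ∏ k, (Gamma (1 + ((ν (Fin.castLE hq.le k) + n k + 1 : ℕ) : ℂ) - z))⁻¹ := by
      refine Finset.prod_congr rfl fun k _ => ?_
      congr 2
      push_cast
      simp only [Fin.castLE, Fin.castAdd]
      ring
    rw [e]
    simp only [ofReal_add, ofReal_one, ofReal_natCast, ofReal_zero, zero_add, one_mul]
    ring
  | muttalibBorodin α θ hα hθ =>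
    refine ((decays_inv_Gamma hc (α / 2) one_pos).mul
      (decays_Gamma hc ((α / 2 + 1) / θ) (inv_pos.2 hθ)).expBounded).congr
        (Eventually.of_forall fun z => ?_)
    simp only [Model.F, div_eq_mul_inv, mul_inv, inv_inv]
    push_cast
    rw [add_comm z, one_mul]
    congr 2
    ring

/-- `1 / Γ` is entire, and inverting it recovers `Γ` everywhere, the poles included, because there
both take the value 0. -/
theorem measurable_Gamma : Measurable Gamma := by
  have h := differentiable_one_div_Gamma.continuous.measurable.inv
  rwa [show (fun s => (Gamma s)⁻¹)⁻¹ = Gamma from funext fun s => inv_inv _] at h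

theorem Model.measurable_F (m : Model) : Measurable m.F := by
  have := measurable_Gamma
  cases m <;> simp only [Model.F] <;> fun_prop

theorem meromorphicAt_Gamma_comp {h : ℂ → ℂ} (hh : Differentiable ℂ h) (z : ℂ) :
    MeromorphicAt (fun z => Gamma (h z)) z := by
  have : Differentiable ℂ fun z => (Gamma (h z))⁻¹ := differentiable_one_div_Gamma.comp hh
  have hi := (this.analyticAt z).meromorphicAt.inv
  rwa [show (fun z => (Gamma (h z))⁻¹)⁻¹ = fun z => Gamma (h z) from
    funext fun s => inv_inv _] at hi

theorem Model.meromorphicAt_F (m : Model) (z : ℂ) : MeromorphicAt m.F z := by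
  cases m with
  | ginibre r hr ν =>
    exact (meromorphicAt_Gamma_comp (by fun_prop) z).div
      (MeromorphicAt.fun_prod fun j _ => meromorphicAt_Gamma_comp (by fun_prop) z)
  | truncatedUnitary r q hq ν μ hμ =>
    exact ((meromorphicAt_Gamma_comp (by fun_prop) z).mul
      (MeromorphicAt.fun_prod fun j _ => meromorphicAt_Gamma_comp (by fun_prop) z)).div
      (MeromorphicAt.fun_prod fun j _ => meromorphicAt_Gamma_comp (by fun_prop) z)
  | muttalibBorodin α θ hα hθ =>
    exact (meromorphicAt_Gamma_comp (by fun_prop) z).div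
      (meromorphicAt_Gamma_comp (by fun_prop) z)

/-! ### Bounds along the contours -/

/-- Compactness. Local boundedness replaces continuity, which may fail for `F` along the curve: at a
removable singularity `F` can have an arbitrary default value. -/
theorem exists_le_of_locally_le {f : ℝ → ℝ} (h : ∀ t, ∃ C, ∀ᶠ x in 𝓝 t, f x ≤ C)
    (h' : ∃ C, ∀ᶠ t in cocompact ℝ, f t ≤ C) : ∃ C, 0 < C ∧ ∀ t, f t ≤ C := by
  obtain ⟨C, hC⟩ := h'
  obtain ⟨S, hS, hSC⟩ := mem_cocompact.1 hC
  obtain ⟨D, hD⟩ : ∃ D, ∀ t ∈ S, f t ≤ D := by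
    refine hS.induction_on (p := fun S => ∃ D, ∀ t ∈ S, f t ≤ D) ⟨0, by simp⟩
      (fun s t hst ⟨D, hD⟩ => ⟨D, fun x hx => hD x (hst hx)⟩)
      (fun s t ⟨D, hD⟩ ⟨E, hE⟩ => ⟨max D E, ?_⟩) fun t _ => ?_
    · rintro x (hx | hx)
      · exact (hD x hx).trans (le_max_left _ _)
      · exact (hE x hx).trans (le_max_right _ _)
    · obtain ⟨D, hD⟩ := h t
      exact ⟨_, mem_nhdsWithin_of_mem_nhds hD, D, fun x hx => hx⟩
  refine ⟨max 1 (max C D), lt_max_of_lt_left one_pos, fun t => ?_⟩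
  by_cases ht : t ∈ S
  · exact (hD t ht).trans ((le_max_right _ _).trans (le_max_right _ _))
  · exact (hSC ht : f t ≤ C).trans ((le_max_left _ _).trans (le_max_right _ _))

theorem eventually_norm_le_of_meromorphicOrderAt_nonneg {f : ℂ → ℂ} {z : ℂ}
    (hf : MeromorphicAt f z) (ho : 0 ≤ meromorphicOrderAt f z) :
    ∃ C, ∀ᶠ x in 𝓝 z, ‖f x‖ ≤ C := by
  obtain ⟨a, ha⟩ := tendsto_nhds_of_meromorphicOrderAt_nonneg hf ho
  have h := ha.norm.eventually_le_const (lt_add_one ‖a‖)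
  -- The order controls `f` only on a punctured neighbourhood, so the value at `z` is added by hand.
  refine ⟨max (‖a‖ + 1) ‖f z‖, ?_⟩
  rw [eventually_nhdsWithin_iff] at h
  filter_upwards [h] with x hx
  by_cases hxz : x = z
  · rw [hxz]; exact le_max_right _ _
  · exact (hx hxz).trans (le_max_left _ _)

theorem exists_norm_le_along_curve {c : ℝ → ℂ} (hc : Continuous c) {l : Filter ℂ} {f : ℂ → ℂ}
    (hcl : Tendsto c (cocompact ℝ) l) (hf : Decays l f) (hm : ∀ t, MeromorphicAt f (c t))
    (ho : ∀ t, 0 ≤ meromorphicOrderAt f (c t)) (K : ℝ) (hK : 0 ≤ K) :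
    ∃ C, 0 < C ∧ ∀ t, ‖f (c t)‖ ≤ C * Real.exp (-K * ‖c t‖) := by
  obtain ⟨C, hC0, hC⟩ : ∃ C, 0 < C ∧ ∀ t, ‖f (c t)‖ * Real.exp (K * ‖c t‖) ≤ C := by
    refine exists_le_of_locally_le (fun t => ?_) ?_
    · obtain ⟨D, hD⟩ := eventually_norm_le_of_meromorphicOrderAt_nonneg (hm t) (ho t)
      have h2 : ∀ᶠ x in 𝓝 t, Real.exp (K * ‖c x‖) ≤ Real.exp (K * ‖c t‖) + 1 := by
        have : Continuous fun x => Real.exp (K * ‖c x‖) := by fun_prop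
        exact (this.tendsto t).eventually_le_const (lt_add_one _)
      refine ⟨D * (Real.exp (K * ‖c t‖) + 1), ?_⟩
      filter_upwards [hc.continuousAt.eventually hD, h2] with x hx hx'
      exact mul_le_mul hx hx' (by positivity) ((norm_nonneg _).trans hx)
    · obtain ⟨C, hC0, hC⟩ := hf K hK
      refine ⟨C, (hcl.eventually hC).mono fun t ht => ?_⟩
      calc _ ≤ C * Real.exp (-K * ‖c t‖) * Real.exp (K * ‖c t‖) := by gcongr
        _ = C := by rw [mul_assoc, ← Real.exp_add]; simp
  refine ⟨C, hC0, fun t => ?_⟩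
  calc ‖f (c t)‖ = ‖f (c t)‖ * Real.exp (K * ‖c t‖) * Real.exp (-K * ‖c t‖) := by
        rw [mul_assoc, ← Real.exp_add]; simp
    _ ≤ _ := by gcongr; exact hC t

theorem IsUpwardContour.tendsto_abs_im {c : ℝ → ℂ} (hc : IsUpwardContour c) :
    Tendsto (fun t => |(c t).im|) (cocompact ℝ) atTop := by
  rw [cocompact_eq_atBot_atTop]
  exact (tendsto_abs_atBot_atTop.comp hc.tendsto_bot).sup
    (tendsto_abs_atTop_atTop.comp hc.tendsto_top)

theorem IsUpwardContour.continuous {c : ℝ → ℂ} (hc : IsUpwardContour c) : Continuous c :=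
  hc.locallyLipschitz.continuous

theorem IsContourPair.tendsto_leftSector {F : ℂ → ℂ} {γ γ' : ℝ → ℂ} (h : IsContourPair F γ γ') :
    ∃ c, 0 < c ∧ Tendsto γ (cocompact ℝ) (leftSector c) := by
  obtain ⟨c, hc, hs⟩ := h.sector_left
  exact ⟨c, hc, tendsto_inf.2 ⟨tendsto_comap_iff.2 h.contour_left.tendsto_abs_im,
    tendsto_principal.2 hs⟩⟩

theorem IsContourPair.tendsto_rightSector {F : ℂ → ℂ} {γ γ' : ℝ → ℂ} (h : IsContourPair F γ γ') :
    ∃ c, 0 < c ∧ Tendsto γ' (cocompact ℝ) (rightSector c) := by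
  obtain ⟨c, hc, hs⟩ := h.sector_right
  exact ⟨c, hc, tendsto_inf.2 ⟨tendsto_comap_iff.2 h.contour_right.tendsto_abs_im,
    tendsto_principal.2 hs⟩⟩

theorem Model.exists_norm_F_le (m : Model) {γ γ' : ℝ → ℂ} (h : IsContourPair m.F γ γ') (K : ℝ)
    (hK : 0 ≤ K) : ∃ C, 0 < C ∧ ∀ t, ‖m.F (γ t)‖ ≤ C * Real.exp (-K * ‖γ t‖) := by
  obtain ⟨c, hc, hl⟩ := h.tendsto_leftSector
  refine exists_norm_le_along_curve h.contour_left.continuous hl (m.decays_F hc)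
    (fun t => m.meromorphicAt_F _) (fun t => ?_) K hK
  by_contra! ho
  exact (h.poles_left _ ho).2.1 ⟨t, rfl⟩

theorem Model.exists_norm_inv_F_le (m : Model) {γ γ' : ℝ → ℂ} (h : IsContourPair m.F γ γ') (K : ℝ)
    (hK : 0 ≤ K) : ∃ C, 0 < C ∧ ∀ t, ‖(m.F (γ' t))⁻¹‖ ≤ C * Real.exp (-K * ‖γ' t‖) := by
  obtain ⟨c, hc, hl⟩ := h.tendsto_rightSector
  refine exists_norm_le_along_curve h.contour_right.continuous hl (m.decays_inv_F hc)
    (fun t => (m.meromorphicAt_F _).inv) (fun t => ?_) K hK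
  have := meromorphicOrderAt_inv (f := m.F) (x := γ' t)
  by_contra! ho
  refine (h.zeros_right (γ' t) ?_).2.1 ⟨t, rfl⟩
  change meromorphicOrderAt m.F⁻¹ (γ' t) < 0 at ho
  rw [this] at ho
  revert ho
  cases meromorphicOrderAt m.F (γ' t) with
  | top => simp
  | coe n =>
    intro ho
    norm_cast at ho ⊢
    omega

theorem exists_pos_lower_bound {c : ℝ → ℂ} (hc : Continuous c) {d : ℝ} (hd : 0 < d)
    {x : ℝ → ℝ} (hx : Continuous x) (hpos : ∀ t, 0 < x t)
    (hev : ∀ᶠ t in cocompact ℝ, d * (1 + ‖c t‖) ≤ x t) :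
    ∃ κ, 0 < κ ∧ ∀ t, κ * (1 + ‖c t‖) ≤ x t := by
  obtain ⟨C, hC0, hC⟩ : ∃ C, 0 < C ∧ ∀ t, (1 + ‖c t‖) / x t ≤ C := by
    refine exists_le_of_locally_le (fun t => ⟨(1 + ‖c t‖) / x t + 1, ?_⟩) ⟨1 / d, hev.mono fun t ht => ?_⟩
    · have : Continuous fun t => (1 + ‖c t‖) / x t :=
        (by fun_prop : Continuous fun t => 1 + ‖c t‖).div hx fun t => (hpos t).ne'
      exact (this.tendsto t).eventually_le_const (lt_add_one _)
    · rw [div_le_div_iff₀ (hpos t) hd]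
      linarith
  refine ⟨C⁻¹, by positivity, fun t => ?_⟩
  have := hC t
  rw [div_le_iff₀ (hpos t)] at this
  rw [inv_mul_le_iff₀ hC0]
  exact this

/-- The assumption `2 / c ≤ |y|` forces `2 ≤ x`, so `1`, `|y|` and `x` are all bounded by multiples
of `x - 1/2`. -/
theorem one_add_norm_le_of_sector {c x y : ℝ} (hc : 0 < c) (hy : 2 / c ≤ |y|)
    (h : c * |y| ≤ x) (z : ℂ) (hz : ‖z‖ ≤ x + |y|) :
    (2 * (2 + c⁻¹))⁻¹ * (1 + ‖z‖) ≤ x - 1 / 2 := by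
  rw [div_le_iff₀ hc] at hy
  have h1 : |y| ≤ c⁻¹ * x := by rw [le_inv_mul_iff₀ hc]; exact h
  have h2 : 0 < c⁻¹ := by positivity
  rw [inv_mul_le_iff₀ (by positivity)]
  nlinarith

/-- The distance to the line `Re z = 1/2` grows linearly along each curve: at infinity by the sector
conditions, elsewhere by compactness. This gives both the separation of the contours and the rate of
convergence of the Cayley expansion. -/
theorem IsContourPair.exists_lower_bound {F : ℂ → ℂ} {γ γ' : ℝ → ℂ} (h : IsContourPair F γ γ') :
    ∃ κ, 0 < κ ∧ (∀ t, κ * (1 + ‖γ t‖) ≤ 1 / 2 - (γ t).re) ∧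
      ∀ t, κ * (1 + ‖γ' t‖) ≤ (γ' t).re - 1 / 2 := by
  have hL := h.contour_left.continuous
  have hR := h.contour_right.continuous
  obtain ⟨κ₁, hκ₁, h₁⟩ : ∃ κ, 0 < κ ∧ ∀ t, κ * (1 + ‖γ t‖) ≤ 1 / 2 - (γ t).re := by
    obtain ⟨c, hc, hs⟩ := h.sector_left
    refine exists_pos_lower_bound (d := (2 * (2 + c⁻¹))⁻¹) hL (by positivity)
      (by fun_prop) (fun t => sub_pos.2 (h.re_lt t)) ?_
    filter_upwards [hs, h.contour_left.tendsto_abs_im.eventually_ge_atTop (2 / c)] with t h1 h2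
    have h4 : c * |(γ t).im| ≤ -(γ t).re := by linarith
    have h3 : 0 ≤ c * |(γ t).im| := by positivity
    have := one_add_norm_le_of_sector hc h2 h4 (γ t) (by
      rw [← abs_of_nonneg (h3.trans h4), abs_neg]
      exact norm_le_abs_re_add_abs_im _)
    linarith
  obtain ⟨κ₂, hκ₂, h₂⟩ : ∃ κ, 0 < κ ∧ ∀ t, κ * (1 + ‖γ' t‖) ≤ (γ' t).re - 1 / 2 := by
    obtain ⟨c, hc, hs⟩ := h.sector_right
    refine exists_pos_lower_bound (d := (2 * (2 + c⁻¹))⁻¹) hR (by positivity)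
      (by fun_prop) (fun t => sub_pos.2 (h.lt_re t)) ?_
    filter_upwards [hs, h.contour_right.tendsto_abs_im.eventually_ge_atTop (2 / c)] with t h1 h2
    have h3 : 0 ≤ c * |(γ' t).im| := by positivity
    exact one_add_norm_le_of_sector hc h2 h1 (γ' t) (by
      rw [← abs_of_nonneg (h3.trans h1)]
      exact norm_le_abs_re_add_abs_im _)
  refine ⟨min κ₁ κ₂, lt_min hκ₁ hκ₂, fun t => (mul_le_mul_of_nonneg_right (min_le_left _ _)
    (by positivity)).trans (h₁ t), fun t => (mul_le_mul_of_nonneg_right (min_le_right _ _)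
    (by positivity)).trans (h₂ t)⟩

end

section

/-! ### Contour integrals as integrals against measures -/

theorem paramMeasure_eq_sum (k : ℕ) :
    paramMeasure k = Measure.sum fun i : Fin k => volume.map (Prod.mk i) := by
  simp only [paramMeasure, Measure.count, Measure.prod_sum_left, Measure.dirac_prod]

theorem measurableEmbedding_prodMk {k : ℕ} (i : Fin k) :
    MeasurableEmbedding (Prod.mk i : ℝ → Fin k × ℝ) :=
  measurableEmbedding_prodMk_left i

theorem integrable_paramMeasure {k : ℕ} {E : Type*} [NormedAddCommGroup E] {g : Fin k × ℝ → E} :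
    Integrable g (paramMeasure k) ↔ ∀ i, Integrable fun t => g (i, t) := by
  rw [paramMeasure_eq_sum, Measure.sum_fintype, integrable_finsetSum_measure]
  simp only [Finset.mem_univ, true_imp_iff, (measurableEmbedding_prodMk _).integrable_map_iff]
  rfl

theorem integral_paramMeasure {k : ℕ} {g : Fin k × ℝ → ℂ} (hg : Integrable g (paramMeasure k)) :
    ∫ p, g p ∂(paramMeasure k) = ∑ i, ∫ t, g (i, t) := by
  rw [paramMeasure_eq_sum, Measure.sum_fintype] at hg ⊢
  rw [integral_finsetSum_measure fun i _ => (integrable_finsetSum_measure.1 hg i (by simp))]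
  simp only [(measurableEmbedding_prodMk _).integral_map]

theorem contourIntegrable_single {c : ℝ → ℂ} {f : ℂ → ℂ} :
    ContourIntegrable ![c] f ↔ Integrable fun t => f (c t) * deriv c t := by
  simp [ContourIntegrable, integrable_paramMeasure, point, lineElement]

theorem contourIntegral_single (c : ℝ → ℂ) (f : ℂ → ℂ) :
    contourIntegral ![c] f = ∫ t, f (c t) * deriv c t := by
  by_cases h : ContourIntegrable ![c] f
  · rw [contourIntegral, integral_paramMeasure h]
    simp [point, lineElement]
  -- Without integrability both sides are the default value 0.
  · rw [contourIntegral, integral_undef h, integral_undef (mt contourIntegrable_single.2 h)]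

theorem contourIntegrable_pair {c c' : ℝ → ℂ} {f : ℂ → ℂ} :
    ContourIntegrable ![c, c'] f ↔ ContourIntegrable ![c] f ∧ ContourIntegrable ![c'] f := by
  simp [ContourIntegrable, integrable_paramMeasure, point, lineElement, Fin.forall_fin_two]

theorem contourIntegral_pair {c c' : ℝ → ℂ} {f : ℂ → ℂ} (h : ContourIntegrable ![c, c'] f) :
    contourIntegral ![c, c'] f = contourIntegral ![c] f + contourIntegral ![c'] f := by
  rw [contourIntegral_single, contourIntegral_single, contourIntegral, integral_paramMeasure h]
  simp [point, lineElement]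

/-- Integration along `Γ` is integration of `f * ρ` with respect to `μ`. -/
structure Represents {k : ℕ} (Γ : Fin k → ℝ → ℂ) (μ : Measure ℂ) (ρ : ℂ → ℂ) : Prop where
  measurable : Measurable ρ
  integrable_iff : ∀ f, ContourIntegrable Γ f ↔ Integrable (fun w => f w * ρ w) μ
  integral_eq : ∀ f, ContourIntegrable Γ f → contourIntegral Γ f = ∫ w, f w * ρ w ∂μ

/-- The unit tangent vector of a curve, as a function on the plane. -/
def unitTangent (c : ℝ → ℂ) : ℂ → ℂ :=
  Function.extend c (fun t => deriv c t / (‖deriv c t‖ : ℂ)) 0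

theorem IsUpwardContour.measurableEmbedding {c : ℝ → ℂ} (hc : IsUpwardContour c) :
    MeasurableEmbedding c :=
  hc.continuous.measurableEmbedding hc.injective

variable {c : ℝ → ℂ}

theorem IsUpwardContour.measurable_unitTangent (hc : IsUpwardContour c) :
    Measurable (unitTangent c) :=
  hc.measurableEmbedding.measurable_extend
    ((measurable_deriv c).div (measurable_deriv c).norm.complex_ofReal) measurable_const

/-- Holds for every `t`: where `c` is not differentiable or has zero speed, `deriv c t` is 0 and so
are both sides. -/
theorem IsUpwardContour.norm_mul_unitTangent (hc : IsUpwardContour c) (t : ℝ) :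
    (‖deriv c t‖ : ℂ) * unitTangent c (c t) = deriv c t := by
  rw [unitTangent, hc.injective.extend_apply]
  by_cases h : deriv c t = 0
  · simp [h]
  · have : (‖deriv c t‖ : ℂ) ≠ 0 := by simpa using h
    field_simp

theorem IsUpwardContour.norm_unitTangent_le (hc : IsUpwardContour c) (t : ℝ) :
    ‖unitTangent c (c t)‖ ≤ 1 := by
  rw [unitTangent, hc.injective.extend_apply, norm_div, norm_real, norm_norm]
  exact div_self_le_one _

theorem weightedArcMeasure_one (c : ℝ → ℂ) : weightedArcMeasure 1 c = arcMeasure c := by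
  simp [weightedArcMeasure]

theorem measurable_weight {σ : ℝ} (hσ : 0 < σ) : Measurable fun z : ℂ => σ ^ (-2 * z.re) :=
  (Continuous.rpow continuous_const (by fun_prop) fun _ => Or.inl hσ.ne').measurable

theorem ae_weightedArcMeasure (hc : IsUpwardContour c) (σ : ℝ) {p : ℂ → Prop}
    (h : ∀ t, p (c t)) : ∀ᵐ z ∂(weightedArcMeasure σ c), p z := by
  have h' : ∀ᵐ z ∂(arcMeasure c), p z := by
    rw [arcMeasure, hc.measurableEmbedding.ae_map_iff]
    exact Eventually.of_forall h
  exact (withDensity_absolutelyContinuous _ _).ae_le h'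

theorem integrable_arcMeasure_iff (hc : IsUpwardContour c) {f : ℂ → ℂ} :
    Integrable f (arcMeasure c) ↔ Integrable fun t => (‖deriv c t‖ : ℂ) * f (c t) := by
  rw [arcMeasure, hc.measurableEmbedding.integrable_map_iff]
  have := integrable_withDensity_iff_integrable_smul (μ := volume) (f := fun t => ‖deriv c t‖₊)
    (measurable_deriv c).nnnorm (g := f ∘ c)
  simp only [← enorm_eq_nnnorm] at this
  rw [this]
  rfl

theorem integral_arcMeasure (hc : IsUpwardContour c) (f : ℂ → ℂ) :
    ∫ z, f z ∂(arcMeasure c) = ∫ t, (‖deriv c t‖ : ℂ) * f (c t) := by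
  rw [arcMeasure, hc.measurableEmbedding.integral_map]
  have := integral_withDensity_eq_integral_smul (μ := volume) (f := fun t => ‖deriv c t‖₊)
    (measurable_deriv c).nnnorm (fun t => f (c t))
  simp only [← enorm_eq_nnnorm] at this
  rw [this]
  rfl

theorem integrable_weightedArcMeasure_iff {σ : ℝ} (hσ : 0 < σ) {f : ℂ → ℂ} :
    Integrable f (weightedArcMeasure σ c) ↔
      Integrable (fun z => ((σ ^ (-2 * z.re) : ℝ) : ℂ) * f z) (arcMeasure c) := by
  have := integrable_withDensity_iff_integrable_smul (μ := arcMeasure c)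
    (f := fun z => Real.toNNReal (σ ^ (-2 * z.re))) (measurable_weight hσ).real_toNNReal (g := f)
  refine this.trans (integrable_congr (Eventually.of_forall fun z => ?_))
  simp only [NNReal.smul_def, Real.coe_toNNReal _ (Real.rpow_nonneg hσ.le _), real_smul]

theorem integral_weightedArcMeasure {σ : ℝ} (hσ : 0 < σ) (f : ℂ → ℂ) :
    ∫ z, f z ∂(weightedArcMeasure σ c) =
      ∫ z, ((σ ^ (-2 * z.re) : ℝ) : ℂ) * f z ∂(arcMeasure c) := by
  have := integral_withDensity_eq_integral_smul (μ := arcMeasure c)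
    (f := fun z => Real.toNNReal (σ ^ (-2 * z.re))) (measurable_weight hσ).real_toNNReal f
  refine this.trans (integral_congr_ae (Eventually.of_forall fun z => ?_))
  simp only [NNReal.smul_def, Real.coe_toNNReal _ (Real.rpow_nonneg hσ.le _), real_smul]

/-- The density of `dz` with respect to the measure `|σ ^ (-z)|² |dz|`. -/
def contourDensity (σ : ℝ) (c : ℝ → ℂ) (z : ℂ) : ℂ :=
  ((σ ^ (2 * z.re) : ℝ) : ℂ) * unitTangent c z

theorem contourDensity_aux {σ : ℝ} (hσ : 0 < σ) (hc : IsUpwardContour c) (f : ℂ → ℂ) (t : ℝ) :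
    (‖deriv c t‖ : ℂ) * (((σ ^ (-2 * (c t).re) : ℝ) : ℂ) * (f (c t) * contourDensity σ c (c t))) =
      f (c t) * deriv c t := by
  have h : ((σ ^ (-2 * (c t).re) : ℝ) : ℂ) * ((σ ^ (2 * (c t).re) : ℝ) : ℂ) = 1 := by
    rw [← ofReal_mul, ← Real.rpow_add hσ]
    simp
  rw [contourDensity]
  linear_combination (‖deriv c t‖ : ℂ) * f (c t) * unitTangent c (c t) * h +
    f (c t) * hc.norm_mul_unitTangent t

theorem represents_weightedArcMeasure {σ : ℝ} (hσ : 0 < σ) (hc : IsUpwardContour c) :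
    Represents ![c] (weightedArcMeasure σ c) (contourDensity σ c) where
  measurable := by
    refine Measurable.mul ?_ hc.measurable_unitTangent
    have := measurable_weight (σ := σ⁻¹) (inv_pos.2 hσ)
    refine Measurable.complex_ofReal ?_
    convert this using 2 with z
    rw [Real.inv_rpow hσ.le, ← Real.rpow_neg hσ.le]
    ring_nf
  integrable_iff f := by
    rw [contourIntegrable_single, integrable_weightedArcMeasure_iff hσ,
      integrable_arcMeasure_iff hc]
    simp only [contourDensity_aux hσ hc]
  integral_eq f _ := by
    rw [contourIntegral_single, integral_weightedArcMeasure hσ, integral_arcMeasure hc]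
    simp only [contourDensity_aux hσ hc]

theorem Represents.pair {c c' : ℝ → ℂ} {μ μ' : Measure ℂ} {ρ ρ' : ℂ → ℂ}
    (h : Represents ![c] μ ρ) (h' : Represents ![c'] μ' ρ') (hc : MeasurableSet (range c))
    (hc' : MeasurableSet (range c')) (hd : Disjoint (range c) (range c'))
    (hμ : ∀ᵐ z ∂μ, z ∈ range c) (hμ' : ∀ᵐ z ∂μ', z ∈ range c') :
    Represents ![c, c'] (μ + μ')
      (fun z => (range c).indicator ρ z + (range c').indicator ρ' z) := by
  have e : ∀ f : ℂ → ℂ, (fun z => f z * ((range c).indicator ρ z + (range c').indicator ρ' z))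
      =ᵐ[μ] fun z => f z * ρ z := fun f => by
    filter_upwards [hμ] with z hz
    rw [indicator_of_mem hz, indicator_of_notMem (disjoint_left.1 hd hz), add_zero]
  have e' : ∀ f : ℂ → ℂ, (fun z => f z * ((range c).indicator ρ z + (range c').indicator ρ' z))
      =ᵐ[μ'] fun z => f z * ρ' z := fun f => by
    filter_upwards [hμ'] with z hz
    rw [indicator_of_mem hz, indicator_of_notMem (disjoint_right.1 hd hz), zero_add]
  have hi : ∀ f, ContourIntegrable ![c, c'] f ↔ Integrable (fun z => f z *
      ((range c).indicator ρ z + (range c').indicator ρ' z)) (μ + μ') := fun f => by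
    rw [contourIntegrable_pair, h.integrable_iff, h'.integrable_iff, integrable_add_measure,
      integrable_congr (e f), integrable_congr (e' f)]
  refine ⟨(h.measurable.indicator hc).add (h'.measurable.indicator hc'), hi, fun f hf => ?_⟩
  rw [contourIntegral_pair hf, integral_add_measure (integrable_add_measure.1 ((hi f).1 hf)).1
    (integrable_add_measure.1 ((hi f).1 hf)).2, integral_congr_ae (e f), integral_congr_ae (e' f),
    h.integral_eq _ (contourIntegrable_pair.1 hf).1, h'.integral_eq _ (contourIntegrable_pair.1 hf).2]

/-! ### Integrability along contours -/

/-- Take the least `n` with `x ≤ 2 ^ n`; minimality gives `2 ^ (n - 1) < x` unless `n = 0`. -/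
theorem exists_dyadic_bound (x : ℝ) (hx : 0 ≤ x) :
    ∃ n : ℕ, x ≤ 2 ^ n ∧ ((1 + x) ^ 2)⁻¹ ≤ 4 * (4 ^ n)⁻¹ := by
  classical
  have hex : ∃ n : ℕ, x ≤ 2 ^ n := (pow_unbounded_of_one_lt x one_lt_two).imp fun _ h => h.le
  refine ⟨Nat.find hex, Nat.find_spec hex, ?_⟩
  rcases h : Nat.find hex with _ | n
  · norm_num
    have : ((1 + x) ^ 2)⁻¹ ≤ 1 := inv_le_one_of_one_le₀ (by nlinarith)
    linarith
  · have h1 : ¬ x ≤ 2 ^ n := Nat.find_min hex (by omega)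
    push Not at h1
    have h2 : (4 : ℝ) ^ n ≤ (1 + x) ^ 2 := by
      calc (4 : ℝ) ^ n = (2 ^ n) ^ 2 := by rw [← pow_mul, mul_comm, pow_mul]; norm_num
        _ ≤ (1 + x) ^ 2 := by gcongr; linarith
    have h3 : (4 : ℝ) * (4 ^ (n + 1))⁻¹ = (4 ^ n)⁻¹ := by rw [pow_succ]; field_simp
    rw [h3]
    exact inv_anti₀ (by positivity) h2

/-- The ball of radius `2 ^ n` contains length `O(2 ^ n)` and carries the weight `4 · 4⁻ⁿ`, so the
dyadic sum is geometric. -/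
theorem IsUpwardContour.lintegral_inv_sq_lt_top (hc : IsUpwardContour c) :
    ∫⁻ z, ENNReal.ofReal ((1 + ‖z‖) ^ 2)⁻¹ ∂(arcMeasure c) < ⊤ := by
  obtain ⟨C, hC⟩ := hc.length_le
  have hle : ∀ z : ℂ, ENNReal.ofReal ((1 + ‖z‖) ^ 2)⁻¹ ≤
      ∑' n : ℕ, (Metric.closedBall (0 : ℂ) (2 ^ n)).indicator
        (fun _ => ENNReal.ofReal (4 * (4 ^ n)⁻¹)) z := fun z => by
    obtain ⟨n, h1, h2⟩ := exists_dyadic_bound ‖z‖ (norm_nonneg z)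
    refine le_trans ?_ (ENNReal.le_tsum n)
    rw [indicator_of_mem (by simpa using h1)]
    exact ENNReal.ofReal_le_ofReal h2
  refine (lintegral_mono hle).trans_lt ?_
  rw [lintegral_tsum fun n => (measurable_const.indicator measurableSet_closedBall).aemeasurable]
  have hterm : ∀ n : ℕ, ∫⁻ z, (Metric.closedBall (0 : ℂ) (2 ^ n)).indicator
        (fun _ => ENNReal.ofReal (4 * (4 ^ n)⁻¹)) z ∂(arcMeasure c) ≤
      ENNReal.ofReal (4 * |C| * (1 / 2) ^ n) := fun n => by
    rw [lintegral_indicator_const measurableSet_closedBall]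
    refine (mul_le_mul_right (hC (2 ^ n) (one_le_pow₀ one_le_two)) _).trans ?_
    rw [← ENNReal.ofReal_mul (by positivity)]
    refine ENNReal.ofReal_le_ofReal ?_
    have : (4 : ℝ) ^ n = 2 ^ n * 2 ^ n := by rw [← mul_pow]; norm_num
    rw [this, one_div, inv_pow]
    have h2 : (2 : ℝ) ^ n ≠ 0 := by positivity
    calc 4 * ((2 : ℝ) ^ n * 2 ^ n)⁻¹ * (C * 2 ^ n) = 4 * C * (2 ^ n)⁻¹ := by field_simp
      _ ≤ _ := by gcongr; exact le_abs_self C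
  refine (ENNReal.tsum_le_tsum hterm).trans_lt ?_
  rw [← ENNReal.ofReal_tsum_of_nonneg (fun n => by positivity)
    ((summable_geometric_of_lt_one (by norm_num) (by norm_num)).mul_left _)]
  exact ENNReal.ofReal_lt_top

theorem IsUpwardContour.memLp_two (hc : IsUpwardContour c) {σ : ℝ} (hσ : 0 < σ) {g : ℂ → ℂ}
    (hg : AEStronglyMeasurable g (weightedArcMeasure σ c)) (C : ℝ)
    (hC : ∀ t, ‖g (c t)‖ * σ ^ (-(c t).re) ≤ C * (1 + ‖c t‖)⁻¹) :
    MemLp g 2 (weightedArcMeasure σ c) := by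
  have hm : Measurable fun z : ℂ => ENNReal.ofReal (σ ^ (-2 * z.re)) :=
    (measurable_weight hσ).ennreal_ofReal
  refine ⟨hg, ?_⟩
  rw [eLpNorm_lt_top_iff_lintegral_rpow_enorm_lt_top (by norm_num) (by norm_num)]
  have h1 : ∫⁻ z, ‖g z‖ₑ ^ (2 : ENNReal).toReal ∂(weightedArcMeasure σ c) =
      ∫⁻ z, ENNReal.ofReal (σ ^ (-2 * z.re)) * ‖g z‖ₑ ^ (2 : ENNReal).toReal ∂(arcMeasure c) := by
    rw [weightedArcMeasure, lintegral_withDensity_eq_lintegral_mul_non_measurable _ hm]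
    · rfl
    · exact Eventually.of_forall fun _ => ENNReal.ofReal_lt_top
  rw [h1]
  refine lt_of_le_of_lt ?_ (ENNReal.mul_lt_top (ENNReal.ofReal_lt_top (r := C ^ 2))
    hc.lintegral_inv_sq_lt_top)
  rw [← lintegral_const_mul' _ _ ENNReal.ofReal_ne_top]
  have hae : ∀ᵐ z ∂(arcMeasure c), z ∈ range c := by
    have := ae_weightedArcMeasure hc 1 (p := fun z => z ∈ range c) fun t => ⟨t, rfl⟩
    rwa [weightedArcMeasure_one] at this
  refine lintegral_mono_ae (hae.mono ?_)
  rintro _ ⟨t, rfl⟩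
  have h2 := hC t
  rw [ENNReal.toReal_ofNat, ENNReal.rpow_ofNat, ← ofReal_norm,
    ← ENNReal.ofReal_pow (norm_nonneg _),
    ← ENNReal.ofReal_mul (by positivity), ← ENNReal.ofReal_mul (by positivity)]
  refine ENNReal.ofReal_le_ofReal ?_
  have h3 : σ ^ (-2 * (c t).re) = (σ ^ (-(c t).re)) ^ 2 := by
    rw [← Real.rpow_natCast, ← Real.rpow_mul hσ.le]; congr 1; push_cast; ring
  rw [h3, ← mul_pow, ← inv_pow, ← mul_pow, mul_comm]
  exact pow_le_pow_left₀ (by positivity) h2 2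

theorem IsUpwardContour.integrable_of_le (hc : IsUpwardContour c) {g : ℂ → ℂ} (hg : Measurable g)
    (C : ℝ) (hC : ∀ t, ‖g (c t)‖ ≤ C * ((1 + ‖c t‖) ^ 2)⁻¹) :
    Integrable fun t => g (c t) * deriv c t := by
  have h0 : Integrable (fun z : ℂ => ((((1 + ‖z‖) ^ 2)⁻¹ : ℝ) : ℂ)) (arcMeasure c) := by
    refine ⟨by fun_prop, ?_⟩
    refine lt_of_eq_of_lt ?_ hc.lintegral_inv_sq_lt_top
    refine lintegral_congr fun z => ?_
    rw [← ofReal_norm, norm_real, Real.norm_of_nonneg (by positivity)]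
  rw [integrable_arcMeasure_iff hc] at h0
  refine Integrable.mono' (h0.norm.const_mul C) ?_ (Eventually.of_forall fun t => ?_)
  · exact ((hg.comp hc.continuous.measurable).mul (measurable_deriv c)).aestronglyMeasurable
  · have : ‖((((1 + ‖c t‖) ^ 2)⁻¹ : ℝ) : ℂ)‖ = ((1 + ‖c t‖) ^ 2)⁻¹ := by
      rw [norm_real, Real.norm_of_nonneg (by positivity)]
    rw [norm_mul, norm_mul, this, norm_real, norm_norm]
    nlinarith [mul_le_mul_of_nonneg_right (hC t) (norm_nonneg (deriv c t))]

end

/-! ### Integral operators with a separated expansion -/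

/-- Termwise integration under absolute summability; `g` need not be assumed measurable, being an
a.e. limit of the partial sums. -/
theorem integrable_and_hasSum_integral {α : Type*} [MeasurableSpace α] {μ : Measure α}
    {f : ℕ → α → ℂ} {g : α → ℂ} (hf : ∀ n, AEStronglyMeasurable (f n) μ)
    (hsum : ∑' n, ∫⁻ a, ‖f n a‖ₑ ∂μ ≠ ⊤) (hg : ∀ᵐ a ∂μ, HasSum (fun n => f n a) (g a)) :
    Integrable g μ ∧ HasSum (fun n => ∫ a, f n a ∂μ) (∫ a, g a ∂μ) := by
  have hInt : ∀ n, Integrable (f n) μ := fun n =>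
    ⟨hf n, (ENNReal.le_tsum n).trans_lt hsum.lt_top⟩
  have htsum : (fun a => ∑' n, f n a) =ᵐ[μ] g := hg.mono fun a ha => ha.tsum_eq
  refine ⟨⟨?_, ?_⟩, ?_⟩
  · refine aestronglyMeasurable_of_tendsto_ae atTop (f := fun N a => ∑ n ∈ Finset.range N, f n a)
      (fun N => Finset.aestronglyMeasurable_fun_sum _ fun n _ => hf n)
      (hg.mono fun a ha => ha.tendsto_sum_nat)
  · refine lt_of_le_of_lt ?_ hsum.lt_top
    rw [← lintegral_tsum fun n => (hf n).enorm]
    refine lintegral_mono_ae (hg.mono fun a ha => ?_)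
    rw [← ha.tsum_eq]
    exact enorm_tsum_le_tsum_enorm
  · rw [← integral_congr_ae htsum]
    refine hasSum_integral_of_summable_integral_norm hInt ?_
    simp_rw [integral_norm_eq_lintegral_enorm (hf _)]
    exact ENNReal.summable_toReal hsum

theorem hasSum_of_eq {f g : ℕ → ℂ} {a b : ℂ} (h : HasSum f a) (hf : ∀ n, g n = f n)
    (ha : b = a) : HasSum g b := by
  rw [ha, funext hf]
  exact h

/-- Partial sums converging in `L²` have an a.e. convergent subsequence, so the `L²` sum and the
pointwise sum agree. -/
theorem ae_eq_of_hasSum {α : Type*} [MeasurableSpace α] {μ : Measure α}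
    {f : ℕ → Lp ℂ 2 μ} {T : Lp ℂ 2 μ} {g : α → ℂ} (hf : HasSum f T)
    (hg : ∀ᵐ a ∂μ, HasSum (fun n => f n a) (g a)) : T =ᵐ[μ] g := by
  obtain ⟨ns, hns, h⟩ := (tendstoInMeasure_of_tendsto_Lp hf.tendsto_sum_nat).exists_seq_tendsto_ae
  have hs : ∀ᵐ a ∂μ, ∀ N : ℕ, (∑ n ∈ Finset.range N, f n : Lp ℂ 2 μ) a =
      ∑ n ∈ Finset.range N, f n a := by
    refine ae_all_iff.2 fun N => ?_
    filter_upwards [Lp.coeFn_finsetSum (Finset.range N) f] with a ha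
    rw [ha, Finset.sum_apply]
  filter_upwards [h, hg, hs] with a h1 h2 h3
  simp only [h3] at h1
  exact tendsto_nhds_unique h1 (h2.tendsto_sum_nat.comp hns.tendsto_atTop)

/-- A kernel `∑ y_n(z) x_n(w)` gives the sum of rank one operators `φ ↦ (∫ x_n ρ φ dμ) y_n`,
absolutely convergent in operator norm because `‖y_n‖ ≤ ‖Y‖` and `‖x_n ρ‖ ≤ B n`. The same bounds
allow termwise integration for each fixed `z`, which identifies the sum with the integral operator.
-/
theorem exists_isTraceClass_isIntegralOperator {k : ℕ} {Γ : Fin k → ℝ → ℂ} {μ ν : Measure ℂ}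
    {ρ : ℂ → ℂ} (hρ : Represents Γ μ ρ) {K : ℂ → ℂ → ℂ} {y x : ℕ → ℂ → ℂ} {Y : ℂ → ℝ}
    (hy : ∀ n, Measurable (y n)) (hyY : ∀ n z, ‖y n z‖ ≤ Y z) (hY : MemLp Y 2 ν)
    {B : ℕ → ℝ} (hB : Summable B) (hB0 : ∀ n, 0 ≤ B n)
    (hxm : ∀ n, AEStronglyMeasurable (fun w => x n w * ρ w) μ)
    (hx : ∀ n, eLpNorm (fun w => x n w * ρ w) 2 μ ≤ ENNReal.ofReal (B n))
    (hK : ∀ z w, HasSum (fun n => y n z * x n w) (K z w)) :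
    ∃ T : Lp ℂ 2 μ →L[ℂ] Lp ℂ 2 ν, IsIntegralOperator Γ K T ∧ IsTraceClass T := by
  have hyL : ∀ n, MemLp (y n) 2 ν := fun n =>
    hY.mono' (hy n).aestronglyMeasurable (Eventually.of_forall (hyY n))
  have hxL : ∀ n, MemLp (fun w => x n w * ρ w) 2 μ := fun n =>
    ⟨hxm n, (hx n).trans_lt ENNReal.ofReal_lt_top⟩
  -- Conjugated, since the inner product is antilinear in its first argument.
  have hxs : ∀ n, MemLp (fun w => starRingEnd ℂ (x n w * ρ w)) 2 μ := fun n => (hxL n).star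
  set u : ℕ → Lp ℂ 2 μ := fun n => (hxs n).toLp with hu
  set v : ℕ → Lp ℂ 2 ν := fun n => (hyL n).toLp with hv
  have hun : ∀ n, ‖u n‖ ≤ B n := fun n => by
    rw [Lp.norm_toLp]
    refine ENNReal.toReal_le_of_le_ofReal (hB0 n) (le_trans (le_of_eq ?_) (hx n))
    exact eLpNorm_congr_norm_ae (Eventually.of_forall fun w => by simp)
  have hvn : ∀ n, ‖v n‖ ≤ (eLpNorm Y 2 ν).toReal := fun n => by
    rw [Lp.norm_toLp]
    refine ENNReal.toReal_mono hY.2.ne (eLpNorm_mono_ae (Eventually.of_forall fun z => ?_))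
    exact (hyY n z).trans (le_abs_self _)
  have hsum : Summable fun n => ‖u n‖ * ‖v n‖ :=
    Summable.of_nonneg_of_le (fun n => by positivity)
      (fun n => mul_le_mul (hun n) (hvn n) (norm_nonneg _) (hB0 n)) (hB.mul_right _)
  set R : ℕ → Lp ℂ 2 μ →L[ℂ] Lp ℂ 2 ν := fun n => (innerSL ℂ (u n)).smulRight (v n) with hR
  have hRs : Summable R := by
    refine Summable.of_norm_bounded hsum fun n => ?_
    rw [hR, ContinuousLinearMap.norm_smulRight_apply, innerSL_apply_norm]
  set T := ∑' n, R n with hT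
  have hTφ : ∀ φ, HasSum (fun n => inner ℂ (u n) φ • v n) (T φ) := fun φ => by
    have h := (ContinuousLinearMap.apply ℂ (Lp ℂ 2 ν) φ).hasSum hRs.hasSum
    exact h
  refine ⟨T, fun φ => ?_, u, v, hsum, hTφ⟩
  have hinner : ∀ n, inner ℂ (u n) φ = ∫ w, x n w * ρ w * φ w ∂μ := fun n => by
    rw [L2.inner_def]
    refine integral_congr_ae ((hxs n).coeFn_toLp.mono fun w hw => ?_)
    simp only [hu, hw, RCLike.inner_apply, RCLike.conj_conj]
    ring
  have key : ∀ z, Integrable (fun w => K z w * φ w * ρ w) μ ∧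
      HasSum (fun n => inner ℂ (u n) φ * y n z) (∫ w, K z w * φ w * ρ w ∂μ) := fun z => by
    have h := integrable_and_hasSum_integral (μ := μ)
      (f := fun n w => y n z * (x n w * ρ w * φ w)) (g := fun w => K z w * φ w * ρ w)
      (fun n => ((hxm n).mul (Lp.aestronglyMeasurable φ)).const_mul _) ?_
      (Eventually.of_forall fun w => ?_)
    · refine ⟨h.1, ?_⟩
      exact hasSum_of_eq h.2 (fun n => by rw [hinner, integral_const_mul, mul_comm]) rfl
    · have hle : ∀ n, ∫⁻ w, ‖y n z * (x n w * ρ w * φ w)‖ₑ ∂μ ≤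
          ENNReal.ofReal (Y z * B n) * eLpNorm φ 2 μ := fun n => by
        have h1 := eLpNorm_smul_le_mul_eLpNorm (p := 2) (q := 2) (r := 1)
          (Lp.aestronglyMeasurable φ) (hxm n)
        rw [eLpNorm_one_eq_lintegral_enorm] at h1
        have hY0 : 0 ≤ Y z := (norm_nonneg _).trans (hyY 0 z)
        simp_rw [enorm_mul (y n z)]
        rw [lintegral_const_mul' _ _ enorm_ne_top, ENNReal.ofReal_mul hY0, mul_assoc]
        refine mul_le_mul' ?_ (h1.trans (mul_le_mul' (hx n) le_rfl))
        rw [← ofReal_norm]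
        exact ENNReal.ofReal_le_ofReal (hyY n z)
      refine ne_top_of_le_ne_top ?_ (ENNReal.tsum_le_tsum hle)
      rw [ENNReal.tsum_mul_right]
      refine ENNReal.mul_ne_top ?_ (Lp.eLpNorm_ne_top φ)
      exact (hB.mul_left (Y z)).tsum_ofReal_ne_top
    · have := ((hK z w).mul_right (ρ w)).mul_right (φ w)
      exact hasSum_of_eq this (fun n => by ring) (by ring)
  have hTz : T φ =ᵐ[ν] fun z => ∫ w, K z w * φ w * ρ w ∂μ := by
    refine ae_eq_of_hasSum (hTφ φ) ?_
    have h1 : ∀ᵐ z ∂ν, ∀ n, (inner ℂ (u n) φ • v n : Lp ℂ 2 ν) z = inner ℂ (u n) φ * y n z := by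
      refine ae_all_iff.2 fun n => ?_
      filter_upwards [Lp.coeFn_smul (inner ℂ (u n) φ) (v n), (hyL n).coeFn_toLp] with z h1 h2
      rw [h1, Pi.smul_apply, hv, h2, smul_eq_mul]
    filter_upwards [h1] with z hz
    simp only [hz]
    exact (key z).2
  filter_upwards [hTz] with z hz
  have hc := (hρ.integrable_iff fun w => K z w * φ w).2 (key z).1
  exact ⟨hc, by rw [hz, hρ.integral_eq _ hc]⟩

/-! ### Sums and compositions of integral operators and of trace class operators -/

theorem IsIntegralOperator.congr {k : ℕ} {Γ : Fin k → ℝ → ℂ} {μ ν : Measure ℂ}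
    {K K' : ℂ → ℂ → ℂ} {T : Lp ℂ 2 μ →L[ℂ] Lp ℂ 2 ν} (hT : IsIntegralOperator Γ K T)
    (h : ∀ᵐ z ∂ν, ∀ p, K z (point Γ p) = K' z (point Γ p)) : IsIntegralOperator Γ K' T := by
  intro φ
  filter_upwards [hT φ, h] with z hz he
  simpa only [ContourIntegrable, contourIntegral, he] using hz

theorem IsIntegralOperator.add {k : ℕ} {Γ : Fin k → ℝ → ℂ} {μ ν : Measure ℂ}
    {K K' : ℂ → ℂ → ℂ} {T T' : Lp ℂ 2 μ →L[ℂ] Lp ℂ 2 ν} (hT : IsIntegralOperator Γ K T)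
    (hT' : IsIntegralOperator Γ K' T') :
    IsIntegralOperator Γ (fun z w => K z w + K' z w) (T + T') := by
  intro φ
  filter_upwards [hT φ, hT' φ, Lp.coeFn_add (T φ) (T' φ)] with z h1 h2 h3
  simp only [ContourIntegrable, contourIntegral, add_mul] at h1 h2 ⊢
  refine ⟨h1.1.add h2.1, ?_⟩
  rw [add_apply, h3, Pi.add_apply, h1.2, h2.2, integral_add h1.1 h2.1]

theorem hasSum_sum_elim {G : Type*} [NormedAddCommGroup G] {f : ℕ ⊕ ℕ → G} {a b : G}
    (ha : HasSum (fun n => f (Sum.inl n)) a) (hb : HasSum (fun n => f (Sum.inr n)) b) :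
    HasSum f (a + b) := by
  have h1 := Sum.inl_injective.hasSum_range_iff.2 ha
  have h2 := Sum.inr_injective.hasSum_range_iff.2 hb
  exact h1.add_isCompl Set.isCompl_range_inl_range_inr h2

theorem IsTraceClass.add {E G : Type*} [NormedAddCommGroup E] [InnerProductSpace ℂ E]
    [NormedAddCommGroup G] [InnerProductSpace ℂ G] {S T : E →L[ℂ] G} (hS : IsTraceClass S)
    (hT : IsTraceClass T) : IsTraceClass (S + T) := by
  obtain ⟨x, y, hxy, h⟩ := hS
  obtain ⟨x', y', hxy', h'⟩ := hT
  let e : ℕ ≃ ℕ ⊕ ℕ := Equiv.natSumNatEquivNat.symm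
  refine ⟨fun n => Sum.elim x x' (e n), fun n => Sum.elim y y' (e n), ?_, fun φ => ?_⟩
  · refine (e.summable_iff (f := fun i => ‖Sum.elim x x' i‖ * ‖Sum.elim y y' i‖)).2 ?_
    exact (hasSum_sum_elim hxy.hasSum hxy'.hasSum).summable
  · refine (e.hasSum_iff (f := fun i => inner ℂ (Sum.elim x x' i) φ • Sum.elim y y' i)).2 ?_
    exact hasSum_sum_elim (h φ) (h' φ)

theorem IsTraceClass.comp {E F G : Type*} [NormedAddCommGroup E] [InnerProductSpace ℂ E]
    [CompleteSpace E] [NormedAddCommGroup F] [InnerProductSpace ℂ F] [CompleteSpace F]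
    [NormedAddCommGroup G] [InnerProductSpace ℂ G] {S : F →L[ℂ] G} (hS : IsTraceClass S)
    (T : E →L[ℂ] F) : IsTraceClass (S ∘L T) := by
  obtain ⟨x, y, hxy, h⟩ := hS
  refine ⟨fun n => T.adjoint (x n), y, ?_, fun φ => ?_⟩
  · refine Summable.of_nonneg_of_le (fun n => by positivity) (fun n => ?_)
      (hxy.mul_left ‖T.adjoint‖)
    rw [← mul_assoc]
    gcongr
    exact T.adjoint.le_opNorm _
  · simp only [ContinuousLinearMap.adjoint_inner_left]
    exact h (T φ)

/-! ### The Cauchy kernel -/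

/-- The Cayley transform, which maps the right half plane to the unit disc. -/
def cayley (Z : ℂ) : ℂ := (Z - 1) / (Z + 1)

theorem measurable_cayley : Measurable cayley :=
  (measurable_id.sub_const 1).div (measurable_id.add_const 1)

theorem add_one_ne_zero_of_re_pos {Z : ℂ} (hZ : 0 < Z.re) : Z + 1 ≠ 0 := fun h => by
  have := congrArg re h
  simp only [add_re, one_re, zero_re] at this
  linarith

theorem norm_cayley_sq {Z : ℂ} (hZ : 0 < Z.re) :
    ‖cayley Z‖ ^ 2 = 1 - 4 * Z.re / ‖Z + 1‖ ^ 2 := by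
  have h : ‖Z + 1‖ ^ 2 ≠ 0 := pow_ne_zero 2 (norm_ne_zero_iff.2 (add_one_ne_zero_of_re_pos hZ))
  have h1 : ‖Z - 1‖ ^ 2 = ‖Z + 1‖ ^ 2 - 4 * Z.re := by
    rw [← normSq_eq_norm_sq, ← normSq_eq_norm_sq, normSq_apply, normSq_apply]
    simp only [sub_re, sub_im, add_re, add_im, one_re, one_im]
    ring
  rw [cayley, norm_div, div_pow, h1, sub_div, div_self h]

theorem norm_cayley_lt_one {Z : ℂ} (hZ : 0 < Z.re) : ‖cayley Z‖ < 1 := by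
  have h0 : 0 < ‖Z + 1‖ := norm_pos_iff.2 (add_one_ne_zero_of_re_pos hZ)
  have h : ‖cayley Z‖ ^ 2 < 1 := by
    rw [norm_cayley_sq hZ]
    have : 0 < 4 * Z.re / ‖Z + 1‖ ^ 2 := by positivity
    linarith
  nlinarith [norm_nonneg (cayley Z)]

/-- From `1 - ‖cayley U‖² = 4 Re U / ‖U + 1‖² ≥ 2η` with `η = 2κ / (1 + ‖U‖)` one gets `‖cayley U‖ ^
n ≤ exp (-nη)`. Trading this for `2 / (η (n + 1))²` makes the series summable in `n` at the cost of
polynomial growth in `U`. -/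
theorem norm_cayley_pow_le {U : ℂ} {κ : ℝ} (hκ : 0 < κ) (hκ' : κ ≤ 1 / 2)
    (hU : κ * (1 + ‖U‖) ≤ U.re) (n : ℕ) :
    ‖cayley U‖ ^ n ≤ (1 + ‖U‖) ^ 2 / (2 * κ ^ 2 * (n + 1) ^ 2) := by
  set η : ℝ := 2 * κ / (1 + ‖U‖) with hη
  have hU1 : 0 < 1 + ‖U‖ := by positivity
  have hη0 : 0 < η := by positivity
  have hη1 : η ≤ 1 := by
    rw [hη, div_le_one hU1]
    linarith [norm_nonneg U]
  have hre : 0 < U.re := lt_of_lt_of_le (by positivity) hU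
  have h0 : 0 < ‖U + 1‖ := norm_pos_iff.2 (add_one_ne_zero_of_re_pos hre)
  have h1 : ‖cayley U‖ ≤ Real.exp (-η) := by
    refine le_of_sq_le_sq ?_ (Real.exp_pos _).le
    rw [norm_cayley_sq hre, ← Real.exp_nat_mul]
    have h2 : 2 * η ≤ 4 * U.re / ‖U + 1‖ ^ 2 := by
      have h3 : ‖U + 1‖ ≤ 1 + ‖U‖ := by
        have := norm_add_le U 1
        rw [norm_one] at this
        linarith
      rw [le_div_iff₀ (by positivity), hη]
      calc 2 * (2 * κ / (1 + ‖U‖)) * ‖U + 1‖ ^ 2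
          ≤ 2 * (2 * κ / (1 + ‖U‖)) * (1 + ‖U‖) ^ 2 := by gcongr
        _ = 4 * (κ * (1 + ‖U‖)) := by field_simp; ring
        _ ≤ 4 * U.re := by gcongr
    have h4 := Real.add_one_le_exp (((2 : ℕ) : ℝ) * -η)
    push_cast at h4 ⊢
    linarith
  have h5 : ‖cayley U‖ ^ n ≤ Real.exp (-(n * η)) := by
    refine (pow_le_pow_left₀ (norm_nonneg _) h1 n).trans_eq ?_
    rw [← Real.exp_nat_mul]
    ring_nf
  refine h5.trans ?_
  have hn : (0 : ℝ) ≤ n := n.cast_nonneg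
  have h6 := Real.quadratic_le_exp_of_nonneg (x := n * η) (by positivity)
  -- `η ≤ 1`, a consequence of `κ ≤ 1/2`, allows `n + 1` in place of `n`, so that `n = 0` is covered
  -- too.
  have h7 : (η * (n + 1)) ^ 2 ≤ 2 * Real.exp (n * η) := by
    have : η * (n + 1) ≤ 1 + n * η := by linarith
    calc (η * (n + 1)) ^ 2 ≤ (1 + n * η) ^ 2 := by gcongr
      _ ≤ _ := by nlinarith
  rw [Real.exp_neg, inv_le_comm₀ (Real.exp_pos _) (by positivity), inv_div]
  have h8 : 2 * κ ^ 2 * (n + 1) ^ 2 / (1 + ‖U‖) ^ 2 = (η * (n + 1)) ^ 2 / 2 := by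
    rw [hη]; field_simp
  rw [h8]
  linarith

/-- A geometric series, because `1 - cayley Z * cayley U = 2 (Z + U) / ((Z + 1) (U + 1))`. -/
theorem hasSum_cayley {Z U : ℂ} (hZ : 0 < Z.re) (hU : 0 < U.re) :
    HasSum (fun n : ℕ => 2 / ((Z + 1) * (U + 1)) * (cayley Z ^ n * cayley U ^ n))
      (1 / (Z + U)) := by
  have hlt : ‖cayley Z * cayley U‖ < 1 := by
    rw [norm_mul]
    have h1 := norm_cayley_lt_one hZ
    have h2 := norm_cayley_lt_one hU
    nlinarith [norm_nonneg (cayley Z), norm_nonneg (cayley U)]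
  have h := (hasSum_geometric_of_norm_lt_one hlt).mul_left (2 / ((Z + 1) * (U + 1)))
  simp only [mul_pow] at h
  refine hasSum_of_eq h (fun n => rfl) ?_
  have h1 := add_one_ne_zero_of_re_pos hZ
  have h2 := add_one_ne_zero_of_re_pos hU
  have h3 : Z + U ≠ 0 := fun h => by
    have := congrArg re h
    simp only [add_re, zero_re] at this
    linarith
  have h4 : 1 - cayley Z * cayley U = 2 * (Z + U) / ((Z + 1) * (U + 1)) := by
    rw [cayley, cayley]; field_simp; ring
  rw [h4]
  field_simp

/-- Operators whose kernel is a Cauchy kernel with a rapidly decaying weight in the second variable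
are trace class. -/
theorem exists_isTraceClass_cauchy {k : ℕ} {Γ : Fin k → ℝ → ℂ} {μ ν : Measure ℂ}
    {ρ : ℂ → ℂ} (hρ : Represents Γ μ ρ) {a b P Q : ℂ → ℂ} (ham : Measurable a) (hbm : Measurable b)
    (hPm : Measurable P) (hQm : Measurable Q) {κ : ℝ} (hκ : 0 < κ) (hκ' : κ ≤ 1 / 2)
    (hP : ∀ z, a z ≠ 0 → 0 < (P z).re) (hQ : ∀ w, b w ≠ 0 → κ * (1 + ‖Q w‖) ≤ (Q w).re)
    (ha : MemLp (fun z => a z / (P z + 1)) 2 ν)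
    (hb : MemLp (fun w => b w * ((1 + ‖Q w‖) ^ 2 : ℝ) * ρ w) 2 μ) :
    ∃ T : Lp ℂ 2 μ →L[ℂ] Lp ℂ 2 ν,
      IsIntegralOperator Γ (fun z w => a z * b w / (P z + Q w)) T ∧ IsTraceClass T := by
  have hρm := hρ.measurable
  have hcm := measurable_cayley
  set N : ℝ := (eLpNorm (fun w => b w * ((1 + ‖Q w‖) ^ 2 : ℝ) * ρ w) 2 μ).toReal with hN
  -- The Cayley expansion is needed only where `a z` and `b w` are nonzero; elsewhere all terms
  -- vanish. This permits `a` and `b` that are extended by zero off their contours.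
  refine exists_isTraceClass_isIntegralOperator hρ
    (y := fun n z => a z / (P z + 1) * cayley (P z) ^ n)
    (x := fun n w => 2 * (b w / (Q w + 1)) * cayley (Q w) ^ n)
    (Y := fun z => ‖a z / (P z + 1)‖) (B := fun n => (κ ^ 2)⁻¹ * (((n + 1 : ℝ)) ^ 2)⁻¹ * N)
    (fun n => by fun_prop) (fun n z => ?_) ha.norm ?_ (fun n => by positivity) (fun n => ?_)
    (fun n => ?_) (fun z w => ?_)
  · by_cases h : a z = 0
    · simp [h]
    · rw [norm_mul, norm_pow]
      exact mul_le_of_le_one_right (norm_nonneg _)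
        (pow_le_one₀ (norm_nonneg _) (norm_cayley_lt_one (hP z h)).le)
  · refine (Summable.mul_left _ ?_).mul_right _
    have := (summable_nat_add_iff 1).2 (Real.summable_nat_pow_inv.2 one_lt_two)
    simpa using this
  · exact (by fun_prop : Measurable _).aestronglyMeasurable
  · have hle : ∀ w, ‖2 * (b w / (Q w + 1)) * cayley (Q w) ^ n * ρ w‖ ≤
        ((κ ^ 2)⁻¹ * ((n + 1 : ℝ) ^ 2)⁻¹) * ‖b w * ((1 + ‖Q w‖) ^ 2 : ℝ) * ρ w‖ := fun w => by
      by_cases h : b w = 0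
      · simp [h]
      have hq := hQ w h
      have hre : 0 < (Q w).re := lt_of_lt_of_le (by positivity) hq
      have h1 : 1 ≤ ‖Q w + 1‖ := by
        refine le_trans ?_ (re_le_norm _)
        simp only [add_re, one_re]
        linarith
      have h2 := norm_cayley_pow_le hκ hκ' hq n
      have h3 : ‖(((1 + ‖Q w‖) ^ 2 : ℝ) : ℂ)‖ = (1 + ‖Q w‖) ^ 2 := by
        rw [norm_real, Real.norm_of_nonneg (by positivity)]
      have h4 : ‖b w‖ / ‖Q w + 1‖ ≤ ‖b w‖ := div_le_self (norm_nonneg _) h1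
      rw [norm_mul _ (ρ w), norm_mul _ (ρ w), norm_mul, norm_mul, norm_mul (b w), h3, norm_ofNat,
        norm_div, norm_pow, ← mul_assoc]
      refine mul_le_mul_of_nonneg_right ?_ (norm_nonneg _)
      calc 2 * (‖b w‖ / ‖Q w + 1‖) * ‖cayley (Q w)‖ ^ n
          ≤ 2 * ‖b w‖ * ((1 + ‖Q w‖) ^ 2 / (2 * κ ^ 2 * (n + 1) ^ 2)) := by gcongr
        _ = _ := by field_simp
    refine (eLpNorm_le_mul_eLpNorm_of_ae_le_mul (Eventually.of_forall hle) 2).trans_eq ?_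
    rw [hN, ENNReal.ofReal_mul (by positivity) (q := ENNReal.toReal _),
      ENNReal.ofReal_toReal hb.2.ne]
  · by_cases h1 : a z = 0
    · simp [h1]
    by_cases h2 : b w = 0
    · simp [h2]
    have hre : 0 < (Q w).re := lt_of_lt_of_le (by positivity) (hQ w h2)
    have := (hasSum_cayley (hP z h1) hre).mul_left (a z * b w)
    have h3 := add_one_ne_zero_of_re_pos (hP z h1)
    have h4 := add_one_ne_zero_of_re_pos hre
    exact hasSum_of_eq this (fun n => by field_simp) (by ring)

section

/-! ### Rapidly decreasing functions on a contour -/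

/-- `b` decays faster than any exponential along the curve `c`. -/
def RapidlyDecreasing (c : ℝ → ℂ) (b : ℂ → ℂ) : Prop :=
  ∀ K : ℝ, 0 ≤ K → ∃ C, 0 < C ∧ ∀ t, ‖b (c t)‖ ≤ C * Real.exp (-K * ‖c t‖)

variable {c : ℝ → ℂ} {b : ℂ → ℂ}

theorem rpow_le_exp_norm {σ : ℝ} (hσ : 0 < σ) {x : ℝ} {z : ℂ} (hx : |x| ≤ ‖z‖) :
    σ ^ x ≤ Real.exp (|Real.log σ| * ‖z‖) := by
  rw [Real.rpow_def_of_pos hσ]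
  refine Real.exp_le_exp.2 ?_
  calc Real.log σ * x ≤ |Real.log σ * x| := le_abs_self _
    _ = |Real.log σ| * |x| := abs_mul _ _
    _ ≤ _ := by gcongr

theorem RapidlyDecreasing.of_norm_le {b' : ℂ → ℂ} (hb : RapidlyDecreasing c b) {L D : ℝ}
    (hL : 0 ≤ L) (hD : 0 < D) (h : ∀ t, ‖b' (c t)‖ ≤ D * Real.exp (L * ‖c t‖) * ‖b (c t)‖) :
    RapidlyDecreasing c b' := by
  intro K hK
  obtain ⟨C, hC0, hC⟩ := hb (K + L) (by positivity)
  refine ⟨D * C, by positivity, fun t => (h t).trans ?_⟩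
  calc D * Real.exp (L * ‖c t‖) * ‖b (c t)‖
      ≤ D * Real.exp (L * ‖c t‖) * (C * Real.exp (-(K + L) * ‖c t‖)) := by
        gcongr; exact hC t
    _ = D * C * (Real.exp (L * ‖c t‖) * Real.exp (-(K + L) * ‖c t‖)) := by ring
    _ = _ := by rw [← Real.exp_add]; ring_nf

theorem exp_neg_nat_mul_le {x : ℝ} (hx : 0 ≤ x) (n : ℕ) :
    Real.exp (-(n * x)) ≤ ((1 + x) ^ n)⁻¹ := by
  rw [Real.exp_neg, Real.exp_nat_mul]
  refine inv_anti₀ (by positivity) ?_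
  gcongr
  linarith [Real.add_one_le_exp x]

theorem RapidlyDecreasing.exists_le_inv_pow (hb : RapidlyDecreasing c b) (n : ℕ) :
    ∃ C, 0 < C ∧ ∀ t, ‖b (c t)‖ ≤ C * ((1 + ‖c t‖) ^ n)⁻¹ := by
  obtain ⟨C, hC0, hC⟩ := hb n n.cast_nonneg
  refine ⟨C, hC0, fun t => (hC t).trans ?_⟩
  gcongr
  rw [neg_mul]
  exact exp_neg_nat_mul_le (norm_nonneg _) n

theorem RapidlyDecreasing.integrable (hb : RapidlyDecreasing c b) (hc : IsUpwardContour c)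
    (hbm : Measurable b) : Integrable fun t => b (c t) * deriv c t := by
  obtain ⟨C, _, hC⟩ := hb.exists_le_inv_pow 2
  exact hc.integrable_of_le hbm C hC

/-- The density contributes `σ ^ (2 Re w)` and the square root of the weight `σ ^ (-Re w)`; the
remaining `σ ^ (Re w)` is at most exponential and is absorbed by `b`. -/
theorem RapidlyDecreasing.memLp_mul_contourDensity (hb : RapidlyDecreasing c b)
    (hc : IsUpwardContour c) (hbm : Measurable b) {σ : ℝ} (hσ : 0 < σ) :
    MemLp (fun w => b w * contourDensity σ c w) 2 (weightedArcMeasure σ c) := by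
  have hρ := (represents_weightedArcMeasure hσ hc).measurable
  have h : RapidlyDecreasing c fun w => ((σ ^ w.re : ℝ) : ℂ) * b w := by
    refine hb.of_norm_le (abs_nonneg (Real.log σ)) one_pos fun t => ?_
    rw [norm_mul, norm_real, Real.norm_of_nonneg (by positivity), one_mul]
    gcongr
    exact rpow_le_exp_norm hσ (abs_re_le_norm _)
  obtain ⟨C, hC0, hC⟩ := h.exists_le_inv_pow 1
  refine hc.memLp_two hσ (by fun_prop) C fun t => ?_
  have h1 := hC t
  rw [pow_one, norm_mul, norm_real, Real.norm_of_nonneg (by positivity)] at h1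
  refine le_trans ?_ h1
  rw [norm_mul, contourDensity, norm_mul, norm_real, Real.norm_of_nonneg (by positivity)]
  have h2 : σ ^ (2 * (c t).re) * σ ^ (-(c t).re) = σ ^ (c t).re := by
    rw [← Real.rpow_add hσ]; ring_nf
  calc ‖b (c t)‖ * (σ ^ (2 * (c t).re) * ‖unitTangent c (c t)‖) * σ ^ (-(c t).re)
      = (σ ^ (2 * (c t).re) * σ ^ (-(c t).re)) * ‖b (c t)‖ * ‖unitTangent c (c t)‖ := by ring
    _ ≤ _ := by
      rw [h2]
      exact mul_le_of_le_one_right (by positivity) (hc.norm_unitTangent_le t)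

theorem memLp_two_add_measure {μ ν : Measure ℂ} {g : ℂ → ℂ} (hμ : MemLp g 2 μ)
    (hν : MemLp g 2 ν) : MemLp g 2 (μ + ν) := by
  have hg : AEStronglyMeasurable g (μ + ν) := hμ.1.add_measure hν.1
  rw [memLp_two_iff_integrable_sq_norm hg, integrable_add_measure]
  exact ⟨(memLp_two_iff_integrable_sq_norm hμ.1).1 hμ, (memLp_two_iff_integrable_sq_norm hν.1).1 hν⟩

theorem ae_range_weightedArcMeasure (hc : IsUpwardContour c) (σ : ℝ) :
    ∀ᵐ z ∂(weightedArcMeasure σ c), z ∈ range c :=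
  ae_weightedArcMeasure hc σ fun t => ⟨t, rfl⟩

/-- A Cauchy type operator between the weighted spaces of two separated contours, and its
extension by zero to the union of the contours. -/
theorem exists_cauchy_operators {c c' : ℝ → ℂ} {σ σ' : ℝ} (hσ : 0 < σ) (hσ' : 0 < σ')
    (hc : IsUpwardContour c) (hc' : IsUpwardContour c') (hd : Disjoint (range c) (range c'))
    {a b P Q : ℂ → ℂ} (ham : Measurable a) (hbm : Measurable b) (hPm : Measurable P)
    (hQm : Measurable Q) {κ : ℝ} (hκ : 0 < κ) (hκ' : κ ≤ 1 / 2)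
    (hP : ∀ t, κ * (1 + ‖c' t‖) ≤ (P (c' t)).re) (hQ : ∀ t, κ * (1 + ‖Q (c t)‖) ≤ (Q (c t)).re)
    (hQc : ∀ z, ‖Q z‖ ≤ 1 + ‖z‖)
    {D : ℝ} (ha : ∀ t, ‖a (c' t)‖ * σ' ^ (-(c' t).re) ≤ D) (hb : RapidlyDecreasing c b) :
    (∃ T : Lp ℂ 2 (weightedArcMeasure σ c) →L[ℂ] Lp ℂ 2 (weightedArcMeasure σ' c'),
      IsIntegralOperator ![c] (fun z w => a z * b w / (P z + Q w)) T ∧ IsTraceClass T) ∧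
    ∀ (k : ℕ) (Γ : Fin k → ℝ → ℂ) (μ : Measure ℂ) (ρ : ℂ → ℂ), Represents Γ μ ρ →
      μ = weightedArcMeasure σ c + weightedArcMeasure σ' c' →
      ρ =ᵐ[weightedArcMeasure σ c] contourDensity σ c →
      ∃ T : Lp ℂ 2 μ →L[ℂ] Lp ℂ 2 μ,
        IsIntegralOperator Γ (fun z w => (range c').indicator a z * (range c).indicator b w /
          (P z + Q w)) T ∧ IsTraceClass T := by
  set a' := (range c').indicator a with ha'
  set b' := (range c).indicator b with hb'
  have hr := hc.measurableEmbedding.measurableSet_range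
  have hr' := hc'.measurableEmbedding.measurableSet_range
  have ham' : Measurable a' := ham.indicator hr'
  have hbm' : Measurable b' := hbm.indicator hr
  have hrep := represents_weightedArcMeasure hσ hc
  have hae := ae_range_weightedArcMeasure hc σ
  have hae' := ae_range_weightedArcMeasure hc' σ'
  have hP' : ∀ z, a' z ≠ 0 → 0 < (P z).re := fun z hz => by
    obtain ⟨t, rfl⟩ := mem_of_indicator_ne_zero hz
    exact lt_of_lt_of_le (by positivity) (hP t)
  have hQ' : ∀ w, b' w ≠ 0 → κ * (1 + ‖Q w‖) ≤ (Q w).re := fun w hw => by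
    obtain ⟨t, rfl⟩ := mem_of_indicator_ne_zero hw
    exact hQ t
  have hA : MemLp (fun z => a' z / (P z + 1)) 2 (weightedArcMeasure σ' c') := by
    refine hc'.memLp_two hσ' (ham'.div (hPm.add_const 1)).aestronglyMeasurable (D * κ⁻¹) fun t => ?_
    have h1 : κ * (1 + ‖c' t‖) ≤ ‖P (c' t) + 1‖ := by
      refine (hP t).trans (le_trans ?_ (re_le_norm _))
      simp
    have h2 : ‖P (c' t) + 1‖⁻¹ ≤ (κ * (1 + ‖c' t‖))⁻¹ := inv_anti₀ (by positivity) h1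
    rw [ha', indicator_of_mem (mem_range_self t), norm_div, div_eq_mul_inv]
    calc ‖a (c' t)‖ * ‖P (c' t) + 1‖⁻¹ * σ' ^ (-(c' t).re)
        = ‖a (c' t)‖ * σ' ^ (-(c' t).re) * ‖P (c' t) + 1‖⁻¹ := by ring
      _ ≤ D * (κ * (1 + ‖c' t‖))⁻¹ := by
        gcongr
        · exact le_trans (by positivity) (ha t)
        · exact ha t
      _ = _ := by rw [mul_inv, mul_assoc]
  have hBd : RapidlyDecreasing c fun w => b' w * ((1 + ‖Q w‖) ^ 2 : ℝ) := by
    refine hb.of_norm_le (L := 2) (D := 4) zero_le_two (by norm_num) fun t => ?_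
    rw [norm_mul, norm_real, Real.norm_of_nonneg (by positivity), hb',
      indicator_of_mem (mem_range_self t), mul_comm]
    gcongr
    have h1 : 1 + ‖Q (c t)‖ ≤ 2 * (1 + ‖c t‖) := by linarith [hQc (c t), norm_nonneg (c t)]
    have h2 : 1 + ‖c t‖ ≤ Real.exp ‖c t‖ := by linarith [Real.add_one_le_exp ‖c t‖]
    calc (1 + ‖Q (c t)‖) ^ 2 ≤ (2 * Real.exp ‖c t‖) ^ 2 := by gcongr; linarith
      _ = 4 * Real.exp (2 * ‖c t‖) := by
        rw [mul_pow, ← Real.exp_nat_mul]; norm_num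
  have hB : MemLp (fun w => b' w * ((1 + ‖Q w‖) ^ 2 : ℝ) * contourDensity σ c w) 2
      (weightedArcMeasure σ c) := hBd.memLp_mul_contourDensity hc (by fun_prop) hσ
  constructor
  · obtain ⟨T, hT, hTc⟩ := exists_isTraceClass_cauchy hrep ham' hbm' hPm hQm hκ hκ' hP' hQ' hA hB
    refine ⟨T, hT.congr ?_, hTc⟩
    filter_upwards [hae'] with z hz p
    have hp : point ![c] p ∈ range c := ⟨p.2, by simp [point]⟩
    rw [ha', hb', indicator_of_mem hz, indicator_of_mem hp]
  · rintro k Γ μ ρ hρ rfl hρe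
    have hρm := hρ.measurable
    -- On the union, `a'` vanishes on `c` and `b'` on `c'`, so each square integrability condition
    -- reduces to the one already shown on a single contour.
    refine exists_isTraceClass_cauchy hρ ham' hbm' hPm hQm hκ hκ' hP' hQ' ?_ ?_
    · refine memLp_two_add_measure ?_ hA
      refine (MemLp.zero (ε := ℂ)).ae_eq (hae.mono fun z hz => ?_)
      simp [ha', indicator_of_notMem (disjoint_left.1 hd hz)]
    · refine memLp_two_add_measure (hB.ae_eq (hρe.mono fun z hz => ?_)) ?_
      · simp only [hz]
      · refine (MemLp.zero (ε := ℂ)).ae_eq (hae'.mono fun z hz => ?_)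
        simp [hb', indicator_of_notMem (disjoint_right.1 hd hz)]

/-! ### The operators of the hard edge kernels -/

variable {m : Model} {s : ℝ} {γ γ' : ℝ → ℂ}

theorem IsContourPair.disjoint {F : ℂ → ℂ} (h : IsContourPair F γ γ') :
    Disjoint (range γ) (range γ') := by
  rw [disjoint_left]
  rintro _ ⟨t, rfl⟩ ⟨t', ht'⟩
  have h1 := h.re_lt t
  have h2 := h.lt_re t'
  rw [ht'] at h2
  linarith

theorem norm_ofReal_cpow_le (hs : 0 < s) (z : ℂ) :
    ‖(s : ℂ) ^ z‖ ≤ Real.exp (|Real.log s| * ‖z‖) := by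
  rw [norm_cpow_eq_rpow_re_of_pos hs]
  exact rpow_le_exp_norm hs (abs_re_le_norm z)

theorem measurable_ofReal_cpow (hs : 0 < s) : Measurable fun z : ℂ => (s : ℂ) ^ z := by
  have : NeZero (s : ℂ) := ⟨by simpa using hs.ne'⟩
  exact (continuous_const_cpow (s : ℂ)).measurable

/-- The factor `s ^ (-u) F(u) / (2πi)` of the kernel of `A`. -/
def leftFactor (F : ℂ → ℂ) (s : ℝ) (u : ℂ) : ℂ := (2 * Real.pi * I)⁻¹ * ((s : ℂ) ^ (-u) * F u)

/-- The factor `1 / (2πi F(v))` of the kernel of `B`. -/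
def rightFactor (F : ℂ → ℂ) (v : ℂ) : ℂ := (2 * Real.pi * I)⁻¹ * (F v)⁻¹

theorem norm_two_pi_I_inv : ‖(2 * Real.pi * I : ℂ)⁻¹‖ = (2 * Real.pi)⁻¹ := by
  simp [abs_of_pos Real.pi_pos]

theorem measurable_leftFactor (m : Model) (hs : 0 < s) : Measurable (leftFactor m.F s) := by
  have := (measurable_ofReal_cpow hs).comp (measurable_neg (G := ℂ))
  exact (this.mul m.measurable_F).const_mul _

theorem measurable_rightFactor (m : Model) : Measurable (rightFactor m.F) :=
  m.measurable_F.inv.const_mul _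

theorem rapidlyDecreasing_leftFactor (hs : 0 < s) (h : IsContourPair m.F γ γ') :
    RapidlyDecreasing γ (leftFactor m.F s) := by
  have hF : RapidlyDecreasing γ m.F := m.exists_norm_F_le h
  refine hF.of_norm_le (abs_nonneg (Real.log s)) (D := (2 * Real.pi)⁻¹) (by positivity) fun t => ?_
  rw [leftFactor, norm_mul, norm_two_pi_I_inv, norm_mul, mul_assoc]
  gcongr
  simpa using norm_ofReal_cpow_le hs (-γ t)

theorem rapidlyDecreasing_rightFactor (h : IsContourPair m.F γ γ') :
    RapidlyDecreasing γ' (rightFactor m.F) := by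
  have hF : RapidlyDecreasing γ' fun v => (m.F v)⁻¹ := m.exists_norm_inv_F_le h
  refine hF.of_norm_le le_rfl (D := (2 * Real.pi)⁻¹) (by positivity) fun t => ?_
  rw [rightFactor, norm_mul, norm_two_pi_I_inv]
  simp

theorem AKernel_eq (F : ℂ → ℂ) (hs : 0 < s) (z u : ℂ) :
    AKernel F s z u = (s : ℂ) ^ z * leftFactor F s u / (z - u) := by
  have hs0 : (s : ℂ) ≠ 0 := by simpa using hs.ne'
  rw [AKernel, leftFactor, sub_eq_add_neg z u, cpow_add _ _ hs0]
  simp only [div_eq_mul_inv, mul_inv]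
  ring

theorem BKernel_eq (F : ℂ → ℂ) (u v : ℂ) : BKernel F u v = rightFactor F v / (v - u) := by
  rw [BKernel, rightFactor]
  simp only [div_eq_mul_inv, mul_inv]
  ring

/-- The summands are the kernels of `A` and `B` extended by zero, each a product of one-variable
functions over a difference. The minus sign in `gVec` turns `z - w` into `w - z` in the second. -/
theorem MKernel_eq (F : ℂ → ℂ) (s : ℝ) (γ γ' : ℝ → ℂ) (z w : ℂ) :
    MKernel F s γ γ' z w =
      (range γ').indicator (fun z => (s : ℂ) ^ z) z * (range γ).indicator (leftFactor F s) w /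
        (z - w) +
      (range γ).indicator (fun _ => 1) z * (range γ').indicator (rightFactor F) w / (w - z) := by
  have e : w - z = -(z - w) := by ring
  rw [MKernel, fVec, gVec, e, div_neg]
  simp only [dotProduct, Fin.sum_univ_two, Pi.smul_apply, Matrix.cons_val_zero, Matrix.cons_val_one,
    smul_eq_mul]
  by_cases h1 : z ∈ range γ <;> by_cases h2 : z ∈ range γ' <;> by_cases h3 : w ∈ range γ <;>
    by_cases h4 : w ∈ range γ' <;>
    simp only [indicator_of_mem, indicator_of_notMem, h1, h2, h3, h4, not_false_eq_true,
      leftFactor, rightFactor] <;> ring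

theorem AKernel_mul_BKernel (F : ℂ → ℂ) (s : ℝ) (z u v : ℂ) :
    AKernel F s z u * BKernel F u v = (2 * Real.pi * I)⁻¹ * HIntegrand F s v z u := by
  rw [AKernel, BKernel, HIntegrand]
  simp only [div_eq_mul_inv, mul_inv]
  ring

theorem HOpKernel_eq (F : ℂ → ℂ) (s : ℝ) (γ : ℝ → ℂ) (z v : ℂ) :
    HOpKernel F s γ z v = ∫ t, AKernel F s z (γ t) * BKernel F (γ t) v * deriv γ t := by
  rw [HOpKernel, HKernel, contourIntegral_single, ← integral_const_mul]
  simp only [AKernel_mul_BKernel, mul_assoc]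

theorem IsContourPair.exists_le_norm_sub {F : ℂ → ℂ} (h : IsContourPair F γ γ') :
    ∃ κ, 0 < κ ∧ ∀ t t', κ ≤ ‖γ' t' - γ t‖ := by
  obtain ⟨κ, hκ, h1, h2⟩ := h.exists_lower_bound
  refine ⟨κ, hκ, fun t t' => ?_⟩
  refine le_trans ?_ (re_le_norm _)
  rw [sub_re]
  have h3 := h1 t
  have h4 := h2 t'
  nlinarith [norm_nonneg (γ t), norm_nonneg (γ' t')]

theorem measurable_AKernel {α : Type*} [MeasurableSpace α] (m : Model) (hs : 0 < s) {f g : α → ℂ}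
    (hf : Measurable f) (hg : Measurable g) : Measurable fun x => AKernel m.F s (f x) (g x) := by
  simp only [AKernel_eq _ hs]
  exact (((measurable_ofReal_cpow hs).comp hf).mul ((measurable_leftFactor m hs).comp hg)).div
    (hf.sub hg)

theorem measurable_BKernel {α : Type*} [MeasurableSpace α] (m : Model) {f g : α → ℂ}
    (hf : Measurable f) (hg : Measurable g) : Measurable fun x => BKernel m.F (f x) (g x) := by
  simp only [BKernel_eq]
  exact ((measurable_rightFactor m).comp hg).div (hg.sub hf)

/-- Products of the kernels of `A` and `B` are dominated by a function with separated variables. -/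
theorem exists_norm_AKernel_mul_BKernel_le (m : Model) (hs : 0 < s) (h : IsContourPair m.F γ γ') :
    ∃ κ, 0 < κ ∧ (∀ t t', ‖AKernel m.F s (γ' t') (γ t)‖ ≤
        κ * (s ^ (γ' t').re * ‖leftFactor m.F s (γ t)‖)) ∧
      ∀ t t', ‖BKernel m.F (γ t) (γ' t')‖ ≤ κ * ‖rightFactor m.F (γ' t')‖ := by
  obtain ⟨κ, hκ, hle⟩ := h.exists_le_norm_sub
  refine ⟨κ⁻¹, inv_pos.2 hκ, fun t t' => ?_, fun t t' => ?_⟩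
  · rw [AKernel_eq _ hs, norm_div, norm_mul, norm_cpow_eq_rpow_re_of_pos hs, div_eq_inv_mul]
    gcongr
    exact hle t t'
  · rw [BKernel_eq, norm_div, div_eq_inv_mul]
    gcongr
    exact hle t t'

/-- The contours being a positive distance apart, the Cauchy factors are bounded and the integrand
is dominated by a product of integrable functions. This justifies Fubini for the composition of `A`
and `B`. -/
theorem integrable_AKernel_mul_BKernel (m : Model) (hs : 0 < s) (h : IsContourPair m.F γ γ')
    (t' : ℝ) {ψ : ℝ → ℂ} (hψ : Measurable ψ)
    (hψi : Integrable fun τ => rightFactor m.F (γ' τ) * ψ τ * deriv γ' τ) :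
    Integrable (fun p : ℝ × ℝ => AKernel m.F s (γ' t') (γ p.1) * deriv γ p.1 *
      (BKernel m.F (γ p.1) (γ' p.2) * ψ p.2 * deriv γ' p.2)) (volume.prod volume) := by
  obtain ⟨κ, hκ, hA, hB⟩ := exists_norm_AKernel_mul_BKernel_le m hs h
  have hα := (rapidlyDecreasing_leftFactor hs h).integrable h.contour_left
    (measurable_leftFactor m hs)
  have h1 := h.contour_left.continuous.measurable
  have h2 := h.contour_right.continuous.measurable
  refine Integrable.mono' ((hα.norm.mul_prod hψi.norm).const_mul (κ * s ^ (γ' t').re * κ)) ?_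
    (Eventually.of_forall fun p => ?_)
  · have e1 : Measurable fun p : ℝ × ℝ => AKernel m.F s (γ' t') (γ p.1) :=
      measurable_AKernel m hs measurable_const (h1.comp measurable_fst)
    have e2 : Measurable fun p : ℝ × ℝ => BKernel m.F (γ p.1) (γ' p.2) :=
      measurable_BKernel m (h1.comp measurable_fst) (h2.comp measurable_snd)
    have e3 := measurable_deriv γ
    have e4 := measurable_deriv γ'
    exact (by fun_prop : Measurable _).aestronglyMeasurable
  · simp only [norm_mul]
    calc ‖AKernel m.F s (γ' t') (γ p.1)‖ * ‖deriv γ p.1‖ *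
          (‖BKernel m.F (γ p.1) (γ' p.2)‖ * ‖ψ p.2‖ * ‖deriv γ' p.2‖)
        ≤ (κ * (s ^ (γ' t').re * ‖leftFactor m.F s (γ p.1)‖)) * ‖deriv γ p.1‖ *
          ((κ * ‖rightFactor m.F (γ' p.2)‖) * ‖ψ p.2‖ * ‖deriv γ' p.2‖) := by
          gcongr
          · exact hA _ _
          · exact hB _ _
      _ = _ := by ring

theorem contourIntegrable_HIntegrand (m : Model) (hs : 0 < s) (h : IsContourPair m.F γ γ')
    (τ t' : ℝ) : ContourIntegrable ![γ] (HIntegrand m.F s (γ' τ) (γ' t')) := by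
  obtain ⟨κ, hκ, hA, hB⟩ := exists_norm_AKernel_mul_BKernel_le m hs h
  have hα := (rapidlyDecreasing_leftFactor hs h).integrable h.contour_left
    (measurable_leftFactor m hs)
  have h1 := h.contour_left.continuous.measurable
  rw [contourIntegrable_single]
  have hInt : Integrable fun t => AKernel m.F s (γ' t') (γ t) * BKernel m.F (γ t) (γ' τ) *
      deriv γ t := by
    refine Integrable.mono' (hα.norm.const_mul
      (κ * s ^ (γ' t').re * (κ * ‖rightFactor m.F (γ' τ)‖))) ?_ (Eventually.of_forall fun t => ?_)
    · have e1 : Measurable fun t : ℝ => AKernel m.F s (γ' t') (γ t) :=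
        measurable_AKernel m hs measurable_const h1
      have e2 : Measurable fun t : ℝ => BKernel m.F (γ t) (γ' τ) :=
        measurable_BKernel m h1 measurable_const
      have e3 := measurable_deriv γ
      exact (by fun_prop : Measurable _).aestronglyMeasurable
    · simp only [norm_mul]
      calc ‖AKernel m.F s (γ' t') (γ t)‖ * ‖BKernel m.F (γ t) (γ' τ)‖ * ‖deriv γ t‖
          ≤ (κ * (s ^ (γ' t').re * ‖leftFactor m.F s (γ t)‖)) *
            (κ * ‖rightFactor m.F (γ' τ)‖) * ‖deriv γ t‖ := by
            gcongr
            · exact hA _ _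
            · exact hB _ _
        _ = _ := by ring
  refine (hInt.const_mul (2 * Real.pi * I)).congr (Eventually.of_forall fun t => ?_)
  have hne : (2 * Real.pi * I : ℂ) ≠ 0 := by simp [Real.pi_ne_zero]
  simp only [AKernel_mul_BKernel]
  field_simp

end

section

variable {m : Model} {s : ℝ} {γ γ' : ℝ → ℂ}

theorem Represents.contourIntegral_congr {k : ℕ} {Γ : Fin k → ℝ → ℂ} {μ : Measure ℂ} {ρ : ℂ → ℂ}
    (hρ : Represents Γ μ ρ) {f g : ℂ → ℂ} (hf : ContourIntegrable Γ f) (hfg : f =ᵐ[μ] g) :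
    ContourIntegrable Γ g ∧ contourIntegral Γ f = contourIntegral Γ g := by
  have he : (fun w => f w * ρ w) =ᵐ[μ] fun w => g w * ρ w := hfg.mono fun w hw => by simp only [hw]
  have hg : ContourIntegrable Γ g :=
    (hρ.integrable_iff g).2 (((hρ.integrable_iff f).1 hf).congr he)
  exact ⟨hg, by rw [hρ.integral_eq _ hf, hρ.integral_eq _ hg, integral_congr_ae he]⟩

theorem represents_arcMeasure {c : ℝ → ℂ} (hc : IsUpwardContour c) :
    Represents ![c] (arcMeasure c) (contourDensity 1 c) := by
  have := represents_weightedArcMeasure one_pos hc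
  rwa [weightedArcMeasure_one] at this

/-- By Fubini the kernel of the composition is the integral over `u` of the product of the kernels,
which is the integral defining `H`. -/
theorem isIntegralOperator_comp (m : Model) (hs : 0 < s) (h : IsContourPair m.F γ γ') {σ : ℝ}
    (hσ : 0 < σ) {A : Lp ℂ 2 (arcMeasure γ) →L[ℂ] Lp ℂ 2 (weightedArcMeasure σ γ')}
    {B : Lp ℂ 2 (weightedArcMeasure σ γ') →L[ℂ] Lp ℂ 2 (arcMeasure γ)}
    (hA : IsIntegralOperator ![γ] (AKernel m.F s) A)
    (hB : IsIntegralOperator ![γ'] (BKernel m.F) B) :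
    IsIntegralOperator ![γ'] (HOpKernel m.F s γ) (A ∘L B) := by
  intro φ
  have hφm : Measurable fun τ => φ (γ' τ) :=
    (Lp.stronglyMeasurable φ).measurable.comp h.contour_right.continuous.measurable
  have hrep := represents_weightedArcMeasure hσ h.contour_right
  have hφi : Integrable fun τ => rightFactor m.F (γ' τ) * φ (γ' τ) * deriv γ' τ := by
    rw [← contourIntegrable_single (f := fun v => rightFactor m.F v * φ v), hrep.integrable_iff]
    have h1 := (rapidlyDecreasing_rightFactor h).memLp_mul_contourDensity h.contour_right
      (measurable_rightFactor m) hσ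
    refine (h1.integrable_mul (Lp.memLp φ)).congr (Eventually.of_forall fun w => ?_)
    simp only [Pi.mul_apply]
    ring
  filter_upwards [hA (B φ), ae_range_weightedArcMeasure h.contour_right σ] with z hz hzr
  obtain ⟨t', rfl⟩ := hzr
  have hInt := integrable_AKernel_mul_BKernel m hs h t' hφm hφi
  -- The integral formula for `B φ` holds only a.e. for arc length on `γ`, which is enough under the
  -- outer contour integral.
  have he : (fun u => AKernel m.F s (γ' t') u * B φ u) =ᵐ[arcMeasure γ]
      fun u => AKernel m.F s (γ' t') u * contourIntegral ![γ'] fun v => BKernel m.F u v * φ v := by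
    filter_upwards [hB φ] with u hu
    rw [hu.2]
  obtain ⟨_, h2⟩ := (represents_arcMeasure h.contour_left).contourIntegral_congr hz.1 he
  have hH : ∀ τ, HOpKernel m.F s γ (γ' t') (γ' τ) * φ (γ' τ) * deriv γ' τ =
      ∫ t, AKernel m.F s (γ' t') (γ t) * deriv γ t *
        (BKernel m.F (γ t) (γ' τ) * φ (γ' τ) * deriv γ' τ) := fun τ => by
    rw [HOpKernel_eq, mul_assoc, ← integral_mul_const]
    refine integral_congr_ae (Eventually.of_forall fun t => ?_)
    simp only
    ring
  constructor
  · rw [contourIntegrable_single]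
    simp only [hH]
    exact hInt.integral_prod_right
  · rw [ContinuousLinearMap.comp_apply, hz.2, h2, contourIntegral_single, contourIntegral_single]
    simp only [hH]
    rw [← integral_integral_swap hInt]
    refine integral_congr_ae (Eventually.of_forall fun t => ?_)
    simp only [contourIntegral_single]
    rw [integral_const_mul]
    ring

theorem exists_isTraceClass_operators (m : Model) (hs : 0 < s) (h : IsContourPair m.F γ γ')
    {σ : ℝ} (hσ : s ≤ σ) :
    ∃ (A : Lp ℂ 2 (arcMeasure γ) →L[ℂ] Lp ℂ 2 (weightedArcMeasure σ γ'))
      (B : Lp ℂ 2 (weightedArcMeasure σ γ') →L[ℂ] Lp ℂ 2 (arcMeasure γ))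
      (M : Lp ℂ 2 (arcMeasure γ + weightedArcMeasure σ γ') →L[ℂ]
        Lp ℂ 2 (arcMeasure γ + weightedArcMeasure σ γ')),
      IsIntegralOperator ![γ] (AKernel m.F s) A ∧ IsIntegralOperator ![γ'] (BKernel m.F) B ∧
      IsIntegralOperator ![γ, γ'] (MKernel m.F s γ γ') M ∧
      IsTraceClass A ∧ IsTraceClass B ∧ IsTraceClass M := by
  have hσ0 : 0 < σ := hs.trans_le hσ
  obtain ⟨κ, hκ, hL, hR⟩ := h.exists_lower_bound
  -- Half of `κ`, since `1 + ‖z - 1/2‖ ≤ 2 (1 + ‖z‖)`; at most `1/2`, as the Cayley estimate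
  -- demands.
  set κ' : ℝ := min (κ / 2) (1 / 2) with hκ'
  have hκ'0 : 0 < κ' := lt_min (by positivity) (by norm_num)
  have hκ'1 : κ' ≤ 1 / 2 := min_le_right _ _
  have hκ'2 : κ' ≤ κ / 2 := min_le_left _ _
  have hhalf : ‖(1 / 2 : ℂ)‖ = 1 / 2 := by norm_num
  have hQ1 : ∀ z : ℂ, ‖1 / 2 - z‖ ≤ 1 / 2 + ‖z‖ := fun z => by
    have := norm_sub_le (1 / 2 : ℂ) z
    rwa [hhalf] at this
  have hQ2 : ∀ z : ℂ, ‖z - 1 / 2‖ ≤ 1 / 2 + ‖z‖ := fun z => by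
    rw [norm_sub_rev]; exact hQ1 z
  have hre1 : ∀ z : ℂ, (1 / 2 - z).re = 1 / 2 - z.re := fun z => by norm_num
  have hre2 : ∀ z : ℂ, (z - 1 / 2).re = z.re - 1 / 2 := fun z => by norm_num
  have hκle : ∀ x y : ℝ, 0 ≤ x → y ≤ 1 / 2 + x → κ' * (1 + y) ≤ κ * (1 + x) := fun x y hx hy => by
    calc κ' * (1 + y) ≤ κ' * (2 * (1 + x)) := by gcongr; linarith
      _ ≤ (κ / 2) * (2 * (1 + x)) := by gcongr
      _ = _ := by ring
  -- The weight is there to compensate the growth of `s ^ z` on `γ'`. As `Re z > 0` there, `s ≤ σ`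
  -- suffices.
  have hsσ : ∀ t, ‖(s : ℂ) ^ γ' t‖ * σ ^ (-(γ' t).re) ≤ 1 := fun t => by
    have hre : 0 ≤ (γ' t).re := by linarith [h.lt_re t]
    rw [norm_cpow_eq_rpow_re_of_pos hs, Real.rpow_neg hσ0.le, ← div_eq_mul_inv]
    exact div_le_one_of_le₀ (Real.rpow_le_rpow hs.le hσ hre) (by positivity)
  have hcA := exists_cauchy_operators (σ := 1) (σ' := σ) one_pos hσ0 h.contour_left h.contour_right
    h.disjoint (a := fun z => (s : ℂ) ^ z) (b := leftFactor m.F s) (P := fun z => z - 1 / 2)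
    (Q := fun w => 1 / 2 - w) (measurable_ofReal_cpow hs) (measurable_leftFactor m hs)
    (by fun_prop) (by fun_prop) hκ'0 hκ'1
    (fun t => by
      rw [hre2]
      exact (hκle _ _ (norm_nonneg _) (by linarith)).trans (hR t))
    (fun t => by
      rw [hre1]
      exact (hκle _ _ (norm_nonneg _) (hQ1 _)).trans (hL t))
    (fun z => (hQ1 z).trans (by linarith)) hsσ (rapidlyDecreasing_leftFactor hs h)
  have hcB := exists_cauchy_operators (σ := σ) (σ' := 1) hσ0 one_pos h.contour_right h.contour_left
    h.disjoint.symm (a := fun _ => 1) (b := rightFactor m.F) (P := fun z => 1 / 2 - z)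
    (Q := fun w => w - 1 / 2) measurable_const (measurable_rightFactor m)
    (by fun_prop) (by fun_prop) hκ'0 hκ'1 (D := 1)
    (fun t => by
      rw [hre1]
      exact (hκle _ _ (norm_nonneg _) (by linarith)).trans (hL t))
    (fun t => by
      rw [hre2]
      exact (hκle _ _ (norm_nonneg _) (hQ2 _)).trans (hR t))
    (fun z => (hQ2 z).trans (by linarith)) (fun t => by simp) (rapidlyDecreasing_rightFactor h)
  rw [weightedArcMeasure_one] at hcA hcB
  obtain ⟨⟨A, hA, hAt⟩, hMA⟩ := hcA
  obtain ⟨⟨B, hB, hBt⟩, hMB⟩ := hcB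
  have haeL := ae_range_weightedArcMeasure h.contour_left 1
  have haeR := ae_range_weightedArcMeasure h.contour_right σ
  rw [weightedArcMeasure_one] at haeL
  have hrep := (represents_arcMeasure h.contour_left).pair
    (represents_weightedArcMeasure hσ0 h.contour_right)
    h.contour_left.measurableEmbedding.measurableSet_range
    h.contour_right.measurableEmbedding.measurableSet_range h.disjoint haeL haeR
  obtain ⟨M₁, hM₁, hM₁t⟩ := hMA _ _ _ _ hrep rfl (haeL.mono fun z hz => by
    simp only [indicator_of_mem hz, indicator_of_notMem (disjoint_left.1 h.disjoint hz), add_zero])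
  obtain ⟨M₂, hM₂, hM₂t⟩ := hMB _ _ _ _ hrep (add_comm _ _) (haeR.mono fun z hz => by
    simp only [indicator_of_mem hz, indicator_of_notMem (disjoint_right.1 h.disjoint hz), zero_add])
  refine ⟨A, B, M₁ + M₂, hA.congr (Eventually.of_forall fun z p => ?_),
    hB.congr (Eventually.of_forall fun z p => ?_),
    (hM₁.add hM₂).congr (Eventually.of_forall fun z p => ?_), hAt, hBt, hM₁t.add hM₂t⟩
  · rw [AKernel_eq _ hs]
    ring_nf
  · rw [BKernel_eq]
    ring_nf
  · rw [MKernel_eq]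
    ring_nf

/-- On functions on the union of the contours, `M` acts as the block operator with entries
`A` and `B`. -/
theorem isIntegralOperator_MKernel_apply (m : Model) (hs : 0 < s) (h : IsContourPair m.F γ γ')
    {σ : ℝ} (hσ : 0 < σ) {A : Lp ℂ 2 (arcMeasure γ) →L[ℂ] Lp ℂ 2 (weightedArcMeasure σ γ')}
    {B : Lp ℂ 2 (weightedArcMeasure σ γ') →L[ℂ] Lp ℂ 2 (arcMeasure γ)}
    {M : Lp ℂ 2 (arcMeasure γ + weightedArcMeasure σ γ') →L[ℂ]
        Lp ℂ 2 (arcMeasure γ + weightedArcMeasure σ γ')}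
    (hA : IsIntegralOperator ![γ] (AKernel m.F s) A)
    (hB : IsIntegralOperator ![γ'] (BKernel m.F) B)
    (hM : IsIntegralOperator ![γ, γ'] (MKernel m.F s γ γ') M)
    (φ : Lp ℂ 2 (arcMeasure γ + weightedArcMeasure σ γ')) (φ₁ : Lp ℂ 2 (arcMeasure γ))
    (φ₂ : Lp ℂ 2 (weightedArcMeasure σ γ')) (h₁ : φ =ᵐ[arcMeasure γ] φ₁)
    (h₂ : φ =ᵐ[weightedArcMeasure σ γ'] φ₂) :
    M φ =ᵐ[weightedArcMeasure σ γ'] A φ₁ ∧ M φ =ᵐ[arcMeasure γ] B φ₂ := by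
  have haeL := ae_range_weightedArcMeasure h.contour_left 1
  have haeR := ae_range_weightedArcMeasure h.contour_right σ
  rw [weightedArcMeasure_one] at haeL
  have hM' := ae_add_measure_iff.1 (hM φ)
  have hnL : ∀ t, γ t ∉ range γ' := fun t => disjoint_left.1 h.disjoint ⟨t, rfl⟩
  have hnR : ∀ t, γ' t ∉ range γ := fun t => disjoint_right.1 h.disjoint ⟨t, rfl⟩
  constructor
  · filter_upwards [hM'.2, hA φ₁, haeR] with z h3 h4 hz
    obtain ⟨t', rfl⟩ := hz
    rw [h3.2, h4.2, contourIntegral_pair h3.1]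
    have e1 : ∀ t, MKernel m.F s γ γ' (γ' t') (γ' t) = 0 := fun t => by
      simp [MKernel_eq, indicator_of_notMem (hnR _)]
    have e2 : ∀ t, MKernel m.F s γ γ' (γ' t') (γ t) = AKernel m.F s (γ' t') (γ t) := fun t => by
      simp [MKernel_eq, indicator_of_notMem (hnR _), AKernel_eq _ hs]
    have e3 : contourIntegral ![γ'] (fun w => MKernel m.F s γ γ' (γ' t') w * φ w) = 0 := by
      rw [contourIntegral_single]
      simp [e1]
    have e4 : contourIntegral ![γ] (fun w => MKernel m.F s γ γ' (γ' t') w * φ w) =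
        contourIntegral ![γ] (fun w => AKernel m.F s (γ' t') w * φ w) := by
      rw [contourIntegral_single, contourIntegral_single]
      simp only [e2]
    rw [e3, e4, add_zero]
    exact ((represents_arcMeasure h.contour_left).contourIntegral_congr h4.1
      (h₁.mono fun w hw => by simp only [hw])).2.symm
  · filter_upwards [hM'.1, hB φ₂, haeL] with z h3 h4 hz
    obtain ⟨t', rfl⟩ := hz
    rw [h3.2, h4.2, contourIntegral_pair h3.1]
    have e1 : ∀ t, MKernel m.F s γ γ' (γ t') (γ t) = 0 := fun t => by
      simp [MKernel_eq, indicator_of_notMem (hnL _)]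
    have e2 : ∀ t, MKernel m.F s γ γ' (γ t') (γ' t) = BKernel m.F (γ t') (γ' t) := fun t => by
      simp [MKernel_eq, indicator_of_notMem (hnL _), BKernel_eq]
    have e3 : contourIntegral ![γ] (fun w => MKernel m.F s γ γ' (γ t') w * φ w) = 0 := by
      rw [contourIntegral_single]
      simp [e1]
    have e4 : contourIntegral ![γ'] (fun w => MKernel m.F s γ γ' (γ t') w * φ w) =
        contourIntegral ![γ'] (fun w => BKernel m.F (γ t') w * φ w) := by
      rw [contourIntegral_single, contourIntegral_single]
      simp only [e2]
    rw [e3, e4, zero_add]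
    exact ((represents_weightedArcMeasure hσ h.contour_right).contourIntegral_congr h4.1
      (h₂.mono fun w hw => by simp only [hw])).2.symm

end

/-! ### Hadamard's inequality and convergence of Fredholm series -/

theorem prod_le_sum_div_card_pow {ι : Type*} [Fintype ι] (x : ι → ℝ) (hx : ∀ i, 0 ≤ x i) :
    ∏ i, x i ≤ ((∑ i, x i) / Fintype.card ι) ^ Fintype.card ι := by
  rcases isEmpty_or_nonempty ι with h | h
  · simp
  have hn : (Fintype.card ι : ℝ) ≠ 0 := by simp
  have h1 := Real.geom_mean_le_arith_mean_weighted Finset.univ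
    (fun _ : ι => (Fintype.card ι : ℝ)⁻¹) x (fun _ _ => by positivity) (by simp)
    (fun i _ => hx i)
  have h2 := pow_le_pow_left₀ (Finset.prod_nonneg fun i _ => Real.rpow_nonneg (hx i) _) h1
    (Fintype.card ι)
  rw [← Finset.prod_pow] at h2
  refine le_trans (le_of_eq ?_) (h2.trans (le_of_eq ?_))
  · refine Finset.prod_congr rfl fun i _ => ?_
    rw [← Real.rpow_natCast, ← Real.rpow_mul (hx i), inv_mul_cancel₀ hn, Real.rpow_one]
  · rw [← Finset.mul_sum, div_eq_inv_mul]

-- Hadamard's inequality: `|det A|²` is the product of the eigenvalues of `Aᴴ A`, which are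
-- nonnegative with sum the trace, at most `n²`. The inequality of arithmetic and geometric means
-- finishes.
open scoped ComplexOrder in
theorem norm_det_sq_le_of_norm_le_one {n : ℕ} (A : Matrix (Fin n) (Fin n) ℂ)
    (hA : ∀ i j, ‖A i j‖ ≤ 1) : ‖A.det‖ ^ 2 ≤ (n : ℝ) ^ n := by
  have hG : (A.conjTranspose * A).PosSemidef := Matrix.posSemidef_conjTranspose_mul_self A
  have hdet : ‖A.det‖ ^ 2 = ∏ i, hG.1.eigenvalues i := by
    have h1 := hG.1.det_eq_prod_eigenvalues
    rw [Matrix.det_mul, Matrix.det_conjTranspose] at h1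
    have h2 : star A.det * A.det = ((‖A.det‖ ^ 2 : ℝ) : ℂ) := by
      rw [← normSq_eq_norm_sq, normSq_eq_conj_mul_self]
      rfl
    rw [h2] at h1
    exact ofReal_injective (h1.trans (ofReal_prod _ _).symm)
  have htr : ∑ i, hG.1.eigenvalues i ≤ (n : ℝ) * n := by
    have h1 := hG.1.trace_eq_sum_eigenvalues
    have h2 : (A.conjTranspose * A).trace = ((∑ i, ∑ j, ‖A j i‖ ^ 2 : ℝ) : ℂ) := by
      rw [Matrix.trace]
      push_cast
      refine Finset.sum_congr rfl fun i _ => ?_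
      rw [Matrix.diag_apply, Matrix.mul_apply]
      refine Finset.sum_congr rfl fun j _ => ?_
      rw [Matrix.conjTranspose_apply, ← ofReal_pow, ← normSq_eq_norm_sq, normSq_eq_conj_mul_self]
      rfl
    rw [h2] at h1
    have h3 : ∑ i, hG.1.eigenvalues i = ∑ i, ∑ j, ‖A j i‖ ^ 2 := 
      (ofReal_injective (h1.trans (ofReal_sum _ _).symm)).symm
    rw [h3]
    calc ∑ i : Fin n, ∑ j : Fin n, ‖A j i‖ ^ 2 ≤ ∑ _i : Fin n, ∑ _j : Fin n, (1 : ℝ) := by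
          gcongr with i _ j _
          exact pow_le_one₀ (norm_nonneg _) (hA j i)
      _ = _ := by simp
  rw [hdet]
  refine (prod_le_sum_div_card_pow _ fun i => hG.eigenvalues_nonneg i).trans ?_
  rw [Fintype.card_fin]
  rcases Nat.eq_zero_or_pos n with rfl | hn
  · simp
  have : (0 : ℝ) < n := by exact_mod_cast hn
  refine pow_le_pow_left₀ (div_nonneg (Finset.sum_nonneg fun i _ => hG.eigenvalues_nonneg i)
    this.le) ?_ n
  rw [div_le_iff₀ this]
  exact htr

theorem norm_det_le_of_norm_le_mul {n : ℕ} (A : Matrix (Fin n) (Fin n) ℂ) {α β : Fin n → ℝ}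
    (hα : ∀ i, 0 ≤ α i) (hβ : ∀ i, 0 ≤ β i) (hA : ∀ i j, ‖A i j‖ ≤ α i * β j) :
    ‖A.det‖ ≤ √((n : ℝ) ^ n) * ∏ i, (α i * β i) := by
  set A' : Matrix (Fin n) (Fin n) ℂ := Matrix.of fun i j => A i j / ((α i : ℂ) * β j) with hA'
  have h1 : ∀ i j, ‖A' i j‖ ≤ 1 := fun i j => by
    rw [hA', Matrix.of_apply, norm_div, norm_mul, norm_real, norm_real,
      Real.norm_of_nonneg (hα i), Real.norm_of_nonneg (hβ j)]
    exact div_le_one_of_le₀ (hA i j) (mul_nonneg (hα i) (hβ j))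
  have h2 : A = Matrix.of fun i j => (α i : ℂ) * (Matrix.of fun i j => (β j : ℂ) * A' i j) i j := by
    ext i j
    simp only [hA', Matrix.of_apply]
    -- Where the scaling factor vanishes, the bound forces the entry of `A` to vanish as well, so
    -- division by zero does no harm.
    by_cases h : (α i : ℂ) * β j = 0
    · have h3 : α i * β j = 0 := by exact_mod_cast h
      have h4 : A i j = 0 := norm_le_zero_iff.1 ((hA i j).trans_eq h3)
      simp [h4]
    · rw [← mul_assoc, mul_div_cancel₀ _ h]
  rw [h2, Matrix.det_mul_column, Matrix.det_mul_row, norm_mul, norm_mul, norm_prod, norm_prod,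
    Finset.prod_mul_distrib]
  simp only [norm_real, Real.norm_of_nonneg (hα _), Real.norm_of_nonneg (hβ _)]
  have h3 : ‖A'.det‖ ≤ √((n : ℝ) ^ n) := Real.le_sqrt_of_sq_le (norm_det_sq_le_of_norm_le_one A' h1)
  have h4 : 0 ≤ ∏ i, α i := Finset.prod_nonneg fun i _ => hα i
  have h5 : 0 ≤ ∏ i, β i := Finset.prod_nonneg fun i _ => hβ i
  calc (∏ i, α i) * ((∏ i, β i) * ‖A'.det‖)
      ≤ (∏ i, α i) * ((∏ i, β i) * √((n : ℝ) ^ n)) := by gcongr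
    _ = _ := by ring

/-- From `n ^ n ≤ eⁿ n!`, the square of the term is at most `(W² e)ⁿ / n!`. Split this as `(4 W² e)ⁿ
/ n!` times `4⁻ⁿ`; a number whose square is at most `a b` is at most `a + b`, and both factors are
summable. -/
theorem summable_sqrt_pow_mul_pow_div_factorial {W : ℝ} (hW : 0 ≤ W) :
    Summable fun n : ℕ => √((n : ℝ) ^ n) * W ^ n / n.factorial := by
  have h1 : ∀ n : ℕ, √((n : ℝ) ^ n) * W ^ n / n.factorial ≤
      (4 * W ^ 2 * Real.exp 1) ^ n / n.factorial + (1 / 4) ^ n := fun n => by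
    have hf : (0 : ℝ) < n.factorial := by exact_mod_cast n.factorial_pos
    have h2 : (n : ℝ) ^ n ≤ Real.exp 1 ^ n * n.factorial := by
      have := Real.pow_div_factorial_le_exp (n : ℝ) n.cast_nonneg n
      rw [div_le_iff₀ hf, ← mul_one (n : ℝ), Real.exp_nat_mul, mul_one] at this
      exact this
    set x : ℝ := √((n : ℝ) ^ n) * W ^ n / n.factorial with hx
    have hx2 : x ^ 2 ≤ (4 * W ^ 2 * Real.exp 1) ^ n / n.factorial * (1 / 4) ^ n := by
      have e1 : x ^ 2 = (n : ℝ) ^ n * (W ^ 2) ^ n / (n.factorial : ℝ) ^ 2 := by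
        rw [hx, div_pow, mul_pow, Real.sq_sqrt (by positivity), ← pow_mul, ← pow_mul, mul_comm n 2]
      have e2 : (4 * W ^ 2 * Real.exp 1) ^ n / n.factorial * (1 / 4) ^ n =
          (Real.exp 1 ^ n * n.factorial) * (W ^ 2) ^ n / (n.factorial : ℝ) ^ 2 := by
        have : (4 : ℝ) ^ n * (1 / 4) ^ n = 1 := by rw [← mul_pow]; norm_num
        rw [mul_pow, mul_pow]
        field_simp
        linear_combination W ^ (2 * n) * this
      rw [e1, e2]
      gcongr
    have ha : 0 ≤ (4 * W ^ 2 * Real.exp 1) ^ n / n.factorial := by positivity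
    have hb : (0 : ℝ) ≤ (1 / 4) ^ n := by positivity
    refine le_of_sq_le_sq ?_ (by positivity)
    nlinarith
  refine Summable.of_nonneg_of_le (fun n => by positivity) h1
    ((Real.summable_pow_div_factorial _).add
      (summable_geometric_of_lt_one (by norm_num) (by norm_num)))

instance sigmaFinite_paramMeasure (k : ℕ) : SigmaFinite (paramMeasure k) := by
  unfold paramMeasure
  infer_instance

theorem measurable_lineElement {k : ℕ} (Γ : Fin k → ℝ → ℂ) : Measurable (lineElement Γ) :=
  measurable_from_prod_countable_right fun i => measurable_deriv (Γ i)

theorem measurable_fredholmMinor {k : ℕ} {Γ : Fin k → ℝ → ℂ} {K : ℂ → ℂ → ℂ}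
    (hK : Measurable fun q : (Fin k × ℝ) × (Fin k × ℝ) => K (point Γ q.1) (point Γ q.2)) (n : ℕ) :
    Measurable (fredholmMinor Γ K n) := by
  have hl := measurable_lineElement Γ
  unfold fredholmMinor
  simp only [Matrix.det_apply, Matrix.of_apply]
  refine Measurable.mul (Finset.measurable_fun_sum _ fun σ _ => Measurable.const_smul
    (Finset.measurable_fun_prod _ fun i _ => ?_) _)
    (Finset.measurable_fun_prod _ fun i _ => by fun_prop)
  exact hK.comp (by fun_prop : Measurable fun p : Fin n → Fin k × ℝ => (p (σ i), p i))

theorem fredholmConvergent_of_le {k : ℕ} {Γ : Fin k → ℝ → ℂ} {K : ℂ → ℂ → ℂ}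
    (hK : Measurable fun q : (Fin k × ℝ) × (Fin k × ℝ) => K (point Γ q.1) (point Γ q.2))
    {α β : Fin k × ℝ → ℝ} (hα : ∀ p, 0 ≤ α p) (hβ : ∀ p, 0 ≤ β p)
    (hle : ∀ p q, ‖K (point Γ p) (point Γ q)‖ ≤ α p * β q)
    (hInt : Integrable (fun p => α p * β p * ‖lineElement Γ p‖) (paramMeasure k)) :
    FredholmConvergent Γ K := by
  set w : Fin k × ℝ → ℝ := fun p => α p * β p * ‖lineElement Γ p‖ with hw
  have hbound : ∀ n (p : Fin n → Fin k × ℝ),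
      ‖fredholmMinor Γ K n p‖ ≤ √((n : ℝ) ^ n) * ∏ i, w (p i) := fun n p => by
    rw [fredholmMinor, norm_mul, norm_prod]
    have h := norm_det_le_of_norm_le_mul
      (Matrix.of fun i j => K (point Γ (p i)) (point Γ (p j))) (fun i => hα (p i))
      (fun i => hβ (p i)) fun i j => hle _ _
    calc _ ≤ (√((n : ℝ) ^ n) * ∏ i, (α (p i) * β (p i))) * ∏ i, ‖lineElement Γ (p i)‖ := by gcongr
      _ = _ := by rw [mul_assoc, ← Finset.prod_mul_distrib]
  have hwi : ∀ n : ℕ, Integrable (fun p : Fin n → Fin k × ℝ => √((n : ℝ) ^ n) * ∏ i, w (p i))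
      (Measure.pi fun _ => paramMeasure k) := fun n =>
    (Integrable.fintype_prod (f := fun _ : Fin n => w) fun _ => hInt).const_mul _
  refine ⟨fun n => (hwi n).mono' (measurable_fredholmMinor hK n).aestronglyMeasurable
    (Eventually.of_forall (hbound n)), ?_⟩
  have hw0 : ∀ p, 0 ≤ w p := fun p => mul_nonneg (mul_nonneg (hα p) (hβ p)) (norm_nonneg _)
  refine Summable.of_nonneg_of_le (fun n => norm_nonneg _) (fun n => ?_)
    (summable_sqrt_pow_mul_pow_div_factorial (W := ∫ p, w p ∂(paramMeasure k))
      (integral_nonneg hw0))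
  rw [fredholmTerm, norm_mul, norm_div, norm_pow, norm_neg, norm_one, one_pow, norm_natCast,
    one_div_mul_eq_div]
  gcongr
  refine (norm_integral_le_of_norm_le (hwi n) (Eventually.of_forall (hbound n))).trans_eq ?_
  rw [integral_const_mul, integral_fintype_prod_eq_pow]
  simp

section

/-! ### Integrals over products of the parameter space -/

/-- The points with parameters `t` on the curves with indices `ε`. -/
def labelled {k n : ℕ} (ε : Fin n → Fin k) (t : Fin n → ℝ) : Fin n → Fin k × ℝ :=
  fun i => (ε i, t i)

theorem measurableEmbedding_labelled {k n : ℕ} (ε : Fin n → Fin k) :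
    MeasurableEmbedding (labelled ε) := by
  refine Measurable.measurableEmbedding ?_ fun t t' h => ?_
  · unfold labelled
    fun_prop
  · funext i
    exact congrArg Prod.snd (congrFun h i)

/-- Tuples of points are sorted by the curves on which their entries lie. -/
theorem pi_paramMeasure_eq_sum (k n : ℕ) :
    (Measure.pi fun _ : Fin n => paramMeasure k) =
      ∑ ε : Fin n → Fin k, (volume : Measure (Fin n → ℝ)).map (labelled ε) := by
  refine Measure.pi_eq fun s hs => ?_
  rw [Measure.finsetSum_apply]
  have h1 : ∀ ε : Fin n → Fin k, (volume : Measure (Fin n → ℝ)).map (labelled ε) (univ.pi s) =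
      ∏ i, volume (Prod.mk (ε i) ⁻¹' s i : Set ℝ) := fun ε => by
    rw [(measurableEmbedding_labelled ε).map_apply, ← volume_pi_pi]
    congr 1
  have h2 : ∀ i, paramMeasure k (s i) = ∑ j, volume (Prod.mk j ⁻¹' s i : Set ℝ) := fun i => by
    rw [paramMeasure_eq_sum, Measure.sum_fintype, Measure.finsetSum_apply]
    simp only [(measurableEmbedding_prodMk _).map_apply]
  simp only [h1, h2]
  rw [Finset.prod_univ_sum, Fintype.piFinset_univ]

theorem integrable_pi_paramMeasure {k n : ℕ} {f : (Fin n → Fin k × ℝ) → ℂ} :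
    Integrable f (Measure.pi fun _ => paramMeasure k) ↔
      ∀ ε, Integrable fun t => f (labelled ε t) := by
  rw [pi_paramMeasure_eq_sum, integrable_finsetSum_measure]
  simp only [Finset.mem_univ, true_imp_iff, (measurableEmbedding_labelled _).integrable_map_iff]
  rfl

theorem integral_pi_paramMeasure {k n : ℕ} {f : (Fin n → Fin k × ℝ) → ℂ}
    (hf : Integrable f (Measure.pi fun _ => paramMeasure k)) :
    ∫ p, f p ∂(Measure.pi fun _ => paramMeasure k) = ∑ ε, ∫ t, f (labelled ε t) := by
  rw [pi_paramMeasure_eq_sum] at hf ⊢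
  rw [integral_finsetSum_measure fun i _ => (integrable_finsetSum_measure.1 hf i (by simp))]
  simp only [(measurableEmbedding_labelled _).integral_map]

/-- Distribution of coordinates over two blocks. -/
def blockEquiv {m n : ℕ} (e : Fin m ⊕ Fin m ≃ Fin n) :
    (Fin m → ℝ) × (Fin m → ℝ) ≃ᵐ (Fin n → ℝ) :=
  (MeasurableEquiv.sumPiEquivProdPi fun _ : Fin m ⊕ Fin m => ℝ).symm.trans
    (MeasurableEquiv.piCongrLeft (fun _ => ℝ) e)

theorem measurePreserving_blockEquiv {m n : ℕ} (e : Fin m ⊕ Fin m ≃ Fin n) :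
    MeasurePreserving (blockEquiv e) volume volume :=
  (volume_measurePreserving_piCongrLeft (fun _ => ℝ) e).comp
    (volume_measurePreserving_sumPiEquivProdPi_symm fun _ => ℝ)

theorem blockEquiv_apply {m n : ℕ} (e : Fin m ⊕ Fin m ≃ Fin n) (z : (Fin m → ℝ) × (Fin m → ℝ))
    (i : Fin m ⊕ Fin m) : blockEquiv e z (e i) = Sum.elim z.1 z.2 i := by
  have h := MeasurableEquiv.piCongrLeft_apply_apply e (β := fun _ => ℝ)
    ((MeasurableEquiv.sumPiEquivProdPi fun _ : Fin m ⊕ Fin m => ℝ).symm z) i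
  refine h.trans ?_
  cases i <;> rfl

/-! ### Determinants -/

theorem det_fromBlocks_zero_diag {m : ℕ} (A B : Matrix (Fin m) (Fin m) ℂ) :
    (Matrix.fromBlocks 0 B A 0).det = (-1) ^ m * (A.det * B.det) := by
  have h1 : Matrix.fromBlocks 0 B A 0 =
      Matrix.fromBlocks B 0 0 A * Matrix.fromBlocks 0 1 1 0 := by
    simp [Matrix.fromBlocks_multiply]
  have h2 : (Matrix.fromBlocks 0 1 1 0 : Matrix (Fin m ⊕ Fin m) (Fin m ⊕ Fin m) ℂ).det =
      (-1) ^ m := by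
    -- A unipotent factor brings the block swap to a matrix with an invertible corner, whose Schur
    -- complement is `-1`.
    have h3 : (Matrix.fromBlocks 1 1 0 1 * Matrix.fromBlocks 0 1 1 0 :
        Matrix (Fin m ⊕ Fin m) (Fin m ⊕ Fin m) ℂ) = Matrix.fromBlocks 1 1 1 0 := by
      simp [Matrix.fromBlocks_multiply]
    have h4 := congrArg Matrix.det h3
    rw [Matrix.det_mul, Matrix.det_fromBlocks_zero₂₁, Matrix.det_fromBlocks_one₁₁] at h4
    simpa [Matrix.det_neg] using h4
  rw [h1, Matrix.det_mul, h2, Matrix.det_fromBlocks_zero₂₁]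
  ring

/-- A permutation with a nonzero product must exchange the two label classes, so these have the same
size. -/
theorem det_eq_zero_of_unbalanced {n : ℕ} (ε : Fin n → Fin 2) (N : Matrix (Fin n) (Fin n) ℂ)
    (hN : ∀ i j, ε i = ε j → N i j = 0) (hε : 2 * (Finset.univ.filter (ε · = 0)).card ≠ n) :
    N.det = 0 := by
  rw [Matrix.det_apply]
  refine Finset.sum_eq_zero fun σ _ => ?_
  suffices ∃ i, ε (σ i) = ε i by
    obtain ⟨i, hi⟩ := this
    rw [Finset.prod_eq_zero (f := fun i => N (σ i) i) (Finset.mem_univ i) (hN _ _ hi), smul_zero]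
  by_contra! h
  apply hε
  have h1 : (Finset.univ.filter fun i => ε (σ i) = 0).card =
      (Finset.univ.filter (ε · = 0)).card :=
    Finset.card_equiv σ fun i => by simp
  have h2 : (Finset.univ.filter fun i => ε (σ i) = 0) = Finset.univ.filter fun i => ¬ ε i = 0 := by
    refine Finset.filter_congr fun i _ => ?_
    have := h i
    omega
  have h3 := Finset.card_filter_add_card_filter_not (s := Finset.univ) (fun i => ε i = 0)
  rw [← h2, h1, Finset.card_univ, Fintype.card_fin] at h3
  omega

theorem card_balanced (m : ℕ) :
    (Finset.univ.filter fun ε : Fin (m + m) → Fin 2 =>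
      (Finset.univ.filter (ε · = 0)).card = m).card = (m + m).choose m := by
  rw [← Finset.card_fin (m + m), ← Finset.card_powersetCard, Finset.card_fin]
  refine Finset.card_nbij' (fun ε => Finset.univ.filter (ε · = 0))
    (fun S i => if i ∈ S then 0 else 1) ?_ ?_ ?_ ?_
  · intro ε hε
    simpa [Finset.mem_powersetCard] using hε
  · intro S hS
    simpa [Finset.mem_powersetCard] using hS
  · intro ε _
    funext i
    by_cases h : ε i = 0
    · simp [h]
    · simp only [Finset.mem_filter, Finset.mem_univ, true_and, h, if_false]
      omega
  · intro S _
    ext i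
    simp

theorem exists_blockEquiv {m : ℕ} (ε : Fin (m + m) → Fin 2)
    (hε : (Finset.univ.filter (ε · = 0)).card = m) :
    ∃ e : Fin m ⊕ Fin m ≃ Fin (m + m), ∀ i, ε (e i) = Sum.elim (fun _ => 0) (fun _ => 1) i := by
  have h0 : Fintype.card {i // ε i = 0} = m := by rw [Fintype.card_subtype, hε]
  have h1 : Fintype.card {i // ¬ ε i = 0} = m := by
    rw [Fintype.card_subtype_compl, h0, Fintype.card_fin]
    omega
  let e₀ := (Fintype.equivFinOfCardEq h0).symm
  let e₁ := (Fintype.equivFinOfCardEq h1).symm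
  refine ⟨(Equiv.sumCongr e₀ e₁).trans (Equiv.sumCompl fun i => ε i = 0), ?_⟩
  rintro (i | i)
  · simpa using (e₀ i).2
  · have := (e₁ i).2
    simp only [Equiv.trans_apply, Equiv.sumCongr_apply, Sum.map_inr, Equiv.sumCompl_apply_inr,
      Sum.elim_inr]
    omega

/-- Andréief's identity. -/
theorem integral_det_mul_det {m : ℕ} {f g : Fin m → ℝ → ℂ}
    (h : ∀ i j, Integrable fun x => f i x * g j x) :
    ∫ x : Fin m → ℝ, (Matrix.of fun i j => f i (x j)).det * (Matrix.of fun i j => g j (x i)).det =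
      m.factorial * (Matrix.of fun i j => ∫ x, f i x * g j x).det := by
  set G : Matrix (Fin m) (Fin m) ℂ := Matrix.of fun i j => ∫ x, f i x * g j x with hG
  have h1 : ∀ x : Fin m → ℝ,
      (Matrix.of fun i j => f i (x j)).det * (Matrix.of fun i j => g j (x i)).det =
        ∑ σ : Equiv.Perm (Fin m), ∑ τ : Equiv.Perm (Fin m),
          ((Equiv.Perm.sign σ : ℤ) : ℂ) * ((Equiv.Perm.sign τ : ℤ) : ℂ) *
            ∏ i, (f (σ i) (x i) * g (τ i) (x i)) := fun x => by
    rw [← Matrix.det_transpose (Matrix.of fun i j => g j (x i)), Matrix.det_apply',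
      Matrix.det_apply', Finset.sum_mul_sum]
    refine Finset.sum_congr rfl fun σ _ => Finset.sum_congr rfl fun τ _ => ?_
    simp only [Matrix.transpose_apply, Matrix.of_apply, Finset.prod_mul_distrib]
    ring
  have hi : ∀ σ τ : Equiv.Perm (Fin m),
      Integrable fun x : Fin m → ℝ => ∏ i, (f (σ i) (x i) * g (τ i) (x i)) := fun σ τ =>
    Integrable.fintype_prod (f := fun i x => f (σ i) x * g (τ i) x) fun i => h (σ i) (τ i)
  simp only [h1]
  rw [integral_finsetSum _ fun σ _ => integrable_finsetSum _ fun τ _ => (hi σ τ).const_mul _]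
  -- For fixed `σ`, the sum over `τ` is the determinant of `G` with rows permuted by `σ`; its sign
  -- cancels the sign of `σ`, so each of the `m!` choices of `σ` contributes `det G`.
  have h2 : ∀ σ : Equiv.Perm (Fin m), (∫ x : Fin m → ℝ, ∑ τ : Equiv.Perm (Fin m),
      ((Equiv.Perm.sign σ : ℤ) : ℂ) * ((Equiv.Perm.sign τ : ℤ) : ℂ) *
        ∏ i, (f (σ i) (x i) * g (τ i) (x i))) = G.det := fun σ => by
    rw [integral_finsetSum _ fun τ _ => (hi σ τ).const_mul _]
    have h3 : ∀ τ : Equiv.Perm (Fin m), (∫ x : Fin m → ℝ,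
        ((Equiv.Perm.sign σ : ℤ) : ℂ) * ((Equiv.Perm.sign τ : ℤ) : ℂ) *
          ∏ i, (f (σ i) (x i) * g (τ i) (x i))) =
        ((Equiv.Perm.sign σ : ℤ) : ℂ) * (((Equiv.Perm.sign τ : ℤ) : ℂ) *
          ∏ i, (G.submatrix σ id).transpose (τ i) i) := fun τ => by
      rw [integral_const_mul, integral_fintype_prod_volume_eq_prod
        (f := fun i x => f (σ i) x * g (τ i) x), mul_assoc]
      rfl
    simp only [h3]
    rw [← Finset.mul_sum, ← Matrix.det_apply', Matrix.det_transpose, Matrix.det_permute, ← mul_assoc]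
    rw [← Int.cast_mul, ← Units.val_mul, Int.units_mul_self]
    simp
  simp only [h2]
  rw [Finset.sum_const, Finset.card_univ, Fintype.card_perm, Fintype.card_fin, nsmul_eq_mul]

/-! ### Fredholm determinants of off-diagonal kernels -/

/-- The line elements are absorbed into the columns, which leaves a kernel on the parameter space.
-/
theorem fredholmMinor_eq_det {k : ℕ} (Γ : Fin k → ℝ → ℂ) (K : ℂ → ℂ → ℂ) (n : ℕ)
    (p : Fin n → Fin k × ℝ) :
    fredholmMinor Γ K n p = (Matrix.of fun i j =>
      K (point Γ (p i)) (point Γ (p j)) * lineElement Γ (p j)).det := by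
  rw [fredholmMinor, mul_comm, ← Matrix.det_mul_row]
  simp only [Matrix.of_apply, mul_comm]

variable {N : Fin 2 × ℝ → Fin 2 × ℝ → ℂ}

/-- The off-diagonal part of the minor of a kernel on two curves. -/
def blockMinor (N : Fin 2 × ℝ → Fin 2 × ℝ → ℂ) (m : ℕ) (z : (Fin m → ℝ) × (Fin m → ℝ)) : ℂ :=
  (Matrix.of fun i j => N (1, z.2 i) (0, z.1 j)).det *
    (Matrix.of fun i j => N (0, z.1 i) (1, z.2 j)).det

theorem det_labelled_blockEquiv (hN : ∀ i x y, N (i, x) (i, y) = 0) {m n : ℕ} {ε : Fin n → Fin 2}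
    (e : Fin m ⊕ Fin m ≃ Fin n) (he : ∀ i, ε (e i) = Sum.elim (fun _ => 0) (fun _ => 1) i)
    (z : (Fin m → ℝ) × (Fin m → ℝ)) :
    (Matrix.of fun i j => N (labelled ε (blockEquiv e z) i) (labelled ε (blockEquiv e z) j)).det =
      (-1) ^ m * blockMinor N m z := by
  rw [blockMinor, ← det_fromBlocks_zero_diag, ← Matrix.det_submatrix_equiv_self e]
  congr 1
  ext i j
  rcases i with i | i <;> rcases j with j | j <;>
    simp [labelled, he, blockEquiv_apply, hN]

theorem integrable_blockMinor (hN : ∀ i x y, N (i, x) (i, y) = 0) {m : ℕ}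
    (hInt : Integrable (fun p : Fin (m + m) → Fin 2 × ℝ =>
      (Matrix.of fun i j => N (p i) (p j)).det) (Measure.pi fun _ => paramMeasure 2)) :
    Integrable (blockMinor N m) := by
  set ε : Fin (m + m) → Fin 2 := fun i => Sum.elim (fun _ => 0) (fun _ => 1) (finSumFinEquiv.symm i)
  have he : ∀ i : Fin m ⊕ Fin m, ε (finSumFinEquiv i) = Sum.elim (fun _ => 0) (fun _ => 1) i :=
    fun i => by simp [ε]
  have h1 := (measurePreserving_blockEquiv finSumFinEquiv).integrable_comp_emb
    (blockEquiv finSumFinEquiv).measurableEmbedding |>.2 (integrable_pi_paramMeasure.1 hInt ε)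
  have h2 := h1.const_mul ((-1 : ℂ) ^ m)
  refine h2.congr (Eventually.of_forall fun z => ?_)
  simp only [Function.comp_apply, det_labelled_blockEquiv hN finSumFinEquiv he]
  rw [← mul_assoc, ← mul_pow]
  simp

theorem integral_det_eq_zero (hN : ∀ i x y, N (i, x) (i, y) = 0) {n : ℕ} (hn : ∀ m, n ≠ m + m) :
    ∫ p : Fin n → Fin 2 × ℝ, (Matrix.of fun i j => N (p i) (p j)).det
      ∂(Measure.pi fun _ => paramMeasure 2) = 0 := by
  have : ∀ p : Fin n → Fin 2 × ℝ, (Matrix.of fun i j => N (p i) (p j)).det = 0 := fun p => by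
    refine det_eq_zero_of_unbalanced (fun i => (p i).1) _ (fun i j hij => ?_) fun h =>
      hn _ (h.symm.trans (two_mul _))
    rw [Matrix.of_apply, show p i = ((p i).1, (p i).2) from rfl,
      show p j = ((p j).1, (p j).2) from rfl]
    rw [hij, hN]
  simp [this]

/-- Unbalanced labellings contribute nothing. Each balanced one becomes, after a measure preserving
relabelling of coordinates, the same block integral, and there are `(2m).choose m` of them. -/
theorem integral_det_eq_choose_mul (hN : ∀ i x y, N (i, x) (i, y) = 0) {m : ℕ}
    (hInt : Integrable (fun p : Fin (m + m) → Fin 2 × ℝ =>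
      (Matrix.of fun i j => N (p i) (p j)).det) (Measure.pi fun _ => paramMeasure 2)) :
    ∫ p : Fin (m + m) → Fin 2 × ℝ, (Matrix.of fun i j => N (p i) (p j)).det
      ∂(Measure.pi fun _ => paramMeasure 2) =
    (m + m).choose m * ((-1) ^ m * ∫ z, blockMinor N m z) := by
  have h1 : ∀ ε : Fin (m + m) → Fin 2,
      ∫ t, (Matrix.of fun i j => N (labelled ε t i) (labelled ε t j)).det =
        if (Finset.univ.filter (ε · = 0)).card = m then (-1) ^ m * ∫ z, blockMinor N m z else 0 := by
    intro ε
    split_ifs with h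
    · obtain ⟨e, he⟩ := exists_blockEquiv ε h
      rw [← (measurePreserving_blockEquiv e).integral_comp (blockEquiv e).measurableEmbedding]
      simp only [det_labelled_blockEquiv hN e he]
      rw [integral_const_mul]
    · have : ∀ t, (Matrix.of fun i j => N (labelled ε t i) (labelled ε t j)).det = 0 := fun t =>
        det_eq_zero_of_unbalanced ε _
          (fun i j hij => by rw [Matrix.of_apply, labelled, labelled, hij, hN]) (by omega)
      simp [this]
  rw [integral_pi_paramMeasure hInt]
  simp only [h1]
  rw [← Finset.sum_filter, Finset.sum_const, card_balanced, nsmul_eq_mul]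

end

section

/-! ### The Fredholm determinants of the hard edge kernels -/

variable {m : Model} {s : ℝ} {γ γ' : ℝ → ℂ}

theorem MKernel_left_left {F : ℂ → ℂ} (h : IsContourPair F γ γ') (t t' : ℝ) :
    MKernel F s γ γ' (γ t) (γ t') = 0 := by
  have hn : ∀ t, γ t ∉ range γ' := fun t => disjoint_left.1 h.disjoint ⟨t, rfl⟩
  simp [MKernel_eq, indicator_of_notMem (hn _)]

theorem MKernel_right_right {F : ℂ → ℂ} (h : IsContourPair F γ γ') (t t' : ℝ) :
    MKernel F s γ γ' (γ' t) (γ' t') = 0 := by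
  have hn : ∀ t, γ' t ∉ range γ := fun t => disjoint_right.1 h.disjoint ⟨t, rfl⟩
  simp [MKernel_eq, indicator_of_notMem (hn _)]

theorem MKernel_right_left {F : ℂ → ℂ} (hs : 0 < s) (h : IsContourPair F γ γ') (t t' : ℝ) :
    MKernel F s γ γ' (γ' t') (γ t) = AKernel F s (γ' t') (γ t) := by
  have hn : ∀ t, γ' t ∉ range γ := fun t => disjoint_right.1 h.disjoint ⟨t, rfl⟩
  simp [MKernel_eq, indicator_of_notMem (hn _), AKernel_eq _ hs]

theorem MKernel_left_right {F : ℂ → ℂ} (h : IsContourPair F γ γ') (t t' : ℝ) :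
    MKernel F s γ γ' (γ t) (γ' t') = BKernel F (γ t) (γ' t') := by
  have hn : ∀ t, γ t ∉ range γ' := fun t => disjoint_left.1 h.disjoint ⟨t, rfl⟩
  simp [MKernel_eq, indicator_of_notMem (hn _), BKernel_eq]

theorem measurable_MKernel (m : Model) (hs : 0 < s) (h : IsContourPair m.F γ γ') :
    Measurable fun q : (Fin 2 × ℝ) × (Fin 2 × ℝ) =>
      MKernel m.F s γ γ' (point ![γ, γ'] q.1) (point ![γ, γ'] q.2) := by
  have hp : Measurable (point ![γ, γ']) := measurable_from_prod_countable_right fun i => by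
    fin_cases i
    · exact h.contour_left.continuous.measurable
    · exact h.contour_right.continuous.measurable
  have hp1 : Measurable fun q : (Fin 2 × ℝ) × (Fin 2 × ℝ) => point ![γ, γ'] q.1 :=
    hp.comp measurable_fst
  have hp2 : Measurable fun q : (Fin 2 × ℝ) × (Fin 2 × ℝ) => point ![γ, γ'] q.2 :=
    hp.comp measurable_snd
  have hL := h.contour_left.measurableEmbedding.measurableSet_range
  have hR := h.contour_right.measurableEmbedding.measurableSet_range
  simp only [MKernel_eq]
  exact (((((measurable_ofReal_cpow hs).indicator hR).comp hp1).mul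
    (((measurable_leftFactor m hs).indicator hL).comp hp2)).div (hp1.sub hp2)).add
    ((((measurable_const.indicator hL).comp hp1).mul
    (((measurable_rightFactor m).indicator hR).comp hp2)).div (hp2.sub hp1))

theorem fredholmConvergent_MKernel (m : Model) (hs : 0 < s) (h : IsContourPair m.F γ γ') :
    FredholmConvergent ![γ, γ'] (MKernel m.F s γ γ') := by
  obtain ⟨κ, hκ, hA, hB⟩ := exists_norm_AKernel_mul_BKernel_le m hs h
  refine fredholmConvergent_of_le (measurable_MKernel m hs h)
    -- Index 0 is `γ`, index 1 is `γ'`. On the diagonal `α * β` is `κ ‖leftFactor‖` on `γ` and `κ ‖s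
    -- ^ z * rightFactor‖` on `γ'`, both integrable by rapid decrease.
    (α := fun p => ![κ, κ * s ^ (γ' p.2).re] p.1)
    (β := fun p => ![‖leftFactor m.F s (γ p.2)‖, ‖rightFactor m.F (γ' p.2)‖] p.1) ?_ ?_ ?_ ?_
  · rintro ⟨i, t⟩
    fin_cases i
    · exact hκ.le
    · exact (by positivity : 0 ≤ κ * s ^ (γ' t).re)
  · rintro ⟨i, t⟩
    fin_cases i
    · exact norm_nonneg _
    · exact norm_nonneg _
  · rintro ⟨i, t⟩ ⟨j, t'⟩
    fin_cases i <;> fin_cases j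
    · simp only [point, Fin.zero_eta, Matrix.cons_val_zero, MKernel_left_left h, norm_zero]
      positivity
    · simpa [point, MKernel_left_right h] using hB t t'
    · simpa [point, MKernel_right_left hs h, mul_assoc] using hA t' t
    · have h0 : ‖MKernel m.F s γ γ' (γ' t) (γ' t')‖ ≤
          κ * s ^ (γ' t).re * ‖rightFactor m.F (γ' t')‖ := by
        rw [MKernel_right_right h, norm_zero]
        positivity
      exact h0
  · have hL := (rapidlyDecreasing_leftFactor hs h).integrable h.contour_left
      (measurable_leftFactor m hs)
    have hR' : RapidlyDecreasing γ' fun v => (s : ℂ) ^ v * rightFactor m.F v := by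
      refine (rapidlyDecreasing_rightFactor h).of_norm_le (abs_nonneg (Real.log s)) one_pos
        fun t => ?_
      rw [norm_mul, one_mul]
      gcongr
      exact norm_ofReal_cpow_le hs _
    have hR := hR'.integrable h.contour_right
      ((measurable_ofReal_cpow hs).mul (measurable_rightFactor m))
    refine integrable_paramMeasure.2 fun i => ?_
    fin_cases i
    · refine (hL.norm.const_mul κ).congr (Eventually.of_forall fun t => ?_)
      simp [lineElement, mul_assoc]
    · refine (hR.norm.const_mul κ).congr (Eventually.of_forall fun t => ?_)
      simp [lineElement, mul_assoc, norm_cpow_eq_rpow_re_of_pos hs]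

/-- The kernel of `M` in terms of the parameters. -/
def MParam (F : ℂ → ℂ) (s : ℝ) (γ γ' : ℝ → ℂ) (p q : Fin 2 × ℝ) : ℂ :=
  MKernel F s γ γ' (point ![γ, γ'] p) (point ![γ, γ'] q) * lineElement ![γ, γ'] q

theorem MParam_self {F : ℂ → ℂ} (h : IsContourPair F γ γ') (i : Fin 2) (x y : ℝ) :
    MParam F s γ γ' (i, x) (i, y) = 0 := by
  fin_cases i
  · simp [MParam, point, MKernel_left_left h]
  · simp [MParam, point, MKernel_right_right h]

/-- Andréief's identity in the variables on `γ`: the entries `∫ A(z_i, u) B(u, z_j) du` are those of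
`H`. -/
theorem integral_blockMinor_MParam (m : Model) (hs : 0 < s) (h : IsContourPair m.F γ γ') (n : ℕ)
    (y : Fin n → ℝ) :
    ∫ x, blockMinor (MParam m.F s γ γ') n (x, y) =
      n.factorial * fredholmMinor ![γ'] (HOpKernel m.F s γ) n (labelled (fun _ => 0) y) := by
  have hInt : ∀ i j, Integrable fun x => (AKernel m.F s (γ' (y i)) (γ x) * deriv γ x) *
      (BKernel m.F (γ x) (γ' (y j)) * deriv γ' (y j)) := fun i j => by
    have h1 := contourIntegrable_single.1 (contourIntegrable_HIntegrand m hs h (y j) (y i))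
    refine (h1.const_mul ((2 * Real.pi * I)⁻¹ * deriv γ' (y j))).congr
      (Eventually.of_forall fun x => ?_)
    have h2 := AKernel_mul_BKernel m.F s (γ' (y i)) (γ x) (γ' (y j))
    simp only
    linear_combination (-deriv γ x * deriv γ' (y j)) * h2
  have h1 := integral_det_mul_det hInt
  rw [fredholmMinor_eq_det]
  refine Eq.trans ?_ (h1.trans ?_)
  · refine integral_congr_ae (Eventually.of_forall fun x => ?_)
    simp [blockMinor, MParam, point, lineElement, MKernel_left_right h, MKernel_right_left hs h]
  · congr 2
    ext i j
    simp only [Matrix.of_apply, labelled, point, lineElement, Matrix.cons_val_fin_one]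
    rw [HOpKernel_eq, ← integral_mul_const]
    refine integral_congr_ae (Eventually.of_forall fun x => ?_)
    simp only
    ring

theorem integrable_det_MParam (m : Model) (hs : 0 < s) (h : IsContourPair m.F γ γ') (n : ℕ) :
    Integrable (fun p : Fin n → Fin 2 × ℝ =>
      (Matrix.of fun i j => MParam m.F s γ γ' (p i) (p j)).det)
        (Measure.pi fun _ => paramMeasure 2) := by
  refine ((fredholmConvergent_MKernel m hs h).1 n).congr (Eventually.of_forall fun p => ?_)
  exact fredholmMinor_eq_det _ _ _ _

/-- No separate estimate for `H`: up to `n!`, its minor is a partial integral of the block minor of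
`M`, hence integrable by Fubini. -/
theorem integrable_fredholmMinor_HOpKernel (m : Model) (hs : 0 < s) (h : IsContourPair m.F γ γ')
    (n : ℕ) : Integrable (fredholmMinor ![γ'] (HOpKernel m.F s γ) n)
      (Measure.pi fun _ => paramMeasure 1) := by
  refine integrable_pi_paramMeasure.2 fun ε => ?_
  have hb := integrable_blockMinor (MParam_self h) (integrable_det_MParam m hs h (n + n))
  have h1 := (Integrable.integral_prod_right hb).const_mul ((n.factorial : ℂ)⁻¹)
  refine h1.congr (Eventually.of_forall fun y => ?_)
  simp only [integral_blockMinor_MParam m hs h]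
  rw [inv_mul_cancel_left₀ (by exact_mod_cast n.factorial_ne_zero), Subsingleton.elim ε]

theorem fredholmTerm_MKernel_eq_zero {F : ℂ → ℂ} (h : IsContourPair F γ γ') {n : ℕ}
    (hn : ∀ k, n ≠ k + k) : fredholmTerm ![γ, γ'] (MKernel F s γ γ') n = 0 := by
  have h1 := integral_det_eq_zero (N := MParam F s γ γ') (MParam_self h) hn
  simp only [fredholmTerm, fredholmMinor_eq_det]
  simp only [MParam] at h1
  rw [h1, mul_zero]

/-- The constants match because `(2n).choose n * n! / (2n)! = 1 / n!`, while the block determinant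
supplies the sign `(-1) ^ n`. -/
theorem fredholmTerm_MKernel_add_self (m : Model) (hs : 0 < s) (h : IsContourPair m.F γ γ')
    (n : ℕ) : fredholmTerm ![γ, γ'] (MKernel m.F s γ γ') (n + n) =
      fredholmTerm ![γ'] (HOpKernel m.F s γ) n := by
  have hInt := integrable_det_MParam m hs h (n + n)
  have hb := integrable_blockMinor (MParam_self h) hInt
  have h1 := integral_det_eq_choose_mul (MParam_self h) hInt
  have h2 : ∫ z, blockMinor (MParam m.F s γ γ') n z = n.factorial *
      ∫ p, fredholmMinor ![γ'] (HOpKernel m.F s γ) n p ∂(Measure.pi fun _ => paramMeasure 1) := by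
    rw [Measure.volume_eq_prod, integral_prod_symm _ hb,
      integral_pi_paramMeasure (integrable_fredholmMinor_HOpKernel m hs h n),
      Fintype.sum_unique, ← integral_const_mul]
    refine integral_congr_ae (Eventually.of_forall fun y => ?_)
    simp only [integral_blockMinor_MParam m hs h]
    rw [Subsingleton.elim (default : Fin n → Fin 1)]
  rw [h2] at h1
  have h3 : ∫ p, fredholmMinor ![γ, γ'] (MKernel m.F s γ γ') (n + n) p
      ∂(Measure.pi fun _ => paramMeasure 2) = ((n + n).choose n : ℂ) * ((-1) ^ n *
        (n.factorial * ∫ p, fredholmMinor ![γ'] (HOpKernel m.F s γ) n p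
          ∂(Measure.pi fun _ => paramMeasure 1))) := by
    rw [← h1]
    exact integral_congr_ae (Eventually.of_forall fun p => fredholmMinor_eq_det _ _ _ _)
  rw [fredholmTerm, fredholmTerm, h3]
  have h4 : (((n + n).choose n : ℕ) : ℂ) * n.factorial * n.factorial = (n + n).factorial := by
    exact_mod_cast Nat.add_choose_mul_factorial_mul_factorial n n
  have h5 : (n.factorial : ℂ) ≠ 0 := by exact_mod_cast n.factorial_ne_zero
  have h6 : ((n + n).factorial : ℂ) ≠ 0 := by exact_mod_cast (n + n).factorial_ne_zero
  have h7 : (-1 : ℂ) ^ (n + n) = 1 := by rw [Even.neg_one_pow ⟨n, rfl⟩]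
  rw [h7]
  field_simp
  rw [← h4]
  ring

theorem injective_add_self : Function.Injective fun n : ℕ => n + n := fun a b hab => by
  simp only at hab
  omega

theorem fredholmConvergent_HOpKernel (m : Model) (hs : 0 < s) (h : IsContourPair m.F γ γ') :
    FredholmConvergent ![γ'] (HOpKernel m.F s γ) := by
  refine ⟨integrable_fredholmMinor_HOpKernel m hs h, ?_⟩
  have := (fredholmConvergent_MKernel m hs h).2.comp_injective injective_add_self
  refine this.congr fun n => ?_
  simp only [Function.comp_apply, fredholmTerm_MKernel_add_self m hs h]

/-- The series for `M` is supported on even indices, and reindexing it along `n ↦ n + n` gives the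
series for `H`. -/
theorem fredholmDet_HOpKernel_eq (m : Model) (hs : 0 < s) (h : IsContourPair m.F γ γ') :
    fredholmDet ![γ'] (HOpKernel m.F s γ) = fredholmDet ![γ, γ'] (MKernel m.F s γ γ') := by
  have h1 := injective_add_self.tsum_eq (f := fredholmTerm ![γ, γ'] (MKernel m.F s γ γ'))
    fun n hn => by
      by_contra hne
      exact hn (fredholmTerm_MKernel_eq_zero h fun k hk => hne ⟨k, hk.symm⟩)
  rw [fredholmDet, fredholmDet, ← h1]
  simp only [fredholmTerm_MKernel_add_self m hs h]

theorem fVec_dotProduct_gVec_self {F : ℂ → ℂ} (h : IsContourPair F γ γ') (u : ℂ) :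
    fVec s γ γ' u ⬝ᵥ gVec F s γ γ' u = 0 := by
  rw [fVec, gVec]
  simp only [dotProduct, Fin.sum_univ_two, Pi.smul_apply, Matrix.cons_val_zero, Matrix.cons_val_one,
    smul_eq_mul]
  by_cases h1 : u ∈ range γ
  · simp [indicator_of_notMem (disjoint_left.1 h.disjoint h1)]
  · simp [indicator_of_notMem h1]

end

end HardEdge

end

theorem proposition2p2 (m : HardEdge.Model) (s : ℝ) (hs : 0 < s) (γ γ' : ℝ → ℂ)
    (hγ : HardEdge.IsContourPair m.F γ γ') :
    -- the integrals defining the kernel of `H` converge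
    (∀ v ∈ Set.range γ', ∀ z ∈ Set.range γ',
      HardEdge.ContourIntegrable ![γ] (HardEdge.HIntegrand m.F s v z)) ∧
    -- the kernel of `M` is integrable in the sense of Its, Izergin, Korepin and Slavnov
    (∀ u : ℂ, HardEdge.fVec s γ γ' u ⬝ᵥ HardEdge.gVec m.F s γ γ' u = 0) ∧
    -- both Fredholm determinants are well defined, and they are equal
    HardEdge.FredholmConvergent ![γ'] (HardEdge.HOpKernel m.F s γ) ∧
    HardEdge.FredholmConvergent ![γ, γ'] (HardEdge.MKernel m.F s γ γ') ∧
    HardEdge.fredholmDet ![γ'] (HardEdge.HOpKernel m.F s γ) =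
      HardEdge.fredholmDet ![γ, γ'] (HardEdge.MKernel m.F s γ γ') ∧
    -- `M` is the block operator with entries `A`, `B`, which are trace class, and `H = A ∘ B`
    ∀ σ : ℝ, s ≤ σ →
      ∃ (A : Lp ℂ 2 (HardEdge.arcMeasure γ) →L[ℂ] Lp ℂ 2 (HardEdge.weightedArcMeasure σ γ'))
        (B : Lp ℂ 2 (HardEdge.weightedArcMeasure σ γ') →L[ℂ] Lp ℂ 2 (HardEdge.arcMeasure γ))
        (H : Lp ℂ 2 (HardEdge.weightedArcMeasure σ γ') →L[ℂ]
          Lp ℂ 2 (HardEdge.weightedArcMeasure σ γ'))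
        (M : Lp ℂ 2 (HardEdge.arcMeasure γ + HardEdge.weightedArcMeasure σ γ') →L[ℂ]
          Lp ℂ 2 (HardEdge.arcMeasure γ + HardEdge.weightedArcMeasure σ γ')),
        HardEdge.IsIntegralOperator ![γ] (HardEdge.AKernel m.F s) A ∧
        HardEdge.IsIntegralOperator ![γ'] (HardEdge.BKernel m.F) B ∧
        HardEdge.IsIntegralOperator ![γ'] (HardEdge.HOpKernel m.F s γ) H ∧
        HardEdge.IsIntegralOperator ![γ, γ'] (HardEdge.MKernel m.F s γ γ') M ∧
        HardEdge.IsTraceClass A ∧ HardEdge.IsTraceClass B ∧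
        HardEdge.IsTraceClass H ∧ HardEdge.IsTraceClass M ∧
        H = A ∘L B ∧
        ∀ (φ : Lp ℂ 2 (HardEdge.arcMeasure γ + HardEdge.weightedArcMeasure σ γ'))
          (φ₁ : Lp ℂ 2 (HardEdge.arcMeasure γ))
          (φ₂ : Lp ℂ 2 (HardEdge.weightedArcMeasure σ γ')),
          φ =ᵐ[HardEdge.arcMeasure γ] φ₁ →
          φ =ᵐ[HardEdge.weightedArcMeasure σ γ'] φ₂ →
            M φ =ᵐ[HardEdge.weightedArcMeasure σ γ'] A φ₁ ∧
            M φ =ᵐ[HardEdge.arcMeasure γ] B φ₂ := by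
  refine ⟨?_, HardEdge.fVec_dotProduct_gVec_self hγ,
    HardEdge.fredholmConvergent_HOpKernel m hs hγ, HardEdge.fredholmConvergent_MKernel m hs hγ,
    HardEdge.fredholmDet_HOpKernel_eq m hs hγ, fun σ hsσ => ?_⟩
  · rintro _ ⟨τ, rfl⟩ _ ⟨t, rfl⟩
    exact HardEdge.contourIntegrable_HIntegrand m hs hγ τ t
  · obtain ⟨A, B, M, hA, hB, hM, hAt, hBt, hMt⟩ :=
      HardEdge.exists_isTraceClass_operators m hs hγ hsσ
    exact ⟨A, B, A ∘L B, M, hA, hB,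
      HardEdge.isIntegralOperator_comp m hs hγ (hs.trans_le hsσ) hA hB, hM, hAt, hBt,
      hAt.comp B, hMt, rfl, fun φ φ₁ φ₂ h₁ h₂ =>
        HardEdge.isIntegralOperator_MKernel_apply m hs hγ (hs.trans_le hsσ) hA hB hM φ φ₁ φ₂ h₁ h₂⟩
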